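/- **Setting.** Let $P$ be the law of $O=(\tilde T,\tilde\Delta,A,X)$ with $\tilde T\in\mathbb R$, $\tilde\Delta\in\{0,1,2\}$ ($0$ means censored), $A\in\{0,1\}$, $X\in\mathcal X$, and let $t^*>0$. Assume that, for $\delta\in\{0,1,2\}$, there are measurable hazard functions $\lambda_\delta(t\mid a,x)\ge 0$ ($\lambda_0$ also written $\lambda_C$) with $\Lambda_\delta(t\mid a,x)=\int_0^t\lambda_\delta(s\mid a,x)\,ds<\infty$ for $t\le t^*$ and $$P(\tilde T\le t,\tilde\Delta=\delta\mid A,X)=\int_0^t P(\tilde T\ge s\mid A,X)\,\Lambda_\delta(ds\mid A,X),\qquad 0\le t\le t^*,$$ and let $\pi(a\mid x)=P(A=a\mid X=x)$. Write $\Lambda_C=\Lambda_0$. For any value $\nu=(\Lambda_1,\Lambda_2,\Lambda_C,\pi)$ of the nuisance parameter, where the cumulative hazards are nondecreasing, right-continuous, zero at time $0$ and finite on $[0,t^*]$, put $S(t\mid a,x)=\prod_{s\le t}\{1-(\Lambda_1+\Lambda_2)(ds\mid a,x)\}$ and $S_C(t\mid a,x)=\prod_{s\le t}\{1-\Lambda_C(ds\mid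 a,x)\}$ (product integrals; if the cumulative hazards are continuous, these are $\exp(-\Lambda_1-\Lambda_2)$ and $\exp(-\Lambda_C)$), and, for $i,j\in\{1,2\}$, $$F_j(t\mid a,x)=\int_0^t S(s-\mid a,x)\,\Lambda_j(ds\mid a,x),\qquad \tau_j(x)=\int_0^{t^*}\{F_j(u\mid 1,x)-F_j(u\mid 0,x)\}\,du,$$ $$H_{ij}(s,t\mid a,x)=\int_s^t\Big\{\mathbb 1(i=j)+\frac{F_j(s\mid a,x)-F_j(u\mid a,x)}{S(s\mid a,x)}\Big\}du,$$ $$\varphi_j(\nu)(O)=\tau_j(X)+\Big(\frac{\mathbb 1(A=1)}{\pi(1\mid X)}-\frac{\mathbb 1(A=0)}{\pi(0\mid X)}\Big)\sum_{i=1,2}\int_0^{t^*}\frac{H_{ij}(s,t^*\mid A,X)}{S_C(s\mid A,X)}\,M_i(ds\mid A,X),$$ where $M_i(ds\mid a,x)=N_i(ds)-\mathbb 1(\tilde T\ge s)\Lambda_i(ds\mid a,x)$ and $N_i(t)=\mathbb 1(\tilde T\le t,\tilde\Delta=i)$. Let $\nu_0$ be the nuisance parameter of $P$ (unhatted quantities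 below belong to $\nu_0$). The cause-$j$ average treatment effect on life-years lost is $\psi_j=E\{\tau_j(X)\}$, and $\tilde\psi_j(O)=\varphi_j(\nu_0)(O)-\psi_j$. **Cross-fitting.** Let $O_1,O_2,\dots$ be i.i.d. with law $P$. For each $n$, let $i_1,\dots,i_n$ be i.i.d. uniform on $\{1,\dots,K\}$ ($K\ge 1$), independent of the data, and $\mathcal T_k=\{m\le n: i_m=k\}$. For each $k$, let $\hat\nu_{-k}$ be an estimate of $\nu_0$, jointly measurable in the data and $x$, that depends only on the fold labels and on the $O_m$, $m\le n$, with $i_m\ne k$. Put $$\hat\psi_j^{CF}=\frac1n\sum_{k=1}^K\sum_{m\in\mathcal T_k}\varphi_j(\hat\nu_{-k})(O_m).$$ **Assumption on $\hat\nu$.** (i) There is $\eta>0$, not depending on $n$, such that (almost surely, for every $n$) $S,\hat S,S_C,\hat S_C,\pi,\hat\pi$ all exceed $\eta$ on $[0,t^*]\times\{0,1\}\times\mathcal X$. (ii) For $a=0,1$ and each of $\Lambda=\Lambda_1,\Lambda_2,\Lambda_C$, $$E\big[\sup_{s\le t^*}|\hat\Lambda(s\mid a,X)-\Lambda(s\mid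 a,X)|^2\big]=o_p(1),\qquad E\big[|\hat\pi(a\mid X)-\pi(a\mid X)|^2\big]=o_p(1).$$ (iii) For $a=0,1$, $$E\Big\{\sum_{i=1,2}\int_0^{t^*}S(s\mid a,X)\hat H_{ij}(s,t^*\mid a,X)\Big(1-\frac{\pi(a\mid X)S_C(s\mid a,X)}{\hat\pi(a\mid X)\hat S_C(s\mid a,X)}\Big)d[\hat\Lambda_i(s\mid a,X)-\Lambda_i(s\mid a,X)]\Big\}=o_p(n^{-1/2}).$$ In (ii) and (iii) the expectation is over $X$ with $\hat\nu$ held fixed. **Theorem.** Let $j\in\{1,2\}$. If $\hat\nu_{-k}$ satisfies this assumption for every $k=1,\dots,K$, then $\hat\psi_j^{CF}$ is asymptotically linear with influence function $\tilde\psi_j$, that is, $E\tilde\psi_j(O)=0$, $E\tilde\psi_j(O)^2<\infty$ and $$\hat\psi_j^{CF}-\psi_j=\frac1n\sum_{m=1}^n\tilde\psi_j(O_m)+o_p(n^{-1/2}),$$ and hence $$\sqrt n\,(\hat\psi_j^{CF}-\psi_j)\xrightarrow{d}\mathcal N\big(0,E\tilde\psi_j(O)^2\big).$$ -/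

import Mathlib

open MeasureTheory ProbabilityTheory Filter Topology Set
open scoped ENNReal NNReal

noncomputable section

namespace LifeYearsLost

/-- An observation `O = (T̃, Δ̃, A, X)`: the observed time, the observed event indicator
(`0` is censoring, `1` and `2` are the two causes), the treatment arm (`0` or `1`) and the
covariates. -/
abbrev Obs (𝒳 : Type*) : Type _ := ℝ × Fin 3 × Fin 2 × 𝒳

namespace Obs

variable {𝒳 : Type*}

/-- The observed time `T̃`. -/
def time (o : Obs 𝒳) : ℝ := o.1

/-- The observed event indicator `Δ̃`. -/
def event (o : Obs 𝒳) : Fin 3 := o.2.1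

/-- The treatment arm `A`. -/
def arm (o : Obs 𝒳) : Fin 2 := o.2.2.1

/-- The covariates `X`. -/
def cov (o : Obs 𝒳) : 𝒳 := o.2.2.2

end Obs

/-- The product integral `∏_{s ∈ B} (1 - μ(ds))`, that is
`exp (-μᶜ(B)) * ∏_{s ∈ B} (1 - μ{s})`, where `μᶜ` is `μ` without its atoms. -/
def prodIntegral (μ : Measure ℝ) (B : Set ℝ) : ℝ :=
  Real.exp (-(μ.real B - ∑' s : B, μ.real {(s : ℝ)})) * ∏' s : B, (1 - μ.real {(s : ℝ)})

/-- For a measure without atoms the product integral is `exp (-μ(B))`. -/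
theorem prodIntegral_of_noAtoms (μ : Measure ℝ) [NullSingletonClass μ] (B : Set ℝ) :
    prodIntegral μ B = Real.exp (-μ.real B) := by
  simp [prodIntegral, Measure.real]

/-- A value of the nuisance parameter `ν = (Λ₁, Λ₂, Λ_C, π)`. The cumulative hazards are given
by the measures `Λ_δ(dt | a, x)`, `δ = 0` being the censoring hazard, and `ps a x` is
`π(a | x)`. -/
structure Nuisance (𝒳 : Type*) where
  haz : Fin 3 → Fin 2 → 𝒳 → Measure ℝ
  ps : Fin 2 → 𝒳 → ℝ

namespace Nuisance

variable {𝒳 : Type*} (ν : Nuisance 𝒳)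

/-- The cumulative hazard `Λ_δ(t | a, x)`. -/
def cumHaz (δ : Fin 3) (t : ℝ) (a : Fin 2) (x : 𝒳) : ℝ := (ν.haz δ a x).real (Ioc 0 t)

/-- The all-cause hazard measure `Λ₁ + Λ₂`. -/
def allCause (a : Fin 2) (x : 𝒳) : Measure ℝ := ν.haz 1 a x + ν.haz 2 a x

/-- The survival function `S(t | a, x)`. -/
def surv (t : ℝ) (a : Fin 2) (x : 𝒳) : ℝ := prodIntegral (ν.allCause a x) (Ioc 0 t)

/-- The left limit `S(t- | a, x)` of the survival function. -/
def survLeft (t : ℝ) (a : Fin 2) (x : 𝒳) : ℝ := prodIntegral (ν.allCause a x) (Ioo 0 t)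

/-- The survival function `S_C(t | a, x)` of the censoring time. -/
def censSurv (t : ℝ) (a : Fin 2) (x : 𝒳) : ℝ := prodIntegral (ν.haz 0 a x) (Ioc 0 t)

/-- For continuous cumulative hazards, `S = exp (-Λ₁ - Λ₂)`. -/
theorem surv_of_noAtoms (t : ℝ) (a : Fin 2) (x : 𝒳) [NullSingletonClass (ν.haz 1 a x)]
    [NullSingletonClass (ν.haz 2 a x)] (h₁ : ν.haz 1 a x (Ioc 0 t) < ∞) (h₂ : ν.haz 2 a x (Ioc 0 t) < ∞) :
    ν.surv t a x = Real.exp (-ν.cumHaz 1 t a x - ν.cumHaz 2 t a x) := by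
  have : NullSingletonClass (ν.allCause a x) := ⟨fun s => by simp [allCause]⟩
  rw [surv, prodIntegral_of_noAtoms, allCause, measureReal_add_apply h₁.ne h₂.ne, cumHaz, cumHaz]
  congr 1
  ring

/-- The cumulative incidence function `F_j(t | a, x) = ∫₀ᵗ S(s- | a, x) Λ_j(ds | a, x)`. The
causes `1, 2` are indexed by `j : Fin 2` through `j.succ`. -/
def cif (j : Fin 2) (t : ℝ) (a : Fin 2) (x : 𝒳) : ℝ :=
  ∫ s in Ioc 0 t, ν.survLeft s a x ∂(ν.haz j.succ a x)

/-- The life-years lost `L_j(0, t* | a, x)`. -/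
def lifeYearsLost (j : Fin 2) (tstar : ℝ) (a : Fin 2) (x : 𝒳) : ℝ :=
  ∫ u in (0 : ℝ)..tstar, ν.cif j u a x

/-- The contrast `τ_j(x) = L_j(0, t* | 1, x) - L_j(0, t* | 0, x)`. -/
def cate (j : Fin 2) (tstar : ℝ) (x : 𝒳) : ℝ :=
  ν.lifeYearsLost j tstar 1 x - ν.lifeYearsLost j tstar 0 x

/-- `H_ij(s, t | a, x) = ∫ₛᵗ 1(i = j) + (F_j(s | a, x) - F_j(u | a, x)) / S(s | a, x) du`. -/
def H (i j : Fin 2) (s t : ℝ) (a : Fin 2) (x : 𝒳) : ℝ :=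
  ∫ u in s..t, ((if i = j then 1 else 0) + (ν.cif j s a x - ν.cif j u a x) / ν.surv s a x)

/-- The integral `∫₀ᵗ f(s) M_i(ds | A, X)` with
`M_i(ds | a, x) = N_i(ds) - 1(T̃ ≥ s) Λ_i(ds | a, x)` and `N_i(t) = 1(T̃ ≤ t, Δ̃ = i)`. -/
def martingaleIntegral (i : Fin 2) (f : ℝ → ℝ) (t : ℝ) (o : Obs 𝒳) : ℝ :=
  (if o.event = i.succ ∧ o.time ∈ Ioc 0 t then f o.time else 0) -
    ∫ s in Ioc 0 (min t o.time), f s ∂(ν.haz i.succ o.arm o.cov)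

/-- The uncentered influence function `φ_j(ν)(O)`. -/
def phi (j : Fin 2) (tstar : ℝ) (o : Obs 𝒳) : ℝ :=
  ν.cate j tstar o.cov +
    ((if o.arm = 1 then 1 else 0) / ν.ps 1 o.cov - (if o.arm = 0 then 1 else 0) / ν.ps 0 o.cov) *
      ∑ i : Fin 2, ν.martingaleIntegral i
        (fun s => ν.H i j s tstar o.arm o.cov / ν.censSurv s o.arm o.cov) tstar o

/-- `S`, `S_C` and `π` exceed `η` on `[0, t*] × {0, 1} × 𝒳`. -/
def Positive (η tstar : ℝ) : Prop :=
  ∀ t ∈ Icc 0 tstar, ∀ a x, η < ν.surv t a x ∧ η < ν.censSurv t a x ∧ η < ν.ps a x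

/-- The cumulative hazards are finite on `[0, t*]`. -/
def FiniteHazards (tstar : ℝ) : Prop := ∀ δ a x, ν.haz δ a x (Ioc 0 tstar) < ∞

end Nuisance

variable {𝒳 : Type*}

/-- The nuisance parameter with hazard functions `lam δ t a x = λ_δ(t | a, x)` and propensity
score `ps`: `Λ_δ(dt | a, x) = λ_δ(t | a, x) dt`. -/
def trueNuisance (lam : Fin 3 → ℝ → Fin 2 → 𝒳 → ℝ≥0) (ps : Fin 2 → 𝒳 → ℝ) : Nuisance 𝒳 where
  haz δ a x := volume.withDensity fun t => (lam δ t a x : ℝ≥0∞)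
  ps := ps

/-- `lam` are the conditional hazard functions on `[0, t*]` (of censoring and of the two causes)
and `ps` is the propensity score of the distribution `P` of the observation. -/
structure IsTrueNuisance [MeasurableSpace 𝒳] (P : Measure (Obs 𝒳)) (tstar : ℝ)
    (lam : Fin 3 → ℝ → Fin 2 → 𝒳 → ℝ≥0) (ps : Fin 2 → 𝒳 → ℝ) : Prop where
  measurable_lam : ∀ δ a, Measurable fun p : ℝ × 𝒳 => lam δ p.1 a p.2
  measurable_ps : ∀ a, Measurable (ps a)
  finite : (trueNuisance lam ps).FiniteHazards tstar
  /-- Given `(A, X)`, the process `N_δ(t) - ∫₀ᵗ 1(T̃ ≥ s) Λ_δ(ds | A, X)` has mean zero, i.e.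
  `P(T̃ ∈ dt, Δ̃ = δ | A, X) = P(T̃ ≥ t | A, X) λ_δ(t | A, X) dt`. -/
  hazard : ∀ δ, ∀ t ∈ Icc 0 tstar, ∀ B : Set (Fin 2 × 𝒳), MeasurableSet B →
    P {o | o.time ≤ t ∧ o.event = δ ∧ (o.arm, o.cov) ∈ B} =
      ∫⁻ o in {o | (o.arm, o.cov) ∈ B},
        (trueNuisance lam ps).haz δ o.arm o.cov (Ioc 0 (min t o.time)) ∂P
  /-- `ps a x` is a version of `P(A = a | X = x)`. -/
  propensity : ∀ a, ∀ B : Set 𝒳, MeasurableSet B →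
    P {o | o.arm = a ∧ o.cov ∈ B} = ∫⁻ o in {o | o.cov ∈ B}, ENNReal.ofReal (ps a o.cov) ∂P

/-- The target parameter `ψ_j(P) = E {L_j(0, t* | 1, X) - L_j(0, t* | 0, X)}`, where `ν₀` is the
nuisance parameter of `P`. -/
def psi [MeasurableSpace 𝒳] (P : Measure (Obs 𝒳)) (ν₀ : Nuisance 𝒳) (j : Fin 2) (tstar : ℝ) : ℝ :=
  ∫ o, ν₀.cate j tstar o.cov ∂P

/-- The function `ψ̃_j(O; ν₀) = φ_j(ν₀)(O) - ψ_j(P)`. -/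
def psiTilde [MeasurableSpace 𝒳] (P : Measure (Obs 𝒳)) (ν₀ : Nuisance 𝒳) (j : Fin 2) (tstar : ℝ)
    (o : Obs 𝒳) : ℝ :=
  ν₀.phi j tstar o - psi P ν₀ j tstar

/-- The second-order remainder for arm `a`:
`E ∑ᵢ ∫₀^{t*} S Ĥ_ij(s, t*) (1 - π S_C / (π̂ Ŝ_C)) d(Λ̂_i - Λ_i)(s)`, the expectation being over
the covariates of a new observation, with `ν'` in the role of the (fixed) estimate. -/
def remainder [MeasurableSpace 𝒳] (P : Measure (Obs 𝒳)) (ν₀ ν' : Nuisance 𝒳) (j : Fin 2)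
    (tstar : ℝ) (a : Fin 2) : ℝ :=
  let w : Fin 2 → 𝒳 → ℝ → ℝ := fun i x s =>
    ν₀.surv s a x * ν'.H i j s tstar a x *
      (1 - ν₀.ps a x * ν₀.censSurv s a x / (ν'.ps a x * ν'.censSurv s a x))
  ∫ o, ∑ i : Fin 2,
    ((∫ s in Ioc 0 tstar, w i o.cov s ∂(ν'.haz i.succ a o.cov)) -
      ∫ s in Ioc 0 tstar, w i o.cov s ∂(ν₀.haz i.succ a o.cov)) ∂P

/-- The assumption on a sequence `νhat n` of (random) nuisance estimators: positivity,
consistency, and a remainder of order `o_p(n^{-1/2})`. -/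
structure NuisanceAssumption {Ω : Type*} [MeasurableSpace Ω] [MeasurableSpace 𝒳] (μ : Measure Ω)
    (P : Measure (Obs 𝒳)) (ν₀ : Nuisance 𝒳) (j : Fin 2) (tstar : ℝ)
    (νhat : ℕ → Ω → Nuisance 𝒳) : Prop where
  positivity : ∃ η : ℝ, 0 < η ∧ ν₀.Positive η tstar ∧ ∀ n, ∀ᵐ ω ∂μ, (νhat n ω).Positive η tstar
  hazard_consistent : ∀ (δ : Fin 3) (a : Fin 2), TendstoInMeasure μ
    (fun n ω => ∫⁻ o, (⨆ s ∈ Icc 0 tstar,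
      ‖(νhat n ω).cumHaz δ s a o.cov - ν₀.cumHaz δ s a o.cov‖ₑ) ^ 2 ∂P)
    atTop (fun _ => (0 : ℝ≥0∞))
  ps_consistent : ∀ a : Fin 2, TendstoInMeasure μ
    (fun n ω => ∫⁻ o, ‖(νhat n ω).ps a o.cov - ν₀.ps a o.cov‖ₑ ^ 2 ∂P)
    atTop (fun _ => (0 : ℝ≥0∞))
  remainder_small : ∀ a : Fin 2, TendstoInMeasure μ
    (fun (n : ℕ) ω => √(n : ℝ) * remainder P ν₀ (νhat n ω) j tstar a) atTop (fun _ => (0 : ℝ))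

/-- A procedure for estimating the nuisance parameter with `K` folds: for every sample size `n`
and fold `k`, it maps the fold labels and the data to an estimate `ν̂₋ₖ`. -/
abbrev Learner (𝒳 : Type*) (K : ℕ) : Type _ :=
  (n : ℕ) → Fin K → (Fin n → Fin K) → (Fin n → Obs 𝒳) → Nuisance 𝒳

/-- The estimates are jointly measurable in data and covariates, their cumulative hazards are
finite on `[0, t*]`, and the `k`-th one uses only the observations outside fold `k`. -/
structure Learner.IsLeaveOut [MeasurableSpace 𝒳] {K : ℕ} (alg : Learner 𝒳 K) (tstar : ℝ) :
    Prop where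
  measurable_haz : ∀ n k s δ a,
    Measurable fun p : (Fin n → Obs 𝒳) × 𝒳 => (alg n k s p.1).haz δ a p.2
  measurable_ps : ∀ n k s a,
    Measurable fun p : (Fin n → Obs 𝒳) × 𝒳 => (alg n k s p.1).ps a p.2
  finite : ∀ n k s d, (alg n k s d).FiniteHazards tstar
  leaveOut : ∀ n k s d d', (∀ i, s i ≠ k → d i = d' i) → alg n k s d = alg n k s d'

/-- The cross-fitted estimator `(1/n) ∑ₖ ∑_{i ∈ 𝒯ₖ} φ_j(ν̂₋ₖ)(O_i)` for fold labels `s` and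
data `d`. -/
def crossFit {K : ℕ} (alg : Learner 𝒳 K) (j : Fin 2) (tstar : ℝ) (n : ℕ) (s : Fin n → Fin K)
    (d : Fin n → Obs 𝒳) : ℝ :=
  (1 / (n : ℝ)) * ∑ k : Fin K, ∑ i : Fin n with s i = k, (alg n k s d).phi j tstar (d i)

end LifeYearsLost

end

open LifeYearsLost

/-!
The influence function `φ(ν)` is a debiased estimating function: its mean at an estimate `ν'` of the
true nuisance parameter `ν` differs from the parameter only by the remainders of the two arms, which
are assumed to be `o_p(n^{-1/2})`. Since, moreover, `φ` is continuous in `ν`, and the estimate used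
for an observation does not depend on that observation, replacing `ν` by the estimate changes the
average of `φ` by `o_p(n^{-1/2})`. The average at `ν` obeys the central limit theorem.

*Hazards with atoms.* The true cumulative hazards are continuous, but the estimates may jump, so
that survival functions are product integrals. Where these are positive, all atoms are smaller than
one and the product integral of a hazard measure `μ` is `exp (-ρ)` for a measure `ρ ≥ μ`, namely
`logHaz μ`, which enlarges the atoms of `μ` (`prodIntegral_eq_exp_neg_logHaz`). The change of
variables `r = ρ (-∞, s]` (`setIntegral_Iic_eq_intervalIntegral`) turns `exp' = exp` into the
integral equation of the reciprocal survival function. From this equation and Fubini's theorem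
follows the Duhamel equation `duhamel` for the ratio `S / S'` of two survival functions.

*Bias.* By the Duhamel equation, the integral of `S H'_ij` against the difference of the hazards,
summed over the causes `i`, is the difference of the life-years lost, without remainder
(`Nuisance.Regular.lifeYearsLost_sub`). On the other hand, given arm and covariates, the counting
processes have the compensators of the model and the probability of being at risk is `S S_C`
(`Nuisance.IsModel.integral_event`, `Nuisance.IsModel.integral_Iic_time`), so that the mean of the
inversely weighted martingale part at `ν'` is minus the integral with the additional factor
`π S_C / (π' S_C')` in the integrand. The sum of both contributions is the remainder
(`Nuisance.IsModel.integral_phi_sub_psi`). In particular `φ(ν)` is unbiased.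

*Continuity.* On `(0, T]` the integrand `H_ij / S_C` is a combination of bounded monotone functions,
and the integrals of such a function against two hazards differ by at most a multiple of the uniform
distance of the cumulative hazards, by the layer cake formula
(`abs_integral_sub_le_of_superlevel`). Together with the stability of the product integral near a
continuous hazard (`abs_exp_logHaz_sub_le`) this makes `φ` Lipschitz in the nuisance parameter, with
a constant that depends only on `T` and the positivity bound
(`Nuisance.Regular.exists_abs_phi_sub_le`). Hence consistency of the estimates in mean square gives
`E (φ(ν') - φ(ν))² = o_p(1)`.

*Sample splitting.* Given the data outside a fold, the terms `φ(ν')(O_m) - φ(ν)(O_m)` of this fold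
are independent and identically distributed. Their centered sum therefore has a variance of at most
the number of terms times `E (φ(ν') - φ(ν))²` (`integral_sq_sum_le`), and is `o_p(n^{1/2})`
(`tendstoInMeasure_crossFit`).

The argument needs bounds and measurability at every realization of the data, whereas positivity of
the estimates holds almost surely. The estimates are therefore replaced by trivial ones at the data
and covariates where positivity fails (`Nuisance.regularize`). The set of these is measurable, since
positivity of the survival function on `[0, T]` can be read off the atoms of the hazard and the
value at `T` (`forall_lt_prodIntegral_iff`).
-/

namespace LifeYearsLost

noncomputable section

/-! ### Change of variables along the distribution function of a measure -/

/-- The generalized inverse `r ↦ inf {s | r ≤ ρ (-∞, s]}` of the distribution function of `ρ`. It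
is meaningful for `0 < r ≤ ρ(ℝ)` only. -/
def quantile (ρ : Measure ℝ) (r : ℝ) : ℝ := sInf {s | r ≤ ρ.real (Iic s)}

theorem countable_atoms (ρ : Measure ℝ) [IsFiniteMeasure ρ] :
    {s : ℝ | ρ {s} ≠ 0}.Countable := by
  have := Measure.countable_meas_pos_of_disjoint_iUnion (μ := ρ) (As := fun s : ℝ => {s})
    (fun i => measurableSet_singleton i) (fun i j h => by simpa using h)
  simpa [pos_iff_ne_zero] using this

/-- The Galois connection between the quantile function and the distribution function, which is
right-continuous. -/
theorem quantile_le_iff {ρ : Measure ℝ} [IsFiniteMeasure ρ] {T : ℝ} (hρ : ρ (Ioc 0 T)ᶜ = 0)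
    {r : ℝ} (h0 : 0 < r) (h1 : r ≤ ρ.real univ) (s : ℝ) :
    quantile ρ r ≤ s ↔ r ≤ ρ.real (Iic s) := by
  have hne : {s | r ≤ ρ.real (Iic s)}.Nonempty := by
    refine ⟨T, h1.trans (le_of_eq ?_)⟩
    rw [← measureReal_add_measureReal_compl (measurableSet_Iic (a := T)) (μ := ρ)]
    have : ρ (Iic T)ᶜ = 0 := measure_mono_null (compl_subset_compl.2 fun x hx => hx.2) hρ
    rw [measureReal_def ρ (Iic T)ᶜ, this]
    simp
  have hbdd : BddBelow {s | r ≤ ρ.real (Iic s)} := by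
    refine ⟨0, fun s hs => ?_⟩
    by_contra hlt
    have : ρ (Iic s) = 0 := measure_mono_null (fun x hx => by
      simp only [mem_compl_iff, mem_Ioc, not_and_or, not_lt]
      exact Or.inl (hx.out.trans (not_le.1 hlt).le)) hρ
    have h2 : r ≤ ρ.real (Iic s) := hs
    rw [Measure.real, this] at h2
    simp only [ENNReal.toReal_zero] at h2
    linarith
  refine ⟨fun h => ?_, fun h => csInf_le hbdd h⟩
  have hlim : Tendsto (fun v => ρ (Iic v)) (𝓝[>] s) (𝓝 (ρ (Iic s))) := by
    have := tendsto_measure_biInter_gt (μ := ρ) (s := fun v : ℝ => Iic v) (a := s)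
      (fun _ _ => measurableSet_Iic.nullMeasurableSet) (fun i j _ hij => Iic_subset_Iic.2 hij)
      ⟨s + 1, by simp, measure_ne_top _ _⟩
    have hI : ⋂ v > s, Iic v = Iic s := by
      ext x
      simp only [mem_iInter, mem_Iic]
      exact ⟨fun h => le_of_forall_gt_imp_ge_of_dense h, fun h v hv => h.trans (le_of_lt hv)⟩
    rwa [hI] at this
  have hlim' : Tendsto (fun v => ρ.real (Iic v)) (𝓝[>] s) (𝓝 (ρ.real (Iic s))) :=
    (ENNReal.tendsto_toReal (measure_ne_top _ _)).comp hlim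
  refine ge_of_tendsto hlim' ?_
  filter_upwards [self_mem_nhdsWithin] with v hv
  obtain ⟨w, hw, hwv⟩ := exists_lt_of_csInf_lt hne (lt_of_le_of_lt h hv)
  exact le_trans hw (measureReal_mono (Iic_subset_Iic.2 hwv.le))

theorem aemeasurable_quantile (ρ : Measure ℝ) [IsFiniteMeasure ρ] {T : ℝ}
    (hρ : ρ (Ioc 0 T)ᶜ = 0) :
    AEMeasurable (quantile ρ) (volume.restrict (Ioc 0 (ρ.real univ))) := by
  refine aemeasurable_restrict_of_monotoneOn measurableSet_Ioc fun r hr r' hr' hrr' => ?_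
  rw [quantile_le_iff hρ hr.1 hr.2]
  exact hrr'.trans ((quantile_le_iff hρ hr'.1 hr'.2 _).1 le_rfl)

/-- The quantile function pushes Lebesgue measure on `(0, ρ(ℝ)]` forward to `ρ`. -/
theorem map_quantile (ρ : Measure ℝ) [IsFiniteMeasure ρ] {T : ℝ} (hρ : ρ (Ioc 0 T)ᶜ = 0) :
    (volume.restrict (Ioc 0 (ρ.real univ))).map (quantile ρ) = ρ := by
  refine (Measure.ext_of_Iic _ _ fun t => ?_)
  rw [Measure.map_apply_of_aemeasurable (aemeasurable_quantile ρ hρ) measurableSet_Iic,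
    Measure.restrict_apply₀' measurableSet_Ioc.nullMeasurableSet]
  have : quantile ρ ⁻¹' Iic t ∩ Ioc 0 (ρ.real univ) = Ioc 0 (ρ.real (Iic t)) := by
    ext r
    simp only [mem_inter_iff, mem_preimage, mem_Iic, mem_Ioc]
    constructor
    · rintro ⟨h, h0, h1⟩
      exact ⟨h0, (quantile_le_iff hρ h0 h1 t).1 h⟩
    · rintro ⟨h0, h⟩
      have h1 := h.trans (measureReal_mono (subset_univ (Iic t)))
      exact ⟨(quantile_le_iff hρ h0 h1 t).2 h, h0, h1⟩
  rw [this, Real.volume_Ioc, sub_zero, ofReal_measureReal]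

theorem measureReal_Iic_eq_add (ρ : Measure ℝ) [IsFiniteMeasure ρ] (s : ℝ) :
    ρ.real (Iic s) = ρ.real (Iio s) + ρ.real {s} := by
  rw [← Iio_union_right, measureReal_union (by simp) (measurableSet_singleton s)]

/-- A single sequence `u n ↑ s` recovers the left limit at `s` of all distribution functions
simultaneously. -/
theorem exists_seq_tendsto_measureReal_Iio (s : ℝ) : ∃ u : ℕ → ℝ, (∀ n, u n < s) ∧
    ∀ (ρ : Measure ℝ) [IsFiniteMeasure ρ],
      Tendsto (fun n => ρ.real (Iic (u n))) atTop (𝓝 (ρ.real (Iio s))) := by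
  obtain ⟨u, hu, hus, hlim⟩ := exists_seq_strictMono_tendsto s
  refine ⟨u, hus, fun ρ _ => ?_⟩
  have hU : ⋃ n, Iic (u n) = Iio s := by
    ext x
    simp only [mem_iUnion, mem_Iic, mem_Iio]
    exact ⟨fun ⟨n, hn⟩ => hn.trans_lt (hus n), fun hx =>
      ((hlim.eventually (lt_mem_nhds hx)).exists).imp fun n hn => hn.le⟩
  have ht : Tendsto (fun n => ρ (Iic (u n))) atTop (𝓝 (ρ (⋃ n, Iic (u n)))) :=
    tendsto_measure_iUnion_atTop fun m n h => Iic_subset_Iic.2 (hu.monotone h)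
  rw [hU] at ht
  exact (ENNReal.tendsto_toReal (measure_ne_top _ _)).comp ht

/-- The fibre of the quantile function over `s` is contained in the jump of the distribution
function at `s`. -/
theorem mem_Icc_of_quantile_eq {ρ : Measure ℝ} [IsFiniteMeasure ρ] {T : ℝ} (hρ : ρ (Ioc 0 T)ᶜ = 0)
    {r : ℝ} (h0 : 0 < r) (h1 : r ≤ ρ.real univ) (s : ℝ) :
    quantile ρ r = s → r ∈ Icc (ρ.real (Iio s)) (ρ.real (Iic s)) := by
  rintro rfl
  refine ⟨?_, (quantile_le_iff hρ h0 h1 _).1 le_rfl⟩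
  set s := quantile ρ r
  obtain ⟨u, hus, ht⟩ := exists_seq_tendsto_measureReal_Iio s
  refine le_of_tendsto (ht ρ) (Eventually.of_forall fun n => ?_)
  by_contra hc
  have := (quantile_le_iff hρ h0 h1 (u n)).2 (not_le.1 hc).le
  exact absurd this (not_le.2 (hus n))

/-- Change of variables `r = ρ (-∞, s]` for a finite measure `ρ` which may have atoms: at an atom
the integrand `φ` is replaced by its mean over the jump. -/
theorem setIntegral_Iic_eq_intervalIntegral {ρ : Measure ℝ} [IsFiniteMeasure ρ] {T : ℝ}
    (hρ : ρ (Ioc 0 T)ᶜ = 0) {φ g : ℝ → ℝ} (hφ : Continuous φ) (hg : Integrable g ρ)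
    (hcont : ∀ s, ρ {s} = 0 → g s = φ (ρ.real (Iic s)))
    (hjump : ∀ s, ρ {s} ≠ 0 →
      g s * ρ.real {s} = ∫ r in ρ.real (Iio s)..ρ.real (Iic s), φ r) (t : ℝ) :
    ∫ s in Iic t, g s ∂ρ = ∫ r in (0 : ℝ)..ρ.real (Iic t), φ r := by
  set q := quantile ρ with hq
  set J : Set ℝ := Ioc 0 (ρ.real (Iic t)) with hJ
  have hle : ρ.real (Iic t) ≤ ρ.real univ := measureReal_mono (subset_univ _)
  have hJsub : J ⊆ Ioc 0 (ρ.real univ) := Ioc_subset_Ioc_right hle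
  have hqm := aemeasurable_quantile ρ hρ
  have hpre : ∀ r ∈ Ioc 0 (ρ.real univ), (q r ≤ t ↔ r ∈ J) := fun r hr => by
    rw [hq, quantile_le_iff hρ hr.1 hr.2]
    exact ⟨fun h => ⟨hr.1, h⟩, fun h => h.2⟩
  have hgq : IntegrableOn (fun r => g (q r)) J := by
    have h1 : Integrable g ((volume.restrict (Ioc 0 (ρ.real univ))).map q) := by
      rwa [hq, map_quantile ρ hρ]
    exact IntegrableOn.mono_set (h1.comp_aemeasurable hqm) hJsub
  have hφJ : IntegrableOn φ J := (hφ.integrableOn_Icc).mono_set Ioc_subset_Icc_self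
  have h1 : ∫ s in Iic t, g s ∂ρ = ∫ r in J, g (q r) := by
    have hmap := map_quantile ρ hρ
    rw [← integral_indicator measurableSet_Iic]
    conv_lhs => rw [← hmap]
    rw [integral_map hqm]
    · rw [hJ, ← integral_indicator measurableSet_Ioc, ← integral_indicator measurableSet_Ioc, ← hJ]
      congr 1
      ext r
      by_cases hr : r ∈ Ioc 0 (ρ.real univ)
      · by_cases hrJ : r ∈ J
        · have : q r ∈ Iic t := (hpre r hr).2 hrJ
          simp only [indicator_of_mem hr, indicator_of_mem hrJ, ← hq, indicator_of_mem this]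
        · have : q r ∉ Iic t := fun h => hrJ ((hpre r hr).1 h)
          simp only [indicator_of_mem hr, indicator_of_notMem hrJ, ← hq, indicator_of_notMem this]
      · rw [indicator_of_notMem hr, indicator_of_notMem (fun h => hr (hJsub h))]
    · rw [hmap]
      exact (hg.indicator measurableSet_Iic).aestronglyMeasurable
  rw [h1, intervalIntegral.integral_of_le measureReal_nonneg, ← sub_eq_zero,
    ← integral_sub hgq hφJ]
  -- the difference vanishes off the plateaus of the quantile function
  set A := {s : ℝ | ρ {s} ≠ 0} with hA
  have hAc : A.Countable := countable_atoms ρ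
  have : Countable A := hAc.to_subtype
  set E : A → Set ℝ := fun s => J ∩ q ⁻¹' {(s : ℝ)} with hE
  -- on the plateau over an atom `s` the integrand is `g s - φ`, whose integral is zero by `hjump`
  have hplateau : ∀ s : ℝ, s ≤ t →
      (J ∩ q ⁻¹' {s} : Set ℝ) =ᵐ[volume] Ioc (ρ.real (Iio s)) (ρ.real (Iic s)) := by
    intro s hst
    have hsub1 : J ∩ q ⁻¹' {s} ⊆ Icc (ρ.real (Iio s)) (ρ.real (Iic s)) := by
      rintro r ⟨hr, hrs⟩
      exact mem_Icc_of_quantile_eq hρ (hJsub hr).1 (hJsub hr).2 s hrs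
    have hsub2 : Ioc (ρ.real (Iio s)) (ρ.real (Iic s)) ⊆ J ∩ q ⁻¹' {s} := by
      rintro r ⟨hr1, hr2⟩
      have hr0 : 0 < r := lt_of_le_of_lt measureReal_nonneg hr1
      have hrt : r ≤ ρ.real (Iic t) := hr2.trans (measureReal_mono (Iic_subset_Iic.2 hst))
      have hru := hrt.trans hle
      refine ⟨⟨hr0, hrt⟩, le_antisymm ((quantile_le_iff hρ hr0 hru s).2 hr2) ?_⟩
      by_contra hlt
      have h2 := (quantile_le_iff hρ hr0 hru (q r)).1 le_rfl
      have h3 : ρ.real (Iic (q r)) ≤ ρ.real (Iio s) :=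
        measureReal_mono fun x hx => lt_of_le_of_lt hx (not_le.1 hlt)
      linarith
    exact ((LE.le.eventuallyLE hsub1).trans Ioc_ae_eq_Icc.symm.le).antisymm
      (LE.le.eventuallyLE hsub2)
  have hEm : ∀ s, NullMeasurableSet (E s) volume := by
    intro s
    by_cases hst : (s : ℝ) ≤ t
    · exact measurableSet_Ioc.nullMeasurableSet.congr (hplateau s hst).symm
    · have : E s = ∅ := by
        ext r
        simp only [hE, mem_inter_iff, mem_preimage, mem_singleton_iff, mem_empty_iff_false,
          iff_false, not_and]
        intro hr hrs
        exact hst (hrs ▸ (hpre r (hJsub hr)).2 hr)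
      rw [this]
      exact nullMeasurableSet_empty
  have hEsub : (⋃ s, E s) ⊆ J := iUnion_subset fun s => inter_subset_left
  have hEint : ∀ s, ∫ r in E s, (g (q r) - φ r) = 0 := by
    intro s
    by_cases hst : (s : ℝ) ≤ t
    · have hc : ∫ r in E s, (g (q r) - φ r) = ∫ r in E s, (g s - φ r) := by
        refine setIntegral_congr_fun₀ (hEm s) fun r hr => ?_
        have : q r = s := hr.2
        simp only [this]
      rw [hc, setIntegral_congr_set (hplateau s hst),
        ← intervalIntegral.integral_of_le (measureReal_mono Iio_subset_Iic_self),
        intervalIntegral.integral_sub (by simp) (hφ.intervalIntegrable _ _),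
        intervalIntegral.integral_const, ← hjump s s.2, measureReal_Iic_eq_add]
      simp [mul_comm]
    · have : E s = ∅ := by
        ext r
        simp only [hE, mem_inter_iff, mem_preimage, mem_singleton_iff, mem_empty_iff_false,
          iff_false, not_and]
        intro hr hrs
        exact hst (hrs ▸ (hpre r (hJsub hr)).2 hr)
      simp [this]
  have hzero : ∫ r in ⋃ s, E s, (g (q r) - φ r) = 0 := by
    have hd : IntegrableOn (fun r => g (q r) - φ r) J := hgq.sub hφJ
    rw [integral_iUnion_ae hEm ?_ (hd.mono_set hEsub)]
    · simp [hEint]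
    · intro i j hij
      refine Disjoint.aedisjoint (disjoint_left.2 fun r hri hrj => hij ?_)
      exact Subtype.ext (hri.2.symm.trans hrj.2)
  rw [← hzero]
  refine setIntegral_eq_of_subset_of_ae_sdiff_eq_zero measurableSet_Ioc.nullMeasurableSet hEsub
    (Eventually.of_forall fun r hr => ?_)
  have hrJ := hJsub hr.1
  -- off the plateaus `q r` is not an atom, and `r = ρ (-∞, q r]`
  have hna : ρ {q r} = 0 := by
    by_contra hne
    exact hr.2 (mem_iUnion.2 ⟨⟨q r, hne⟩, hr.1, rfl⟩)
  rw [hcont _ hna]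
  have h2 := mem_Icc_of_quantile_eq hρ hrJ.1 hrJ.2 _ rfl
  have h3 := measureReal_Iic_eq_add ρ (q r)
  have h4 : ρ.real {q r} = 0 := by simp [Measure.real, hna]
  have : ρ.real (Iic (q r)) = r := le_antisymm (by rw [h3, h4, add_zero]; exact h2.1) h2.2
  rw [this, sub_self]

/-! ### Product integrals as exponentials -/

/-- The factor by which an atom of size `a < 1` grows when the hazard measure is replaced by the
logarithm of its product integral: `-log (1 - a) = a * atomFactor a`. -/
def atomFactor (a : ℝ) : ℝ := if a = 0 then 1 else -Real.log (1 - a) / a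

theorem atomFactor_mul_self {a : ℝ} : atomFactor a * a = -Real.log (1 - a) := by
  unfold atomFactor
  split_ifs with h
  · simp [h]
  · field_simp

theorem one_le_atomFactor {a : ℝ} (h0 : 0 ≤ a) (h1 : a < 1) : 1 ≤ atomFactor a := by
  unfold atomFactor
  split_ifs with h
  · exact le_rfl
  · have : 0 < a := lt_of_le_of_ne h0 (Ne.symm h)
    rw [le_div_iff₀ this]
    have := Real.log_le_sub_one_of_pos (by linarith : (0 : ℝ) < 1 - a)
    linarith

theorem atomFactor_sub_one_le {a : ℝ} (h0 : 0 ≤ a) (h1 : a < 1) :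
    atomFactor a - 1 ≤ a / (1 - a) := by
  unfold atomFactor
  split_ifs with h
  · simp [h]
  · have ha : 0 < a := lt_of_le_of_ne h0 (Ne.symm h)
    have hp : (0 : ℝ) < 1 - a := by linarith
    have := Real.one_sub_inv_le_log_of_pos hp
    rw [sub_le_iff_le_add, div_le_iff₀ ha]
    have h2 : (a / (1 - a) + 1) * a = (1 - a)⁻¹ - 1 := by field_simp; ring
    rw [h2]
    linarith

@[fun_prop]
theorem measurable_atomFactor : Measurable atomFactor :=
  Measurable.ite (measurableSet_eq) measurable_const (by fun_prop)

/-- The measure `ρ` with `∏_{s ∈ B} (1 - μ(ds)) = exp (-ρ(B))`, for a measure `μ` whose atoms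
are smaller than one. -/
def logHaz (μ : Measure ℝ) : Measure ℝ :=
  μ.withDensity fun s => ENNReal.ofReal (atomFactor (μ.real {s}))

theorem summable_atoms (μ : Measure ℝ) [IsFiniteMeasure μ] : Summable fun s : ℝ => μ.real {s} := by
  refine ENNReal.summable_toReal (ne_top_of_le_ne_top (measure_ne_top μ univ) ?_)
  exact (tsum_meas_le_meas_iUnion_of_disjoint μ (fun s => measurableSet_singleton s)
    (fun i j h => by simpa using h)).trans (measure_mono (subset_univ _))

theorem summable_log_atoms (μ : Measure ℝ) [IsFiniteMeasure μ] :
    Summable fun s : ℝ => Real.log (1 - μ.real {s}) := by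
  simpa [sub_eq_add_neg] using Real.summable_log_one_add_of_summable (summable_atoms μ).neg

theorem measurable_measureReal_singleton (μ : Measure ℝ) [IsFiniteMeasure μ] :
    Measurable fun s : ℝ => μ.real {s} := by
  have := measurable_measure_prodMk_left (ν := μ) (s := {p : ℝ × ℝ | p.2 = p.1})
    (measurableSet_eq_fun measurable_snd measurable_fst)
  exact this.ennreal_toReal

section

variable {μ : Measure ℝ} [IsFiniteMeasure μ]

/-- Only the atoms contribute to the difference of `logHaz μ` and `μ`. -/
theorem logHaz_apply (hμ : ∀ s, μ.real {s} < 1) {B : Set ℝ} (hB : MeasurableSet B) :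
    logHaz μ B = μ B +
      ENNReal.ofReal (∑' s : B, (-Real.log (1 - μ.real {(s : ℝ)}) - μ.real {(s : ℝ)})) := by
  have hm := measurable_measureReal_singleton μ
  have hnn : ∀ s, 0 ≤ atomFactor (μ.real {s}) - 1 := fun s =>
    sub_nonneg.2 (one_le_atomFactor measureReal_nonneg (hμ s))
  have hsum : Summable fun s : ℝ => (-Real.log (1 - μ.real {s}) - μ.real {s}) :=
    (summable_log_atoms μ).neg.sub (summable_atoms μ)
  have hsumB : Summable fun s : B => (-Real.log (1 - μ.real {(s : ℝ)}) - μ.real {(s : ℝ)}) :=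
    hsum.subtype B
  have hterm : ∀ s : ℝ, -Real.log (1 - μ.real {s}) - μ.real {s} =
      (atomFactor (μ.real {s}) - 1) * μ.real {s} := fun s => by
    rw [sub_mul, atomFactor_mul_self, one_mul]
  have hpos : ∀ s : ℝ, 0 ≤ -Real.log (1 - μ.real {s}) - μ.real {s} := fun s => by
    rw [hterm]; exact mul_nonneg (hnn s) measureReal_nonneg
  rw [logHaz, withDensity_apply _ hB]
  have h1 : ∀ s, ENNReal.ofReal (atomFactor (μ.real {s})) =
      1 + ENNReal.ofReal (atomFactor (μ.real {s}) - 1) := fun s => by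
    rw [← ENNReal.ofReal_one, ← ENNReal.ofReal_add zero_le_one (hnn s)]
    congr 1
    ring
  simp_rw [h1]
  rw [lintegral_add_left measurable_const, setLIntegral_const, one_mul]
  congr 1
  set A := {s : ℝ | μ {s} ≠ 0} with hA
  have hAc : A.Countable := countable_atoms μ
  have h2 : ∫⁻ s in B, ENNReal.ofReal (atomFactor (μ.real {s}) - 1) ∂μ =
      ∫⁻ s in B ∩ A, ENNReal.ofReal (atomFactor (μ.real {s}) - 1) ∂μ := by
    rw [← lintegral_indicator hB, ← lintegral_indicator (hB.inter hAc.measurableSet)]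
    congr 1
    ext s
    by_cases hsA : s ∈ A
    · by_cases hsB : s ∈ B <;> simp [hsA, hsB]
    · have : μ.real {s} = 0 := by
        have : μ {s} = 0 := by simpa [hA] using hsA
        simp [Measure.real, this]
      simp [hsA, this, atomFactor, indicator]
  rw [h2, lintegral_countable _ (hAc.mono inter_subset_right),
    ENNReal.ofReal_tsum_of_nonneg (fun s : B => hpos s) hsumB,
    tsum_subtype (B ∩ A) (fun s => ENNReal.ofReal (atomFactor (μ.real {s}) - 1) * μ {s}),
    tsum_subtype B (fun s => ENNReal.ofReal (-Real.log (1 - μ.real {s}) - μ.real {s}))]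
  congr 1
  ext s
  by_cases hsB : s ∈ B
  · by_cases hsA : s ∈ A
    · rw [indicator_of_mem (mem_inter hsB hsA), indicator_of_mem hsB, hterm,
        ENNReal.ofReal_mul (hnn s), ofReal_measureReal]
    · have : μ.real {s} = 0 := by
        have : μ {s} = 0 := by simpa [hA] using hsA
        simp [Measure.real, this]
      rw [indicator_of_notMem (fun h => hsA h.2), indicator_of_mem hsB]
      simp [this]
  · rw [indicator_of_notMem (fun h => hsB h.1), indicator_of_notMem hsB]

theorem isFiniteMeasure_logHaz (hμ : ∀ s, μ.real {s} < 1) : IsFiniteMeasure (logHaz μ) :=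
  ⟨by rw [logHaz_apply hμ MeasurableSet.univ]; exact ENNReal.add_lt_top.2 ⟨measure_lt_top _ _,
    ENNReal.ofReal_lt_top⟩⟩

/-- The product integral of a measure with atoms is an honest exponential, of a measure that is
countably additive in the set: this makes it amenable to the calculus of Stieltjes integrals. -/
theorem prodIntegral_eq_exp_neg_logHaz (hμ : ∀ s, μ.real {s} < 1) {B : Set ℝ}
    (hB : MeasurableSet B) : prodIntegral μ B = Real.exp (-(logHaz μ).real B) := by
  have hs1 : Summable fun s : B => μ.real {(s : ℝ)} := (summable_atoms μ).subtype B
  have hs2 : Summable fun s : B => Real.log (1 - μ.real {(s : ℝ)}) :=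
    (summable_log_atoms μ).subtype B
  have hpos : ∀ s : B, 0 ≤ -Real.log (1 - μ.real {(s : ℝ)}) - μ.real {(s : ℝ)} := fun s => by
    have := Real.log_le_sub_one_of_pos (by linarith [hμ s] : (0 : ℝ) < 1 - μ.real {(s : ℝ)})
    linarith
  rw [prodIntegral, ← Real.rexp_tsum_eq_tprod (fun s => by linarith [hμ s]) hs2, ← Real.exp_add]
  congr 1
  rw [measureReal_def (logHaz μ), logHaz_apply hμ hB,
    ENNReal.toReal_add (measure_ne_top _ _) ENNReal.ofReal_ne_top,
    ENNReal.toReal_ofReal (tsum_nonneg hpos), hs2.neg.tsum_sub hs1, tsum_neg, ← measureReal_def]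
  ring

theorem le_logHaz (hμ : ∀ s, μ.real {s} < 1) : μ ≤ logHaz μ := by
  refine Measure.le_iff.2 fun B hB => ?_
  rw [logHaz_apply hμ hB]
  exact le_self_add

end

theorem logHaz_singleton {μ : Measure ℝ} (hμ : ∀ s, μ.real {s} < 1) (s : ℝ) :
    (logHaz μ).real {s} = -Real.log (1 - μ.real {s}) := by
  have := Real.log_le_sub_one_of_pos (by linarith [hμ s] : (0 : ℝ) < 1 - μ.real {(s : ℝ)})
  have h0 : 0 ≤ μ.real {s} := measureReal_nonneg
  rw [measureReal_def, logHaz, withDensity_apply _ (measurableSet_singleton s),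
    lintegral_singleton, ENNReal.toReal_mul, ENNReal.toReal_ofReal
      (zero_le_one.trans (one_le_atomFactor h0 (hμ s))), ← measureReal_def, atomFactor_mul_self]

theorem logHaz_eq_zero {μ : Measure ℝ} {B : Set ℝ} (h : μ B = 0) : logHaz μ B = 0 :=
  withDensity_absolutelyContinuous _ _ h

/-- The reciprocal `G` of the product integral solves `G(t) = 1 + ∫_{(0, t]} G(s) μ(ds)`. -/
theorem exp_logHaz_Iic {μ : Measure ℝ} [IsFiniteMeasure μ] {T : ℝ} (hT : μ (Ioc 0 T)ᶜ = 0)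
    (hμ : ∀ s, μ.real {s} < 1) (t : ℝ) :
    Real.exp ((logHaz μ).real (Iic t)) =
      1 + ∫ s in Iic t, Real.exp ((logHaz μ).real (Iic s)) ∂μ := by
  have := isFiniteMeasure_logHaz hμ
  have hf : ∀ s, 1 ≤ atomFactor (μ.real {s}) := fun s =>
    one_le_atomFactor measureReal_nonneg (hμ s)
  have hmR : Measurable fun s => (logHaz μ).real (Iic s) :=
    Monotone.measurable fun s t hst => measureReal_mono (Iic_subset_Iic.2 hst)
  have hmA := measurable_atomFactor.comp (measurable_measureReal_singleton μ)
  have key := setIntegral_Iic_eq_intervalIntegral (ρ := logHaz μ) (T := T) (logHaz_eq_zero hT)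
    (φ := Real.exp)
    (g := fun s => Real.exp ((logHaz μ).real (Iic s)) / atomFactor (μ.real {s}))
    Real.continuous_exp ?_ ?_ ?_ t
  · rw [integral_exp, Real.exp_zero] at key
    rw [← sub_eq_iff_eq_add', ← key, logHaz, restrict_withDensity measurableSet_Iic,
      integral_withDensity_eq_integral_toReal_smul (by exact hmA.ennreal_ofReal)
        (Eventually.of_forall fun _ => ENNReal.ofReal_lt_top)]
    refine integral_congr_ae (Eventually.of_forall fun s => ?_)
    have h1 := hf s
    simp only [smul_eq_mul]
    rw [ENNReal.toReal_ofReal (by linarith)]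
    field_simp
  · refine Integrable.of_bound (C := Real.exp ((logHaz μ).real univ))
      ((hmR.exp.div hmA).aestronglyMeasurable) (Eventually.of_forall fun s => ?_)
    have h1 := hf s
    rw [Real.norm_of_nonneg (by positivity)]
    refine (div_le_self (Real.exp_pos _).le h1).trans (Real.exp_le_exp.2 ?_)
    exact measureReal_mono (subset_univ _)
  · intro s hs
    have h1 := logHaz_singleton hμ s
    rw [measureReal_def, hs, ENNReal.toReal_zero] at h1
    have h2 : μ {s} = 0 :=
      le_antisymm ((Measure.le_iff'.1 (le_logHaz hμ) {s}).trans_eq hs) zero_le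
    simp [measureReal_def μ, h2, atomFactor]
  · intro s _
    have h1 := hf s
    have h2 : Real.exp ((logHaz μ).real (Iio s)) =
        Real.exp ((logHaz μ).real (Iic s)) * (1 - μ.real {s}) := by
      rw [measureReal_Iic_eq_add, Real.exp_add, logHaz_singleton hμ, Real.exp_neg,
        Real.exp_log (by linarith [hμ s]), mul_assoc, inv_mul_cancel₀ (by linarith [hμ s]), mul_one]
    rw [integral_exp, h2, logHaz_singleton hμ, ← atomFactor_mul_self]
    have : atomFactor (μ.real {s}) ≠ 0 := by linarith
    field_simp
    ring

/-- The left limit of `exp_logHaz_Iic`. -/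
theorem exp_logHaz_Iio {μ : Measure ℝ} [IsFiniteMeasure μ] {T : ℝ} (hT : μ (Ioc 0 T)ᶜ = 0)
    (hμ : ∀ s, μ.real {s} < 1) (t : ℝ) :
    Real.exp ((logHaz μ).real (Iio t)) =
      1 + ∫ s in Iio t, Real.exp ((logHaz μ).real (Iic s)) ∂μ := by
  have := isFiniteMeasure_logHaz hμ
  have hmR : Measurable fun s => (logHaz μ).real (Iic s) :=
    Monotone.measurable fun s t hst => measureReal_mono (Iic_subset_Iic.2 hst)
  have hint : Integrable (fun s => Real.exp ((logHaz μ).real (Iic s))) μ := by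
    refine Integrable.of_bound (C := Real.exp ((logHaz μ).real univ))
      (hmR.exp.aestronglyMeasurable) (Eventually.of_forall fun s => ?_)
    rw [Real.norm_of_nonneg (by positivity)]
    exact Real.exp_le_exp.2 (measureReal_mono (subset_univ _))
  have h1 := exp_logHaz_Iic hT hμ t
  rw [← Iio_union_right (a := t), setIntegral_union (by simp) (measurableSet_singleton t)
    hint.integrableOn hint.integrableOn, integral_singleton, smul_eq_mul, Iio_union_right] at h1
  have h2 : Real.exp ((logHaz μ).real (Iio t)) =
      Real.exp ((logHaz μ).real (Iic t)) * (1 - μ.real {t}) := by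
    rw [measureReal_Iic_eq_add, Real.exp_add, logHaz_singleton hμ, Real.exp_neg,
      Real.exp_log (by linarith [hμ t]), mul_assoc, inv_mul_cancel₀ (by linarith [hμ t]), mul_one]
  linarith

/-- For a measure without atoms, `exp (c * μ(0, t])` solves the linear equation with rate `c`. -/
theorem exp_mul_Iic {μ : Measure ℝ} [IsFiniteMeasure μ] [NullSingletonClass μ] {T : ℝ}
    (hT : μ (Ioc 0 T)ᶜ = 0) {c : ℝ} (hc : c ≠ 0) (t : ℝ) :
    Real.exp (c * μ.real (Iic t)) = 1 + c * ∫ s in Iic t, Real.exp (c * μ.real (Iic s)) ∂μ := by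
  have hmR : Measurable fun s => μ.real (Iic s) :=
    Monotone.measurable fun s t hst => measureReal_mono (Iic_subset_Iic.2 hst)
  have key := setIntegral_Iic_eq_intervalIntegral hT (φ := fun r => Real.exp (c * r))
    (g := fun s => Real.exp (c * μ.real (Iic s))) (by fun_prop) ?_ (fun s _ => rfl)
    (fun s hs => absurd (measure_singleton s) hs) t
  · rw [key, intervalIntegral.integral_comp_mul_left (fun r => Real.exp r) hc]
    simp [hc]
  · refine Integrable.of_bound (C := Real.exp (|c| * μ.real univ))
      ((hmR.const_mul c).exp.aestronglyMeasurable) (Eventually.of_forall fun s => ?_)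
    rw [Real.norm_of_nonneg (by positivity)]
    refine Real.exp_le_exp.2 ?_
    have h2 : μ.real (Iic s) ≤ μ.real univ := measureReal_mono (subset_univ _)
    nlinarith [le_abs_self c, abs_nonneg c, measureReal_nonneg (μ := μ) (s := Iic s)]

/-! ### Exchanging the order of integration -/

/-- Fubini's theorem for a product integrand over a measurable set `D` of pairs. -/
theorem integral_mul_setIntegral_swap {X Y : Type*} [MeasurableSpace X] [MeasurableSpace Y]
    (α : Measure X) (β : Measure Y) [IsFiniteMeasure α] [IsFiniteMeasure β]
    {f : X → ℝ} {g : Y → ℝ} (hf : Measurable f) (hg : Measurable g) {Cf Cg : ℝ}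
    (hfC : ∀ x, |f x| ≤ Cf) (hgC : ∀ y, |g y| ≤ Cg) {D : Set (X × Y)} (hD : MeasurableSet D) :
    ∫ x, f x * (∫ y in {y | (x, y) ∈ D}, g y ∂β) ∂α =
      ∫ y, g y * (∫ x in {x | (x, y) ∈ D}, f x ∂α) ∂β := by
  have hF : Integrable (Function.uncurry fun x y => D.indicator (fun p => f p.1 * g p.2) (x, y))
      (α.prod β) := by
    refine Integrable.of_bound (C := Cf * Cg) ?_ (Eventually.of_forall fun p => ?_)
    · exact (((hf.comp measurable_fst).mul
        (hg.comp measurable_snd)).indicator hD).aestronglyMeasurable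
    · refine (norm_indicator_le_norm_self (fun q : X × Y => f q.1 * g q.2) p).trans ?_
      rw [norm_mul]
      exact mul_le_mul (hfC _) (hgC _) (norm_nonneg _) ((abs_nonneg _).trans (hfC p.1))
  have h := integral_integral_swap hF
  convert h using 2
  · ext x
    have hm : MeasurableSet {y | (x, y) ∈ D} := measurable_prodMk_left hD
    rw [← integral_indicator hm, ← integral_const_mul]
    congr 1
    ext y
    by_cases hp : (x, y) ∈ D <;> simp [hp, indicator]
  · ext y
    have hm : MeasurableSet {x | (x, y) ∈ D} := measurable_prodMk_right hD
    rw [← integral_indicator hm, ← integral_const_mul]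
    congr 1
    ext x
    by_cases hp : (x, y) ∈ D <;> simp [hp, indicator, mul_comm]

/-- Integrating the increments of `∫ b dh` over `(s, T]` weights `b` by the remaining time. -/
theorem integral_setIntegral_Ioc (h : Measure ℝ) [IsFiniteMeasure h] {T : ℝ}
    (hT : h (Ioc 0 T)ᶜ = 0) {b : ℝ → ℝ} (hb : Measurable b) {C : ℝ} (hbC : ∀ v, |b v| ≤ C)
    {s : ℝ} (hs : s ≤ T) :
    ∫ u in s..T, (∫ v in Ioc s u, b v ∂h) = ∫ v in Ioi s, (T - v) * b v ∂h := by
  have hD : MeasurableSet {p : ℝ × ℝ | s < p.2 ∧ p.2 ≤ p.1} :=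
    (measurableSet_lt measurable_const measurable_snd).inter
      (measurableSet_le measurable_snd measurable_fst)
  have key := integral_mul_setIntegral_swap (volume.restrict (Ioc s T)) h (f := fun _ => 1)
    measurable_const hb (fun _ => le_of_eq abs_one) hbC hD
  rw [intervalIntegral.integral_of_le hs]
  simp only [one_mul] at key
  refine key.trans ?_
  rw [← integral_indicator measurableSet_Ioi]
  refine integral_congr_ae ?_
  have hae : ∀ᵐ v ∂h, v ∈ Ioc 0 T := by
    rw [ae_iff]
    exact hT
  filter_upwards [hae] with v hv
  by_cases hsv : s < v
  · have hset : {u | (u, v) ∈ {p : ℝ × ℝ | s < p.2 ∧ p.2 ≤ p.1}} = Ici v := by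
      ext u; simp [hsv]
    simp only [mem_ofPred_eq] at hset ⊢
    rw [hset, indicator_of_mem (mem_Ioi.2 hsv), Measure.restrict_restrict measurableSet_Ici]
    have hI : Ici v ∩ Ioc s T = Icc v T := by
      ext u
      simp only [mem_inter_iff, mem_Ici, mem_Ioc, mem_Icc]
      exact ⟨fun ⟨h1, _, h3⟩ => ⟨h1, h3⟩, fun ⟨h1, h2⟩ => ⟨h1, hsv.trans_le h1, h2⟩⟩
    rw [hI]
    simp [hv.2, mul_comm]
  · have hset : {u | (u, v) ∈ {p : ℝ × ℝ | s < p.2 ∧ p.2 ≤ p.1}} = ∅ := by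
      ext u; simp [hsv]
    simp only [mem_ofPred_eq] at hset ⊢
    rw [hset, indicator_of_notMem (by simpa using hsv)]
    simp

theorem bounded_exp_Iic (ρ : Measure ℝ) [IsFiniteMeasure ρ] (c : ℝ) (s : ℝ) :
    |Real.exp (c * ρ.real (Iic s))| ≤ Real.exp (|c| * ρ.real univ) := by
  rw [abs_of_pos (Real.exp_pos _)]
  refine Real.exp_le_exp.2 ?_
  have h2 : ρ.real (Iic s) ≤ ρ.real univ := measureReal_mono (subset_univ _)
  nlinarith [le_abs_self c, abs_nonneg c, measureReal_nonneg (μ := ρ) (s := Iic s)]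

theorem measurable_measureReal_Iic (ρ : Measure ℝ) [IsFiniteMeasure ρ] :
    Measurable fun s => ρ.real (Iic s) :=
  Monotone.measurable fun _ _ hst => measureReal_mono (Iic_subset_Iic.2 hst)

/-- The Duhamel equation for the ratio `S / S'` of the survival functions of a hazard measure
`μ` without atoms and a hazard measure `μ'`. -/
theorem duhamel {μ μ' : Measure ℝ} [IsFiniteMeasure μ] [IsFiniteMeasure μ'] [NullSingletonClass μ]
    {T : ℝ} (hT : μ (Ioc 0 T)ᶜ = 0) (hT' : μ' (Ioc 0 T)ᶜ = 0) (hμ' : ∀ s, μ'.real {s} < 1)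
    (v : ℝ) :
    ∫ s in Iio v, Real.exp (-μ.real (Iic s)) * Real.exp ((logHaz μ').real (Iic s)) ∂μ' -
      ∫ s in Iio v, Real.exp (-μ.real (Iic s)) * Real.exp ((logHaz μ').real (Iic s)) ∂μ =
    Real.exp (-μ.real (Iic v)) * Real.exp ((logHaz μ').real (Iio v)) - 1 := by
  have hfin := isFiniteMeasure_logHaz hμ'
  set S : ℝ → ℝ := fun s => Real.exp (-μ.real (Iic s)) with hS
  set G : ℝ → ℝ := fun s => Real.exp ((logHaz μ').real (Iic s)) with hG
  have hSm : Measurable S := (measurable_measureReal_Iic μ).neg.exp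
  have hGm : Measurable G := (measurable_measureReal_Iic _).exp
  have hSC : ∀ s, |S s| ≤ Real.exp (|(-1)| * μ.real univ) := fun s => by
    simpa [hS] using bounded_exp_Iic μ (-1) s
  have hGC : ∀ s, |G s| ≤ Real.exp (|1| * (logHaz μ').real univ) := fun s => by
    simpa [hG] using bounded_exp_Iic (logHaz μ') 1 s
  have hSeq : ∀ s, S s = 1 - ∫ r in Iic s, S r ∂μ := fun s => by
    have := exp_mul_Iic hT (c := -1) (by norm_num) s
    simp only [neg_one_mul] at this
    rw [sub_eq_add_neg]
    exact this
  have hSv : ∫ r in Iio v, S r ∂μ = 1 - S v := by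
    rw [hSeq v, ← setIntegral_congr_set Iio_ae_eq_Iic]
    ring
  have hGeq : ∀ s, G s = 1 + ∫ r in Iic s, G r ∂μ' := exp_logHaz_Iic hT' hμ'
  have hGv : Real.exp ((logHaz μ').real (Iio v)) = 1 + ∫ r in Iio v, G r ∂μ' :=
    exp_logHaz_Iio hT' hμ' v
  have hSi : ∀ (α : Measure ℝ) [IsFiniteMeasure α], Integrable S α := fun α _ =>
    Integrable.of_bound hSm.aestronglyMeasurable _ (Eventually.of_forall hSC)
  have hGi : ∀ (α : Measure ℝ) [IsFiniteMeasure α], Integrable G α := fun α _ =>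
    Integrable.of_bound hGm.aestronglyMeasurable _ (Eventually.of_forall hGC)
  set α := ∫ r in Iio v, S r ∂μ with hα
  set β := ∫ r in Iio v, G r ∂μ' with hβ
  have hSG : ∀ (α : Measure ℝ) [IsFiniteMeasure α], Integrable (fun s => S s * G s) α := fun α _ =>
    (hGi α).bdd_mul hSm.aestronglyMeasurable (Eventually.of_forall hSC)
  -- the first integral, with `S` replaced by its integral equation and the order exchanged
  have hD : MeasurableSet {p : ℝ × ℝ | p.2 ≤ p.1} :=
    measurableSet_le measurable_snd measurable_fst
  have hswap := integral_mul_setIntegral_swap (μ'.restrict (Iio v)) (μ.restrict (Iio v)) hGm hSm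
    hGC hSC hD
  have hL : ∀ s ∈ Iio v, ∫ r in {r | (s, r) ∈ {p : ℝ × ℝ | p.2 ≤ p.1}}, S r ∂(μ.restrict (Iio v)) =
      1 - S s := by
    intro s hs
    have : {r | (s, r) ∈ {p : ℝ × ℝ | p.2 ≤ p.1}} = Iic s := rfl
    rw [this, Measure.restrict_restrict measurableSet_Iic,
      inter_eq_self_of_subset_left (Iic_subset_Iio.2 hs), hSeq s]
    ring
  have hR : ∀ r ∈ Iio v, ∫ s in {s | (s, r) ∈ {p : ℝ × ℝ | p.2 ≤ p.1}}, G s ∂(μ'.restrict (Iio v)) =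
      β - G r + 1 + G r * μ'.real {r} := by
    intro r hr
    have h1 : {s | (s, r) ∈ {p : ℝ × ℝ | p.2 ≤ p.1}} = Ici r := rfl
    have h2 : Ici r ∩ Iio v = Ico r v := rfl
    rw [h1, Measure.restrict_restrict measurableSet_Ici, h2]
    have h3 : ∫ s in Iio v, G s ∂μ' = ∫ s in Iio r, G s ∂μ' + ∫ s in Ico r v, G s ∂μ' := by
      rw [← setIntegral_union (by
        rw [disjoint_left]; intro x hx hx2; exact absurd hx2.1 (not_le.2 hx)) measurableSet_Ico
        (hGi _).integrableOn (hGi _).integrableOn, Iio_union_Ico_eq_Iio hr.le]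
    have h4 : ∫ s in Iic r, G s ∂μ' = ∫ s in Iio r, G s ∂μ' + G r * μ'.real {r} := by
      rw [← Iio_union_right (a := r), setIntegral_union (by simp) (measurableSet_singleton r)
        (hGi _).integrableOn (hGi _).integrableOn, integral_singleton, smul_eq_mul, mul_comm]
    have h5 := hGeq r
    linarith
  have hA : ∫ s in Iio v, G s * (1 - S s) ∂μ' =
      ∫ r in Iio v, S r * (β - G r + 1 + G r * μ'.real {r}) ∂μ := by
    rw [← setIntegral_congr_fun measurableSet_Iio
        (fun s hs => congrArg (G s * ·) (hL s hs)), hswap,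
      setIntegral_congr_fun measurableSet_Iio (fun r hr => congrArg (S r * ·) (hR r hr))]
  -- `μ` does not charge the countably many atoms of `μ'`
  have hnull : ∀ᵐ r ∂μ, μ'.real {r} = 0 := by
    rw [ae_iff]
    refine measure_mono_null ?_ ((countable_atoms μ').measure_zero μ)
    intro r hr hr2
    exact hr (by simp [measureReal_def, hr2])
  have hA2 : ∫ r in Iio v, S r * (β - G r + 1 + G r * μ'.real {r}) ∂μ =
      (β + 1) * α - ∫ r in Iio v, S r * G r ∂μ := by
    have : ∫ r in Iio v, S r * (β - G r + 1 + G r * μ'.real {r}) ∂μ =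
        ∫ r in Iio v, ((β + 1) * S r - S r * G r) ∂μ := by
      refine integral_congr_ae (ae_restrict_of_ae ?_)
      filter_upwards [hnull] with r hr
      rw [hr]
      ring
    rw [this, integral_sub ((hSi _).const_mul _) (hSG _), integral_const_mul]
  have hA1 : ∫ s in Iio v, G s * (1 - S s) ∂μ' = β - ∫ s in Iio v, S s * G s ∂μ' := by
    rw [hβ, ← integral_sub (hGi _) (hSG _)]
    congr 1
    ext s
    ring
  have hfinal : ∫ s in Iio v, S s * G s ∂μ' - ∫ s in Iio v, S s * G s ∂μ =
      S v * Real.exp ((logHaz μ').real (Iio v)) - 1 := by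
    rw [hGv]
    have h6 : S v = 1 - α := by rw [hSv]; ring
    rw [h6]
    have h7 := hA1.symm.trans (hA.trans hA2)
    linear_combination -h7
  exact hfinal

/-! ### Nuisance parameters bounded away from zero -/

/-- If all the product integrals of `μ` over `(0, t]`, `t ≤ T`, are positive, then the atoms of
`μ` are smaller than one: otherwise the product integral up to the first atom of size at least
one is nonpositive. -/
theorem atom_lt_one_of_prodIntegral_pos {μ : Measure ℝ} [IsFiniteMeasure μ] {T : ℝ}
    (hT : μ (Ioc 0 T)ᶜ = 0) (hpos : ∀ t ∈ Icc 0 T, 0 < prodIntegral μ (Ioc 0 t)) (s : ℝ) :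
    μ.real {s} < 1 := by
  by_contra hs
  have hfin : {s : ℝ | 1 ≤ μ.real {s}}.Finite := by
    have := (summable_atoms μ).tendsto_cofinite_zero.eventually (gt_mem_nhds one_pos)
    simpa [eventually_cofinite] using this
  obtain ⟨s₀, hs₀, hmin⟩ := hfin.exists_minimal ⟨s, not_lt.1 hs⟩
  have hlt : ∀ r, r < s₀ → μ.real {r} < 1 := by
    intro r hr
    by_contra hr1
    exact absurd (hmin (y := r) (not_lt.1 hr1) hr.le) (not_le.2 hr)
  have hmem : s₀ ∈ Ioc 0 T := by
    by_contra hn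
    have h0 : μ {s₀} = 0 := measure_mono_null (by simpa using hn) hT
    have h1 : (1 : ℝ) ≤ μ.real {s₀} := hs₀
    rw [measureReal_def, h0] at h1
    norm_num at h1
  refine absurd (hpos s₀ ⟨hmem.1.le, hmem.2⟩) (not_lt.2 ?_)
  refine mul_nonpos_of_nonneg_of_nonpos (Real.exp_pos _).le ?_
  have hmul : Multipliable fun r : Ioc 0 s₀ => (1 - μ.real {(r : ℝ)}) := by
    have h1 : Summable fun r : Ioc 0 s₀ => -μ.real {(r : ℝ)} :=
      ((summable_atoms μ).subtype (Ioc 0 s₀)).neg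
    simpa [sub_eq_add_neg] using Real.multipliable_one_add_of_summable h1
  refine le_of_tendsto hmul.hasProd ?_
  filter_upwards [eventually_ge_atTop {(⟨s₀, hmem.1, le_rfl⟩ : Ioc 0 s₀)}] with F hF
  have hF' : (⟨s₀, hmem.1, le_rfl⟩ : Ioc 0 s₀) ∈ F := by simpa using hF
  rw [← Finset.mul_prod_erase F _ hF']
  refine mul_nonpos_of_nonpos_of_nonneg (sub_nonpos.2 hs₀) (Finset.prod_nonneg fun r hr => ?_)
  have hne : (r : ℝ) ≠ s₀ := fun h => (Finset.ne_of_mem_erase hr) (Subtype.ext h)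
  linarith [hlt r (lt_of_le_of_ne r.2.2 hne)]

namespace Nuisance

variable {𝒳 : Type*}

/-- A nuisance parameter whose hazard measures are finite and live on `(0, T]` and which is
bounded away from zero. -/
structure Regular (ν : Nuisance 𝒳) (η T : ℝ) : Prop where
  eta_pos : 0 < η
  time_pos : 0 < T
  support : ∀ δ a x, ν.haz δ a x (Ioc 0 T)ᶜ = 0
  finite : ∀ δ a x, IsFiniteMeasure (ν.haz δ a x)
  positive : ν.Positive η T

namespace Regular

variable {ν : Nuisance 𝒳} {η T : ℝ}

theorem allCause_support (hν : ν.Regular η T) (a : Fin 2) (x : 𝒳) :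
    ν.allCause a x (Ioc 0 T)ᶜ = 0 := by
  simp [allCause, hν.support]

theorem isFiniteMeasure_allCause (hν : ν.Regular η T) (a : Fin 2) (x : 𝒳) :
    IsFiniteMeasure (ν.allCause a x) := by
  have := hν.finite 1 a x
  have := hν.finite 2 a x
  unfold allCause
  infer_instance

/-- A hazard with an atom of size one has a vanishing survival function afterwards, contrary to
positivity. -/
theorem allCause_atom (hν : ν.Regular η T) (a : Fin 2) (x : 𝒳) (s : ℝ) :
    (ν.allCause a x).real {s} < 1 := by
  have := hν.isFiniteMeasure_allCause a x
  exact atom_lt_one_of_prodIntegral_pos (hν.allCause_support a x)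
    (fun t ht => hν.eta_pos.trans (hν.positive t ht a x).1) s

theorem cens_atom (hν : ν.Regular η T) (a : Fin 2) (x : 𝒳) (s : ℝ) :
    (ν.haz 0 a x).real {s} < 1 := by
  have := hν.finite 0 a x
  exact atom_lt_one_of_prodIntegral_pos (hν.support 0 a x)
    (fun t ht => hν.eta_pos.trans (hν.positive t ht a x).2.1) s

theorem isFiniteMeasure_logHaz_allCause (hν : ν.Regular η T) (a : Fin 2) (x : 𝒳) :
    IsFiniteMeasure (logHaz (ν.allCause a x)) := by
  have := hν.isFiniteMeasure_allCause a x
  exact isFiniteMeasure_logHaz (hν.allCause_atom a x)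

theorem isFiniteMeasure_logHaz_cens (hν : ν.Regular η T) (a : Fin 2) (x : 𝒳) :
    IsFiniteMeasure (logHaz (ν.haz 0 a x)) := by
  have := hν.finite 0 a x
  exact isFiniteMeasure_logHaz (hν.cens_atom a x)

theorem _root_.LifeYearsLost.restrict_Ioc_eq {μ : Measure ℝ} {T : ℝ}
    (hT : μ (Ioc 0 T)ᶜ = 0) (t : ℝ) : μ.restrict (Ioc 0 t) = μ.restrict (Iic t) := by
  refine Measure.restrict_congr_set (ae_eq_set.2 ⟨?_, measure_mono_null ?_ hT⟩)
  · rw [sdiff_eq_empty.2 Ioc_subset_Iic_self, measure_empty]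
  · rintro s ⟨h1, h2⟩ h3
    exact h2 ⟨h3.1, h1⟩

theorem _root_.LifeYearsLost.restrict_Ioo_eq {μ : Measure ℝ} {T : ℝ}
    (hT : μ (Ioc 0 T)ᶜ = 0) (t : ℝ) : μ.restrict (Ioo 0 t) = μ.restrict (Iio t) := by
  refine Measure.restrict_congr_set (ae_eq_set.2 ⟨?_, measure_mono_null ?_ hT⟩)
  · rw [sdiff_eq_empty.2 Ioo_subset_Iio_self, measure_empty]
  · rintro s ⟨h1, h2⟩ h3
    exact h2 ⟨h3.1, h1⟩

theorem _root_.LifeYearsLost.restrict_Ioc_horizon {μ : Measure ℝ} {T : ℝ}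
    (hT : μ (Ioc 0 T)ᶜ = 0) : μ.restrict (Ioc 0 T) = μ :=
  Measure.restrict_eq_self_of_ae_mem (by rw [ae_iff]; exact hT)

theorem _root_.LifeYearsLost.measureReal_eq_of_restrict_eq {μ : Measure ℝ} {A B : Set ℝ}
    (h : μ.restrict A = μ.restrict B) : μ.real A = μ.real B := by
  rw [measureReal_def, measureReal_def, ← Measure.restrict_apply_univ A, h,
    Measure.restrict_apply_univ]

theorem surv_eq (hν : ν.Regular η T) (t : ℝ) (a : Fin 2) (x : 𝒳) :
    ν.surv t a x = Real.exp (-(logHaz (ν.allCause a x)).real (Iic t)) := by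
  have := hν.isFiniteMeasure_allCause a x
  rw [surv, prodIntegral_eq_exp_neg_logHaz (hν.allCause_atom a x) measurableSet_Ioc,
    measureReal_eq_of_restrict_eq (restrict_Ioc_eq (logHaz_eq_zero (hν.allCause_support a x)) t)]

theorem survLeft_eq (hν : ν.Regular η T) (t : ℝ) (a : Fin 2) (x : 𝒳) :
    ν.survLeft t a x = Real.exp (-(logHaz (ν.allCause a x)).real (Iio t)) := by
  have := hν.isFiniteMeasure_allCause a x
  rw [survLeft, prodIntegral_eq_exp_neg_logHaz (hν.allCause_atom a x) measurableSet_Ioo,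
    measureReal_eq_of_restrict_eq (restrict_Ioo_eq (logHaz_eq_zero (hν.allCause_support a x)) t)]

theorem censSurv_eq (hν : ν.Regular η T) (t : ℝ) (a : Fin 2) (x : 𝒳) :
    ν.censSurv t a x = Real.exp (-(logHaz (ν.haz 0 a x)).real (Iic t)) := by
  have := hν.finite 0 a x
  rw [censSurv, prodIntegral_eq_exp_neg_logHaz (hν.cens_atom a x) measurableSet_Ioc,
    measureReal_eq_of_restrict_eq (restrict_Ioc_eq (logHaz_eq_zero (hν.support 0 a x)) t)]

theorem real_univ_eq (μ : Measure ℝ) {T : ℝ} (hT : μ (Ioc 0 T)ᶜ = 0) :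
    μ.real univ = μ.real (Iic T) := by
  refine measureReal_eq_of_restrict_eq ?_
  rw [← restrict_Ioc_eq hT, restrict_Ioc_horizon hT, Measure.restrict_univ]

theorem surv_antitone (hν : ν.Regular η T) (a : Fin 2) (x : 𝒳) :
    Antitone fun t => ν.surv t a x := by
  have := hν.isFiniteMeasure_logHaz_allCause a x
  intro s t hst
  simp only [hν.surv_eq]
  exact Real.exp_le_exp.2 (neg_le_neg (measureReal_mono (Iic_subset_Iic.2 hst)))

theorem censSurv_antitone (hν : ν.Regular η T) (a : Fin 2) (x : 𝒳) :
    Antitone fun t => ν.censSurv t a x := by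
  have := hν.isFiniteMeasure_logHaz_cens a x
  intro s t hst
  simp only [hν.censSurv_eq]
  exact Real.exp_le_exp.2 (neg_le_neg (measureReal_mono (Iic_subset_Iic.2 hst)))

theorem survLeft_antitone (hν : ν.Regular η T) (a : Fin 2) (x : 𝒳) :
    Antitone fun t => ν.survLeft t a x := by
  have := hν.isFiniteMeasure_logHaz_allCause a x
  intro s t hst
  simp only [hν.survLeft_eq]
  exact Real.exp_le_exp.2 (neg_le_neg (measureReal_mono (Iio_subset_Iio hst)))

/-- Beyond the time horizon the survival function is constant, so that the lower bound holds at all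
times. -/
theorem lt_surv (hν : ν.Regular η T) (t : ℝ) (a : Fin 2) (x : 𝒳) : η < ν.surv t a x := by
  have := hν.isFiniteMeasure_logHaz_allCause a x
  refine (hν.positive T ⟨hν.time_pos.le, le_rfl⟩ a x).1.trans_le ?_
  rw [hν.surv_eq, hν.surv_eq, ← real_univ_eq _ (logHaz_eq_zero (hν.allCause_support a x))]
  exact Real.exp_le_exp.2 (neg_le_neg (measureReal_mono (subset_univ _)))

theorem lt_censSurv (hν : ν.Regular η T) (t : ℝ) (a : Fin 2) (x : 𝒳) : η < ν.censSurv t a x := by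
  have := hν.isFiniteMeasure_logHaz_cens a x
  refine (hν.positive T ⟨hν.time_pos.le, le_rfl⟩ a x).2.1.trans_le ?_
  rw [hν.censSurv_eq, hν.censSurv_eq, ← real_univ_eq _ (logHaz_eq_zero (hν.support 0 a x))]
  exact Real.exp_le_exp.2 (neg_le_neg (measureReal_mono (subset_univ _)))

theorem lt_ps (hν : ν.Regular η T) (a : Fin 2) (x : 𝒳) : η < ν.ps a x :=
  (hν.positive T ⟨hν.time_pos.le, le_rfl⟩ a x).2.2

theorem surv_le_survLeft (hν : ν.Regular η T) (t : ℝ) (a : Fin 2) (x : 𝒳) :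
    ν.surv t a x ≤ ν.survLeft t a x := by
  have := hν.isFiniteMeasure_logHaz_allCause a x
  rw [hν.surv_eq, hν.survLeft_eq]
  exact Real.exp_le_exp.2 (neg_le_neg (measureReal_mono Iio_subset_Iic_self))

theorem lt_survLeft (hν : ν.Regular η T) (t : ℝ) (a : Fin 2) (x : 𝒳) : η < ν.survLeft t a x :=
  (hν.lt_surv t a x).trans_le (hν.surv_le_survLeft t a x)

theorem survLeft_le_one (hν : ν.Regular η T) (t : ℝ) (a : Fin 2) (x : 𝒳) :
    ν.survLeft t a x ≤ 1 := by
  rw [hν.survLeft_eq, Real.exp_le_one_iff]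
  exact neg_nonpos.2 measureReal_nonneg

theorem surv_le_one (hν : ν.Regular η T) (t : ℝ) (a : Fin 2) (x : 𝒳) : ν.surv t a x ≤ 1 :=
  (hν.surv_le_survLeft t a x).trans (hν.survLeft_le_one t a x)

theorem censSurv_le_one (hν : ν.Regular η T) (t : ℝ) (a : Fin 2) (x : 𝒳) :
    ν.censSurv t a x ≤ 1 := by
  rw [hν.censSurv_eq, Real.exp_le_one_iff]
  exact neg_nonpos.2 measureReal_nonneg

theorem _root_.LifeYearsLost.le_inv_of_le_exp_neg {η r : ℝ} (hη : 0 < η)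
    (h : η ≤ Real.exp (-r)) : r ≤ 1 / η := by
  have h1 : r + 1 ≤ Real.exp r := Real.add_one_le_exp r
  have h2 : Real.exp r * Real.exp (-r) = 1 := by rw [← Real.exp_add]; simp
  rw [le_div_iff₀ hη]
  nlinarith [Real.exp_pos r]

theorem logHaz_allCause_le (hν : ν.Regular η T) (a : Fin 2) (x : 𝒳) :
    (logHaz (ν.allCause a x)).real univ ≤ 1 / η := by
  rw [real_univ_eq _ (logHaz_eq_zero (hν.allCause_support a x))]
  exact le_inv_of_le_exp_neg hν.eta_pos (hν.surv_eq T a x ▸ hν.lt_surv T a x).le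

theorem logHaz_cens_le (hν : ν.Regular η T) (a : Fin 2) (x : 𝒳) :
    (logHaz (ν.haz 0 a x)).real univ ≤ 1 / η := by
  rw [real_univ_eq _ (logHaz_eq_zero (hν.support 0 a x))]
  exact le_inv_of_le_exp_neg hν.eta_pos (hν.censSurv_eq T a x ▸ hν.lt_censSurv T a x).le

theorem allCause_le (hν : ν.Regular η T) (a : Fin 2) (x : 𝒳) :
    (ν.allCause a x).real univ ≤ 1 / η := by
  have := hν.isFiniteMeasure_allCause a x
  have := hν.isFiniteMeasure_logHaz_allCause a x
  refine le_trans ?_ (hν.logHaz_allCause_le a x)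
  exact ENNReal.toReal_mono (measure_ne_top _ _) (le_logHaz (hν.allCause_atom a x) univ)

theorem _root_.LifeYearsLost.Nuisance.haz_succ_le_allCause (ν : Nuisance 𝒳) (i : Fin 2)
    (a : Fin 2) (x : 𝒳) : ν.haz i.succ a x ≤ ν.allCause a x := by
  fin_cases i
  · exact Measure.le_add_right le_rfl
  · exact Measure.le_add_left le_rfl

/-- Positivity of the survival functions bounds the total masses of the hazards uniformly. -/
theorem haz_le (hν : ν.Regular η T) (δ : Fin 3) (a : Fin 2) (x : 𝒳) :
    (ν.haz δ a x).real univ ≤ 1 / η := by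
  have := hν.isFiniteMeasure_allCause a x
  have := hν.isFiniteMeasure_logHaz_cens a x
  refine Fin.cases ?_ (fun i => ?_) δ
  · have := hν.finite 0 a x
    refine le_trans ?_ (hν.logHaz_cens_le a x)
    exact ENNReal.toReal_mono (measure_ne_top _ _) (le_logHaz (hν.cens_atom a x) univ)
  · refine le_trans ?_ (hν.allCause_le a x)
    exact ENNReal.toReal_mono (measure_ne_top _ _) (ν.haz_succ_le_allCause i a x univ)

theorem abs_survLeft_le (hν : ν.Regular η T) (t : ℝ) (a : Fin 2) (x : 𝒳) :
    |ν.survLeft t a x| ≤ 1 := by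
  rw [abs_of_pos (hν.eta_pos.trans (hν.lt_survLeft t a x))]
  exact hν.survLeft_le_one t a x

theorem integrable_survLeft (hν : ν.Regular η T) (a : Fin 2) (x : 𝒳) (μ : Measure ℝ)
    [IsFiniteMeasure μ] : Integrable (fun s => ν.survLeft s a x) μ :=
  Integrable.of_bound (hν.survLeft_antitone a x).measurable.aestronglyMeasurable 1
    (Eventually.of_forall fun s => hν.abs_survLeft_le s a x)

theorem cif_eq (hν : ν.Regular η T) (j : Fin 2) (t : ℝ) (a : Fin 2) (x : 𝒳) :
    ν.cif j t a x = ∫ s in Iic t, ν.survLeft s a x ∂(ν.haz j.succ a x) := by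
  rw [cif, restrict_Ioc_eq (hν.support _ _ _)]

theorem cif_sub (hν : ν.Regular η T) (j : Fin 2) {s t : ℝ} (hst : s ≤ t) (a : Fin 2) (x : 𝒳) :
    ν.cif j t a x - ν.cif j s a x = ∫ r in Ioc s t, ν.survLeft r a x ∂(ν.haz j.succ a x) := by
  have := hν.finite j.succ a x
  rw [hν.cif_eq, hν.cif_eq, ← Iic_union_Ioc_eq_Iic hst, setIntegral_union (by
    rw [disjoint_left]; intro r h1 h2; exact absurd h1.out (not_le.2 h2.1)) measurableSet_Ioc
    (hν.integrable_survLeft a x _).integrableOn (hν.integrable_survLeft a x _).integrableOn]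
  ring

theorem cif_mono (hν : ν.Regular η T) (j : Fin 2) (a : Fin 2) (x : 𝒳) :
    Monotone fun t => ν.cif j t a x := by
  intro s t hst
  have := hν.cif_sub j hst a x
  have h2 : 0 ≤ ∫ r in Ioc s t, ν.survLeft r a x ∂(ν.haz j.succ a x) :=
    integral_nonneg fun r => (hν.eta_pos.trans (hν.lt_survLeft r a x)).le
  simp only
  linarith

theorem cif_nonneg (hν : ν.Regular η T) (j : Fin 2) (t : ℝ) (a : Fin 2) (x : 𝒳) :
    0 ≤ ν.cif j t a x :=
  integral_nonneg fun r => (hν.eta_pos.trans (hν.lt_survLeft r a x)).le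

theorem cif_le (hν : ν.Regular η T) (j : Fin 2) (t : ℝ) (a : Fin 2) (x : 𝒳) :
    ν.cif j t a x ≤ 1 / η := by
  have := hν.finite j.succ a x
  rw [hν.cif_eq]
  have h1 := norm_setIntegral_le_of_norm_le_const (μ := ν.haz j.succ a x) (s := Iic t) (C := 1)
    (f := fun s => ν.survLeft s a x) (measure_lt_top _ _) (fun s _ => hν.abs_survLeft_le s a x)
  refine (le_abs_self _).trans (h1.trans ?_)
  rw [one_mul]
  exact (measureReal_mono (subset_univ _)).trans (hν.haz_le j.succ a x)

/-- The expected life-years lost to cause `j` between `s` and `T`: the mass `S(v-) Λ_j(dv)` of the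
events after `s`, weighted by the remaining time `T - v`. -/
def _root_.LifeYearsLost.Nuisance.futureLoss (ν : Nuisance 𝒳) (j : Fin 2) (T s : ℝ) (a : Fin 2)
    (x : 𝒳) : ℝ := ∫ v in Ioi s, (T - v) * ν.survLeft v a x ∂(ν.haz j.succ a x)

theorem integral_cif_sub (hν : ν.Regular η T) (j : Fin 2) {s : ℝ} (hs : s ≤ T) (a : Fin 2)
    (x : 𝒳) : ∫ u in s..T, (ν.cif j u a x - ν.cif j s a x) = ν.futureLoss j T s a x := by
  have := hν.finite j.succ a x
  rw [futureLoss, ← integral_setIntegral_Ioc _ (hν.support j.succ a x)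
    (hν.survLeft_antitone a x).measurable (fun v => hν.abs_survLeft_le v a x) hs]
  refine intervalIntegral.integral_congr fun u hu => ?_
  rw [uIcc_of_le hs] at hu
  exact hν.cif_sub j hu.1 a x

theorem lifeYearsLost_eq (hν : ν.Regular η T) (j : Fin 2) (a : Fin 2) (x : 𝒳) :
    ν.lifeYearsLost j T a x = ∫ v, (T - v) * ν.survLeft v a x ∂(ν.haz j.succ a x) := by
  have h1 := hν.integral_cif_sub j hν.time_pos.le a x
  have h2 : ν.cif j 0 a x = 0 := by simp [cif]
  simp only [h2, sub_zero] at h1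
  rw [lifeYearsLost, h1, futureLoss, Measure.restrict_eq_self_of_ae_mem]
  rw [ae_iff]
  exact measure_mono_null (compl_subset_compl.2 fun v hv => hv.1) (hν.support j.succ a x)

/-- After exchanging the order of integration, `H_ij(s, T) = 1(i = j) (T - s) - V_j(s) / S(s)`,
where `V_j` is the future loss: what an event of cause `i` at time `s` adds to the years lost to
cause `j`, compared with what is expected for a survivor. -/
theorem H_eq (hν : ν.Regular η T) (i j : Fin 2) {s : ℝ} (hs : s ≤ T) (a : Fin 2) (x : 𝒳) :
    ν.H i j s T a x =
      (if i = j then T - s else 0) - ν.futureLoss j T s a x / ν.surv s a x := by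
  have hint : IntervalIntegrable (fun u => ν.cif j u a x) volume s T :=
    (hν.cif_mono j a x).intervalIntegrable
  rw [H, ← hν.integral_cif_sub j hs, ← intervalIntegral.integral_div]
  have h1 : ∀ u, ((if i = j then (1 : ℝ) else 0) + (ν.cif j s a x - ν.cif j u a x) / ν.surv s a x) =
      (if i = j then 1 else 0) - (ν.cif j u a x - ν.cif j s a x) / ν.surv s a x := fun u => by ring
  simp_rw [h1]
  rw [intervalIntegral.integral_sub (by simp) ((hint.sub (by simp)).div_const _)]
  split_ifs <;> simp

end Regular

end Nuisance

namespace Nuisance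

variable {𝒳 : Type*}

/-! ### The von Mises expansion of the life-years lost -/

namespace Regular

variable {ν ν' : Nuisance 𝒳} {η T : ℝ}

theorem ae_mem (hν : ν.Regular η T) (δ : Fin 3) (a : Fin 2) (x : 𝒳) :
    ∀ᵐ s ∂(ν.haz δ a x), s ∈ Ioc 0 T := by
  rw [ae_iff]
  exact hν.support δ a x

/-- The remaining time `T - v` is unbounded on the real line; its truncation to `[0, T]` agrees with
it on `(0, T]`, where the hazards are concentrated. -/
theorem abs_clamp_le (hT : 0 < T) (v : ℝ) : |max 0 (T - max v 0)| ≤ T := by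
  rw [abs_of_nonneg (le_max_left _ _)]
  exact max_le hT.le (by linarith [le_max_right v 0])

theorem clamp_eq {v : ℝ} (hv : v ∈ Ioc 0 T) : max 0 (T - max v 0) = T - v := by
  rw [max_eq_left hv.1.le, max_eq_right (by linarith [hv.2])]

theorem futureLoss_eq_clamp (hν : ν.Regular η T) (j : Fin 2) (s : ℝ) (a : Fin 2) (x : 𝒳) :
    ν.futureLoss j T s a x =
      ∫ v in Ioi s, max 0 (T - max v 0) * ν.survLeft v a x ∂(ν.haz j.succ a x) := by
  refine integral_congr_ae (ae_restrict_of_ae ?_)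
  filter_upwards [hν.ae_mem j.succ a x] with v hv
  rw [clamp_eq hv]

theorem measurable_clamp_mul (hν : ν.Regular η T) (a : Fin 2) (x : 𝒳) :
    Measurable fun v => max 0 (T - max v 0) * ν.survLeft v a x :=
  (by fun_prop : Measurable fun v : ℝ => max 0 (T - max v 0)).mul
    (hν.survLeft_antitone a x).measurable

theorem abs_clamp_mul_le (hν : ν.Regular η T) (a : Fin 2) (x : 𝒳) (v : ℝ) :
    |max 0 (T - max v 0) * ν.survLeft v a x| ≤ T := by
  rw [abs_mul]
  have := mul_le_mul (abs_clamp_le hν.time_pos v) (hν.abs_survLeft_le v a x) (abs_nonneg _)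
    hν.time_pos.le
  linarith

theorem integrable_clamp_mul (hν : ν.Regular η T) (a : Fin 2) (x : 𝒳) (m : Measure ℝ)
    [IsFiniteMeasure m] : Integrable (fun v => max 0 (T - max v 0) * ν.survLeft v a x) m :=
  Integrable.of_bound (hν.measurable_clamp_mul a x).aestronglyMeasurable T
    (Eventually.of_forall fun s => hν.abs_clamp_mul_le a x s)

theorem clamp_mul_nonneg (hν : ν.Regular η T) (a : Fin 2) (x : 𝒳) (v : ℝ) :
    0 ≤ max 0 (T - max v 0) * ν.survLeft v a x :=
  mul_nonneg (le_max_left _ _) (hν.eta_pos.trans (hν.lt_survLeft v a x)).le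

theorem futureLoss_antitone (hν : ν.Regular η T) (j : Fin 2) (a : Fin 2) (x : 𝒳) :
    Antitone fun s => ν.futureLoss j T s a x := by
  intro s t hst
  have := hν.finite j.succ a x
  simp only [hν.futureLoss_eq_clamp]
  exact setIntegral_mono_set (hν.integrable_clamp_mul a x _).integrableOn
    (Eventually.of_forall fun v => hν.clamp_mul_nonneg a x v)
    (LE.le.eventuallyLE (Ioi_subset_Ioi hst))

theorem futureLoss_nonneg (hν : ν.Regular η T) (j : Fin 2) (s : ℝ) (a : Fin 2) (x : 𝒳) :
    0 ≤ ν.futureLoss j T s a x := by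
  rw [hν.futureLoss_eq_clamp]
  exact integral_nonneg fun v => hν.clamp_mul_nonneg a x v

theorem futureLoss_le (hν : ν.Regular η T) (j : Fin 2) (s : ℝ) (a : Fin 2) (x : 𝒳) :
    ν.futureLoss j T s a x ≤ T / η := by
  have := hν.finite j.succ a x
  rw [hν.futureLoss_eq_clamp]
  have h1 := norm_setIntegral_le_of_norm_le_const (μ := ν.haz j.succ a x) (s := Ioi s) (C := T)
    (f := fun v => max 0 (T - max v 0) * ν.survLeft v a x) (measure_lt_top _ _)
    (fun s _ => hν.abs_clamp_mul_le a x s)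
  refine (le_abs_self _).trans (h1.trans ?_)
  rw [div_eq_mul_one_div]
  exact mul_le_mul_of_nonneg_left ((measureReal_mono (subset_univ _)).trans
    (hν.haz_le j.succ a x)) hν.time_pos.le

theorem inv_surv_eq (hν : ν.Regular η T) (s : ℝ) (a : Fin 2) (x : 𝒳) :
    (ν.surv s a x)⁻¹ = Real.exp ((logHaz (ν.allCause a x)).real (Iic s)) := by
  rw [hν.surv_eq, Real.exp_neg, inv_inv]

/-- Integrating the part of `S H'` that does not depend on the cause against an all-cause hazard
measure `m` amounts to integrating the future losses against `∫ S / S' dm`. -/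
theorem integral_surv_mul_futureLoss (hν : ν.Regular η T) (hν' : ν'.Regular η T) (j : Fin 2)
    (a : Fin 2) (x : 𝒳) (m : Measure ℝ) [IsFiniteMeasure m] :
    ∫ s, ν.surv s a x * (ν'.futureLoss j T s a x / ν'.surv s a x) ∂m =
      ∫ v, max 0 (T - max v 0) * ν'.survLeft v a x *
        (∫ s in Iio v, ν.surv s a x * (ν'.surv s a x)⁻¹ ∂m) ∂(ν'.haz j.succ a x) := by
  have := hν'.finite j.succ a x
  have hf : Measurable fun s => ν.surv s a x * (ν'.surv s a x)⁻¹ :=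
    (hν.surv_antitone a x).measurable.mul (hν'.surv_antitone a x).measurable.inv
  have hfC : ∀ s, |ν.surv s a x * (ν'.surv s a x)⁻¹| ≤ 1 / η := by
    intro s
    have h1 := hν.surv_le_one s a x
    have h2 := hν.lt_surv s a x
    have h3 := hν'.lt_surv s a x
    have h4 := hν.eta_pos
    rw [abs_of_nonneg (mul_nonneg (by linarith) (inv_nonneg.2 (by linarith))), ← div_eq_mul_inv]
    exact div_le_div₀ zero_le_one h1 h4 h3.le
  have hD : MeasurableSet {p : ℝ × ℝ | p.1 < p.2} := measurableSet_lt measurable_fst measurable_snd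
  have key := integral_mul_setIntegral_swap m (ν'.haz j.succ a x) hf
    (hν'.measurable_clamp_mul a x) hfC (fun v => hν'.abs_clamp_mul_le a x v) hD
  refine Eq.trans ?_ key
  refine integral_congr_ae (Eventually.of_forall fun s => ?_)
  have hset : {y | (s, y) ∈ {p : ℝ × ℝ | p.1 < p.2}} = Ioi s := rfl
  simp only [hset, ← hν'.futureLoss_eq_clamp]
  ring

/-- Integration of a function of the form `1(i = j) f - g` against the hazard measures of the two
causes. -/
theorem sum_integral_ite_sub (ν : Nuisance 𝒳) (j : Fin 2) (a : Fin 2) (x : 𝒳) {f g : ℝ → ℝ}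
    (hf : ∀ i, Integrable f (ν.haz i a x)) (hg : ∀ i, Integrable g (ν.haz i a x)) :
    ∑ i : Fin 2, ∫ s, ((if i = j then f s else 0) - g s) ∂(ν.haz i.succ a x) =
      ∫ s, f s ∂(ν.haz j.succ a x) - ∫ s, g s ∂(ν.allCause a x) := by
  have h1 : ∀ i : Fin 2, ∫ s, ((if i = j then f s else 0) - g s) ∂(ν.haz i.succ a x) =
      (if i = j then ∫ s, f s ∂(ν.haz i.succ a x) else 0) - ∫ s, g s ∂(ν.haz i.succ a x) := by
    intro i
    split_ifs with h
    · exact integral_sub (hf _) (hg _)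
    · simp [integral_neg]
  simp_rw [h1]
  rw [Finset.sum_sub_distrib, Finset.sum_ite_eq' Finset.univ j, if_pos (Finset.mem_univ j),
    allCause, integral_add_measure (hg 1) (hg 2), Fin.sum_univ_two]
  rfl

/-- The exact first-order expansion of the life-years lost in the hazards of the two causes: the
difference of the functionals at `ν'` and `ν` is the integral of `S H'_ij` against the difference of
the hazards, without a remainder. Only `ν` needs to have continuous cumulative hazards. -/
theorem lifeYearsLost_sub (hν : ν.Regular η T) (hν' : ν'.Regular η T)
    (hcont : ∀ δ a x, NullSingletonClass (ν.haz δ a x)) (j : Fin 2) (a : Fin 2) (x : 𝒳) :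
    ∑ i : Fin 2, ((∫ s, ν.surv s a x * ν'.H i j s T a x ∂(ν'.haz i.succ a x)) -
        ∫ s, ν.surv s a x * ν'.H i j s T a x ∂(ν.haz i.succ a x)) =
      ν'.lifeYearsLost j T a x - ν.lifeYearsLost j T a x := by
  have := hν.finite
  have := hν'.finite
  have := hν.isFiniteMeasure_allCause a x
  have := hν'.isFiniteMeasure_allCause a x
  have hcont' : NullSingletonClass (ν.allCause a x) :=
    ⟨fun s => by have := hcont 1 a x; have := hcont 2 a x; simp [allCause]⟩
  have hatom : ∀ s, (ν.allCause a x).real {s} < 1 := hν.allCause_atom a x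
  have hlog : logHaz (ν.allCause a x) = ν.allCause a x := by
    rw [logHaz]
    simp [measureReal_def, atomFactor]
  have hsurvLeft : ∀ v, ν.survLeft v a x = ν.surv v a x := fun v => by
    rw [hν.survLeft_eq, hν.surv_eq, hlog, measureReal_def, measureReal_def,
      measure_congr Iio_ae_eq_Iic]
  set f : ℝ → ℝ := fun s => ν.surv s a x * max 0 (T - max s 0) with hf
  set g : ℝ → ℝ := fun s => ν.surv s a x * (ν'.futureLoss j T s a x / ν'.surv s a x) with hg
  have hSm : Measurable fun s => ν.surv s a x := (hν.surv_antitone a x).measurable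
  have hfi : ∀ (m : Measure ℝ) [IsFiniteMeasure m], Integrable f m := fun m _ => by
    refine Integrable.of_bound (C := T) (hSm.mul (by fun_prop)).aestronglyMeasurable
      (Eventually.of_forall fun s => ?_)
    rw [hf, norm_mul]
    have h1 : ‖ν.surv s a x‖ ≤ 1 := by
      rw [Real.norm_of_nonneg (hν.eta_pos.trans (hν.lt_surv s a x)).le]
      exact hν.surv_le_one s a x
    exact (mul_le_mul h1 (abs_clamp_le hν.time_pos s) (abs_nonneg _) zero_le_one).trans_eq
      (one_mul _)
  have hgi : ∀ (m : Measure ℝ) [IsFiniteMeasure m], Integrable g m := fun m _ => by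
    refine Integrable.of_bound (C := 1 * (T / η / η)) (hSm.mul
      ((hν'.futureLoss_antitone j a x).measurable.div
        (hν'.surv_antitone a x).measurable)).aestronglyMeasurable (Eventually.of_forall fun s => ?_)
    have h2 := hν.lt_surv s a x
    have h3 := hν'.lt_surv s a x
    have h4 := hν.eta_pos
    have h5 := hν'.futureLoss_nonneg j s a x
    have h6 := hν'.futureLoss_le j s a x
    have h7 : 0 < ν.surv s a x := by linarith
    have h8 : 0 < ν'.surv s a x := by linarith
    have h9 := hν.time_pos
    rw [hg, Real.norm_of_nonneg (by positivity)]
    refine mul_le_mul (hν.surv_le_one s a x) ?_ (by positivity) zero_le_one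
    exact div_le_div₀ (by positivity) h6 h4 h3.le
  -- `S H'_ij = 1(i = j) f - g`, where neither `f` nor `g` depends on the cause `i`
  have hH : ∀ (i : Fin 2) (ν₁ : Nuisance 𝒳), ν₁.Regular η T →
      ∫ s, ν.surv s a x * ν'.H i j s T a x ∂(ν₁.haz i.succ a x) =
        ∫ s, ((if i = j then f s else 0) - g s) ∂(ν₁.haz i.succ a x) := by
    intro i ν₁ h₁
    refine integral_congr_ae ?_
    filter_upwards [h₁.ae_mem i.succ a x] with s hs
    rw [hν'.H_eq i j hs.2, hf, hg]
    simp only [clamp_eq hs]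
    split_ifs <;> ring
  rw [Finset.sum_sub_distrib]
  simp_rw [fun i => hH i ν hν, fun i => hH i ν' hν']
  rw [sum_integral_ite_sub ν' j a x (fun i => hfi _) (fun i => hgi _),
    sum_integral_ite_sub ν j a x (fun i => hfi _) (fun i => hgi _)]
  rw [hg, hν.integral_surv_mul_futureLoss hν' j a x (ν'.allCause a x),
    hν.integral_surv_mul_futureLoss hν' j a x (ν.allCause a x)]
  -- against the difference of the all-cause hazards, `∫ S / S'` telescopes by Duhamel's equation
  have hduh : ∀ v, (∫ s in Iio v, ν.surv s a x * (ν'.surv s a x)⁻¹ ∂(ν'.allCause a x)) -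
      (∫ s in Iio v, ν.surv s a x * (ν'.surv s a x)⁻¹ ∂(ν.allCause a x)) =
      ν.surv v a x * (ν'.survLeft v a x)⁻¹ - 1 := by
    intro v
    have h1 := duhamel (hν.allCause_support a x) (hν'.allCause_support a x)
      (hν'.allCause_atom a x) v
    simp only [hν'.inv_surv_eq, hν.surv_eq, hν'.survLeft_eq, hlog, Real.exp_neg _, inv_inv] at h1 ⊢
    exact h1
  have hdiff : (∫ v, max 0 (T - max v 0) * ν'.survLeft v a x *
        (∫ s in Iio v, ν.surv s a x * (ν'.surv s a x)⁻¹ ∂(ν'.allCause a x)) ∂(ν'.haz j.succ a x)) -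
      (∫ v, max 0 (T - max v 0) * ν'.survLeft v a x *
        (∫ s in Iio v, ν.surv s a x * (ν'.surv s a x)⁻¹ ∂(ν.allCause a x)) ∂(ν'.haz j.succ a x)) =
      ∫ v, f v ∂(ν'.haz j.succ a x) -
        ∫ v, max 0 (T - max v 0) * ν'.survLeft v a x ∂(ν'.haz j.succ a x) := by
    have hIi : ∀ (m : Measure ℝ) [IsFiniteMeasure m], Integrable (fun v =>
        max 0 (T - max v 0) * ν'.survLeft v a x *
          (∫ s in Iio v, ν.surv s a x * (ν'.surv s a x)⁻¹ ∂m)) (ν'.haz j.succ a x) := by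
      intro m _
      have hnn : ∀ s, 0 ≤ ν.surv s a x * (ν'.surv s a x)⁻¹ := fun s =>
        mul_nonneg (hν.eta_pos.trans (hν.lt_surv s a x)).le
          (inv_nonneg.2 (hν.eta_pos.trans (hν'.lt_surv s a x)).le)
      have hle : ∀ s, ‖ν.surv s a x * (ν'.surv s a x)⁻¹‖ ≤ 1 / η := fun s => by
        rw [Real.norm_of_nonneg (hnn s), ← div_eq_mul_inv]
        exact div_le_div₀ zero_le_one (hν.surv_le_one s a x) hν.eta_pos (hν'.lt_surv s a x).le
      have hi : Integrable (fun s => ν.surv s a x * (ν'.surv s a x)⁻¹) m :=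
        Integrable.of_bound (hSm.mul (hν'.surv_antitone a x).measurable.inv).aestronglyMeasurable
          _ (Eventually.of_forall hle)
      have hmono : Monotone fun v => ∫ s in Iio v, ν.surv s a x * (ν'.surv s a x)⁻¹ ∂m :=
        fun u v huv => setIntegral_mono_set hi.integrableOn (Eventually.of_forall hnn)
          (LE.le.eventuallyLE (Iio_subset_Iio huv))
      refine Integrable.of_bound (C := T * (1 / η * m.real univ))
        ((hν'.measurable_clamp_mul a x).mul hmono.measurable).aestronglyMeasurable
        (Eventually.of_forall fun v => ?_)
      rw [norm_mul]
      refine mul_le_mul (hν'.abs_clamp_mul_le a x v) ?_ (norm_nonneg _) hν.time_pos.le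
      refine (norm_setIntegral_le_of_norm_le_const (measure_lt_top _ _) fun s _ => hle s).trans ?_
      exact mul_le_mul_of_nonneg_left (measureReal_mono (subset_univ _))
        (one_div_nonneg.2 hν.eta_pos.le)
    rw [← integral_sub (hIi _) (hIi _), ← integral_sub (hfi _) (hν'.integrable_clamp_mul a x _)]
    refine integral_congr_ae (Eventually.of_forall fun v => ?_)
    simp only [hf]
    rw [← mul_sub, hduh]
    have : ν'.survLeft v a x ≠ 0 := (hν.eta_pos.trans (hν'.lt_survLeft v a x)).ne'
    field_simp
  have hL' : ν'.lifeYearsLost j T a x =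
      ∫ v, max 0 (T - max v 0) * ν'.survLeft v a x ∂(ν'.haz j.succ a x) := by
    rw [hν'.lifeYearsLost_eq]
    refine integral_congr_ae ?_
    filter_upwards [hν'.ae_mem j.succ a x] with v hv
    rw [clamp_eq hv]
  have hL : ν.lifeYearsLost j T a x = ∫ v, f v ∂(ν.haz j.succ a x) := by
    rw [hν.lifeYearsLost_eq]
    refine integral_congr_ae ?_
    filter_upwards [hν.ae_mem j.succ a x] with v hv
    simp only [hf, clamp_eq hv, hsurvLeft]
    ring
  rw [hL', hL]
  linear_combination -hdiff

end Regular

end Nuisance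

/-! ### Integrals against hazards that are close in supremum norm -/

section Perturbation

variable {μ μ' : Measure ℝ} [IsFiniteMeasure μ] [IsFiniteMeasure μ'] {ε : ℝ}

theorem abs_sub_Iio_le (h : ∀ s, |μ'.real (Iic s) - μ.real (Iic s)| ≤ ε) (s : ℝ) :
    |μ'.real (Iio s) - μ.real (Iio s)| ≤ ε := by
  obtain ⟨u, -, hu⟩ := exists_seq_tendsto_measureReal_Iio s
  exact le_of_tendsto (((hu μ').sub (hu μ)).abs) (Eventually.of_forall fun n => h _)

/-- If `μ` has no atoms, then a measure close to `μ` has small atoms. -/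
theorem atom_le_of_abs_sub_le [NullSingletonClass μ]
    (h : ∀ s, |μ'.real (Iic s) - μ.real (Iic s)| ≤ ε) (s : ℝ) : μ'.real {s} ≤ 2 * ε := by
  have h1 := measureReal_Iic_eq_add μ' s
  have h2 := measureReal_Iic_eq_add μ s
  have h3 : μ.real {s} = 0 := by simp [measureReal_def]
  have h4 := abs_le.1 (h s)
  have h5 := abs_le.1 (abs_sub_Iio_le h s)
  linarith

theorem abs_sub_univ_le (h : ∀ s, |μ'.real (Iic s) - μ.real (Iic s)| ≤ ε) :
    |μ'.real univ - μ.real univ| ≤ ε := by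
  have hlim : ∀ (ρ : Measure ℝ) [IsFiniteMeasure ρ],
      Tendsto (fun n : ℕ => ρ.real (Iic (n : ℝ))) atTop (𝓝 (ρ.real univ)) := by
    intro ρ _
    have hU : ⋃ n : ℕ, Iic (n : ℝ) = univ :=
      eq_univ_of_forall fun x => mem_iUnion.2 (exists_nat_ge x)
    have ht : Tendsto (fun n : ℕ => ρ (Iic (n : ℝ))) atTop (𝓝 (ρ (⋃ n : ℕ, Iic (n : ℝ)))) :=
      tendsto_measure_iUnion_atTop fun m n h => Iic_subset_Iic.2 (Nat.cast_le.2 h)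
    rw [hU] at ht
    exact (ENNReal.tendsto_toReal (measure_ne_top _ _)).comp ht
  exact le_of_tendsto (((hlim μ').sub (hlim μ)).abs) (Eventually.of_forall fun n => h _)

/-- Lower sets of reals are half-lines, so that closeness of the distribution functions carries over
to them. -/
theorem abs_sub_lowerSet_le (h : ∀ s, |μ'.real (Iic s) - μ.real (Iic s)| ≤ ε) {I : Set ℝ}
    (hI : IsLowerSet I) : |μ'.real I - μ.real I| ≤ ε := by
  rcases I.eq_empty_or_nonempty with rfl | hne
  · simpa using (abs_nonneg _).trans (h 0)
  by_cases hb : BddAbove I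
  · by_cases hc : sSup I ∈ I
    · have : I = Iic (sSup I) :=
        Subset.antisymm (fun x hx => le_csSup hb hx) fun x hx => hI hx hc
      rw [this]
      exact h _
    · have : I = Iio (sSup I) := by
        refine Subset.antisymm (fun x hx => lt_of_le_of_ne (le_csSup hb hx) ?_) fun x hx => ?_
        · rintro rfl; exact hc hx
        · obtain ⟨y, hy, hxy⟩ := exists_lt_of_lt_csSup hne hx
          exact hI hxy.le hy
      rw [this]
      exact abs_sub_Iio_le h _
  · have : I = univ := by
      refine eq_univ_of_forall fun x => ?_
      rw [not_bddAbove_iff] at hb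
      obtain ⟨y, hy, hxy⟩ := hb x
      exact hI hxy.le hy
    rw [this]
    exact abs_sub_univ_le h

theorem abs_sub_upperSet_le (h : ∀ s, |μ'.real (Iic s) - μ.real (Iic s)| ≤ ε) {I : Set ℝ}
    (hI : IsUpperSet I) (hIm : MeasurableSet I) : |μ'.real I - μ.real I| ≤ 2 * ε := by
  have h1 := abs_le.1 (abs_sub_lowerSet_le h hI.compl)
  have h2 := abs_le.1 (abs_sub_univ_le h)
  have h3 := measureReal_add_measureReal_compl (μ := μ) hIm
  have h4 := measureReal_add_measureReal_compl (μ := μ') hIm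
  rw [abs_le]
  constructor <;> linarith

/-- Layer cake formula: a bounded function is integrated almost equally by two measures that nearly
agree on its superlevel sets. This replaces integration by parts for monotone functions. -/
theorem abs_integral_sub_le_of_superlevel {f : ℝ → ℝ} (hf : Measurable f) {M : ℝ}
    (h0 : ∀ s, 0 ≤ f s) (hM : ∀ s, f s ≤ M)
    (h : ∀ r, |μ'.real {s | r ≤ f s} - μ.real {s | r ≤ f s}| ≤ ε) :
    |∫ s, f s ∂μ' - ∫ s, f s ∂μ| ≤ M * ε := by
  have hM0 : 0 ≤ M := (h0 0).trans (hM 0)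
  have hform : ∀ (ρ : Measure ℝ) [IsFiniteMeasure ρ],
      ∫ s, f s ∂ρ = ∫ r in (0 : ℝ)..M, ρ.real {s | r ≤ f s} := fun ρ _ => by
    rw [intervalIntegral.integral_of_le hM0]
    exact (Integrable.of_bound hf.aestronglyMeasurable M (Eventually.of_forall fun s => by
      rw [Real.norm_of_nonneg (h0 s)]; exact hM s)).integral_eq_integral_Ioc_meas_le
      (Eventually.of_forall h0) (Eventually.of_forall hM)
  have hint : ∀ (ρ : Measure ℝ) [IsFiniteMeasure ρ],
      IntervalIntegrable (fun r => ρ.real {s | r ≤ f s}) volume 0 M := fun ρ _ =>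
    Antitone.intervalIntegrable fun r r' hrr' =>
      measureReal_mono fun s (hs : r' ≤ f s) => hrr'.trans hs
  rw [hform μ', hform μ, ← intervalIntegral.integral_sub (hint μ') (hint μ)]
  have := intervalIntegral.norm_integral_le_of_norm_le_const (a := (0 : ℝ)) (b := M) (C := ε)
    (f := fun r => μ'.real {s | r ≤ f s} - μ.real {s | r ≤ f s}) fun r _ => h r
  rw [sub_zero, abs_of_nonneg hM0] at this
  rw [mul_comm]
  exact this

theorem abs_integral_sub_le_of_antitone (h : ∀ s, |μ'.real (Iic s) - μ.real (Iic s)| ≤ ε)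
    {f : ℝ → ℝ} (hf : Antitone f) {M : ℝ} (h0 : ∀ s, 0 ≤ f s) (hM : ∀ s, f s ≤ M) :
    |∫ s, f s ∂μ' - ∫ s, f s ∂μ| ≤ M * ε :=
  abs_integral_sub_le_of_superlevel hf.measurable h0 hM fun _ =>
    abs_sub_lowerSet_le h fun _ _ hst hs => le_trans hs (hf hst)

theorem abs_integral_sub_le_of_monotone (h : ∀ s, |μ'.real (Iic s) - μ.real (Iic s)| ≤ ε)
    {f : ℝ → ℝ} (hf : Monotone f) {M : ℝ} (h0 : ∀ s, 0 ≤ f s) (hM : ∀ s, f s ≤ M) :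
    |∫ s, f s ∂μ' - ∫ s, f s ∂μ| ≤ M * (2 * ε) :=
  abs_integral_sub_le_of_superlevel hf.measurable h0 hM fun _ =>
    abs_sub_upperSet_le h (fun _ _ hst hs => le_trans hs (hf hst))
      (measurableSet_le measurable_const hf.measurable)

theorem abs_sub_Iic_restrict_le {μ μ' : Measure ℝ} {ε : ℝ}
    (h : ∀ s, |μ'.real (Iic s) - μ.real (Iic s)| ≤ ε) (t s : ℝ) :
    |(μ'.restrict (Iic t)).real (Iic s) - (μ.restrict (Iic t)).real (Iic s)| ≤ ε := by
  rw [measureReal_restrict_apply measurableSet_Iic, measureReal_restrict_apply measurableSet_Iic,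
    Iic_inter_Iic]
  exact h _

/-- Passing from the hazard measure to the logarithm of its product integral costs a term of the
order of the largest atom. -/
theorem logHaz_real_le {η b : ℝ} (hη : 0 < η) (hμ : ∀ s, μ.real {s} < 1)
    (hμη : ∀ s, η ≤ 1 - μ.real {s}) (hb : ∀ s, μ.real {s} ≤ b) (B : Set ℝ)
    (hB : MeasurableSet B) : (logHaz μ).real B ≤ (1 + b / η) * μ.real B := by
  have hb0 : 0 ≤ b := (measureReal_nonneg).trans (hb 0)
  have hc : 0 ≤ 1 + b / η := by positivity
  have h1 : logHaz μ B ≤ ENNReal.ofReal (1 + b / η) * μ B := by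
    rw [logHaz, withDensity_apply _ hB, ← setLIntegral_const]
    refine lintegral_mono fun s => ENNReal.ofReal_le_ofReal ?_
    have h2 := atomFactor_sub_one_le (a := μ.real {s}) measureReal_nonneg (hμ s)
    have h3 : μ.real {s} / (1 - μ.real {s}) ≤ b / η := div_le_div₀ hb0 (hb s) hη (hμη s)
    linarith
  have h4 := ENNReal.toReal_mono (ENNReal.mul_ne_top ENNReal.ofReal_ne_top (measure_ne_top _ _)) h1
  rwa [ENNReal.toReal_mul, ENNReal.toReal_ofReal hc] at h4

theorem abs_exp_neg_sub_le {a b : ℝ} (ha : 0 ≤ a) (hb : 0 ≤ b) :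
    |Real.exp (-a) - Real.exp (-b)| ≤ |a - b| := by
  wlog hab : a ≤ b generalizing a b
  · rw [abs_sub_comm, abs_sub_comm a]
    exact this hb ha (not_le.1 hab).le
  have h1 : Real.exp (-b) = Real.exp (-a) * Real.exp (-(b - a)) := by
    rw [← Real.exp_add]; congr 1; ring
  have h2 : 1 - (b - a) ≤ Real.exp (-(b - a)) := by
    have := Real.add_one_le_exp (-(b - a)); linarith
  have h3 : Real.exp (-a) ≤ 1 := Real.exp_le_one_iff.2 (by linarith)
  have h4 : Real.exp (-b) ≤ Real.exp (-a) := Real.exp_le_exp.2 (by linarith)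
  rw [abs_of_nonneg (by linarith), abs_sub_comm, abs_of_nonneg (by linarith : 0 ≤ b - a), h1]
  nlinarith [Real.exp_pos (-a)]

/-- Stability of the product integral near a measure without atoms: the atoms of `μ'` are then of
size at most `2 * ε`, so that `logHaz μ'` differs from `μ'` by a term of order `ε`. -/
theorem abs_exp_logHaz_sub_le [NullSingletonClass μ] {η : ℝ} (hη : 0 < η)
    (hμ' : ∀ s, μ'.real {s} < 1) (hmass : η ≤ Real.exp (-(logHaz μ').real univ))
    (h : ∀ s, |μ'.real (Iic s) - μ.real (Iic s)| ≤ ε) {I : Set ℝ} (hI : IsLowerSet I)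
    (hIm : MeasurableSet I) :
    |Real.exp (-(logHaz μ').real I) - Real.exp (-μ.real I)| ≤ (1 + 2 / η ^ 2) * ε := by
  have hfin := isFiniteMeasure_logHaz hμ'
  have hε : 0 ≤ ε := (abs_nonneg _).trans (h 0)
  refine (abs_exp_neg_sub_le measureReal_nonneg measureReal_nonneg).trans ?_
  -- the factor `1 - μ'{s}` of the product integral is at least the whole product integral
  have hη' : ∀ s, η ≤ 1 - μ'.real {s} := fun s => by
    refine hmass.trans ?_
    have h1 : (logHaz μ').real {s} ≤ (logHaz μ').real univ := measureReal_mono (subset_univ _)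
    rw [logHaz_singleton hμ'] at h1
    have h2 : Real.exp (Real.log (1 - μ'.real {s})) = 1 - μ'.real {s} :=
      Real.exp_log (by linarith [hμ' s])
    rw [← h2]
    exact Real.exp_le_exp.2 (by linarith)
  have h1 := logHaz_real_le hη hμ' hη' (atom_le_of_abs_sub_le h) I hIm
  have h2 : μ'.real I ≤ (logHaz μ').real I :=
    ENNReal.toReal_mono (measure_ne_top _ _) (le_logHaz hμ' I)
  have h3 := abs_le.1 (abs_sub_lowerSet_le h hI)
  have h4 : μ'.real I ≤ 1 / η := by
    refine (measureReal_mono (subset_univ _)).trans (le_trans ?_ (le_inv_of_le_exp_neg hη hmass))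
    exact ENNReal.toReal_mono (measure_ne_top _ _) (le_logHaz hμ' univ)
  have h5 : 2 * ε / η * μ'.real I ≤ 2 * ε / η * (1 / η) :=
    mul_le_mul_of_nonneg_left h4 (by positivity)
  have h6 : 2 * ε / η * (1 / η) = 2 / η ^ 2 * ε := by field_simp
  rw [abs_le]
  constructor <;> nlinarith

theorem abs_div_sub_div_le {p q r s η : ℝ} (hη : 0 < η) (hq : η ≤ q) (hs : η ≤ s) :
    |p / q - r / s| ≤ |p - r| / η + |r| * |q - s| / η ^ 2 := by
  have hq0 : 0 < q := hη.trans_le hq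
  have hs0 : 0 < s := hη.trans_le hs
  have h1 : p / q - r / s = (p - r) / q + r * (s - q) / (q * s) := by field_simp; ring
  rw [h1]
  refine (abs_add_le _ _).trans (add_le_add ?_ ?_)
  · rw [abs_div, abs_of_pos hq0]
    exact div_le_div_of_nonneg_left (abs_nonneg _) hη hq
  · rw [abs_div, abs_mul, abs_of_pos (mul_pos hq0 hs0), abs_sub_comm s q]
    refine div_le_div_of_nonneg_left (by positivity) (by positivity) ?_
    rw [sq]
    exact mul_le_mul hq hs hη.le hq0.le

end Perturbation

/-! ### Stability of the influence function -/

namespace Nuisance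

variable {𝒳 : Type*}

/-- All cumulative hazards of `ν` and `ν'` given `(a, x)` are within `ε` of each other on
`[0, T]`. -/
def CloseAt (ν ν' : Nuisance 𝒳) (T : ℝ) (a : Fin 2) (x : 𝒳) (ε : ℝ) : Prop :=
  ∀ δ, ∀ s ∈ Icc 0 T, |ν'.cumHaz δ s a x - ν.cumHaz δ s a x| ≤ ε

namespace Regular

variable {ν ν' : Nuisance 𝒳} {η T : ℝ} {a : Fin 2} {x : 𝒳} {ε : ℝ}

theorem cumHaz_eq (hν : ν.Regular η T) (δ : Fin 3) (s : ℝ) (a : Fin 2) (x : 𝒳) :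
    ν.cumHaz δ s a x = (ν.haz δ a x).real (Iic s) :=
  measureReal_eq_of_restrict_eq (restrict_Ioc_eq (hν.support _ _ _) s)

theorem closeAt_Iic (hν : ν.Regular η T) (hν' : ν'.Regular η T) (h : ν.CloseAt ν' T a x ε)
    (δ : Fin 3) (s : ℝ) :
    |(ν'.haz δ a x).real (Iic s) - (ν.haz δ a x).real (Iic s)| ≤ ε := by
  have hf := hν.finite δ a x
  have hf' := hν'.finite δ a x
  rcases lt_or_ge s 0 with hs | hs
  · have h0 : ∀ μ : Measure ℝ, μ (Ioc 0 T)ᶜ = 0 → μ.real (Iic s) = 0 := fun μ hμ => by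
      rw [measureReal_def, measure_mono_null _ hμ]
      · rfl
      · exact fun r hr hr2 => absurd (hr2.1.trans_le hr) (not_lt.2 hs.le)
    rw [h0 _ (hν.support _ _ _), h0 _ (hν'.support _ _ _), sub_self, abs_zero]
    exact (abs_nonneg _).trans (h 0 0 ⟨le_rfl, hν.time_pos.le⟩)
  rcases le_or_gt s T with hsT | hsT
  · rw [← hν.cumHaz_eq, ← hν'.cumHaz_eq]
    exact h δ s ⟨hs, hsT⟩
  · have h0 : ∀ μ : Measure ℝ, IsFiniteMeasure μ → μ (Ioc 0 T)ᶜ = 0 →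
        μ.real (Iic s) = μ.real (Iic T) := fun μ _ hμ => by
      refine le_antisymm ?_ (measureReal_mono (Iic_subset_Iic.2 hsT.le))
      rw [← real_univ_eq μ hμ]
      exact measureReal_mono (subset_univ _)
    rw [h0 _ hf (hν.support _ _ _), h0 _ hf' (hν'.support _ _ _), ← hν.cumHaz_eq, ← hν'.cumHaz_eq]
    exact h δ T ⟨hν.time_pos.le, le_rfl⟩

theorem closeAt_allCause_Iic (hν : ν.Regular η T) (hν' : ν'.Regular η T)
    (h : ν.CloseAt ν' T a x ε) (s : ℝ) :
    |(ν'.allCause a x).real (Iic s) - (ν.allCause a x).real (Iic s)| ≤ 2 * ε := by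
  have := hν.finite
  have := hν'.finite
  have h1 := abs_le.1 (hν.closeAt_Iic hν' h 1 s)
  have h2 := abs_le.1 (hν.closeAt_Iic hν' h 2 s)
  rw [allCause, allCause, measureReal_add_apply, measureReal_add_apply, abs_le]
  constructor <;> linarith

theorem eps_nonneg (hν : ν.Regular η T) (h : ν.CloseAt ν' T a x ε) : 0 ≤ ε :=
  (abs_nonneg _).trans (h 0 0 ⟨le_rfl, hν.time_pos.le⟩)

theorem nullSingletonClass_allCause (hcont : ∀ δ a x, NullSingletonClass (ν.haz δ a x))
    (a : Fin 2) (x : 𝒳) : NullSingletonClass (ν.allCause a x) :=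
  ⟨fun s => by have := hcont 1 a x; have := hcont 2 a x; simp [allCause]⟩

theorem logHaz_of_nullSingletonClass (μ : Measure ℝ) [NullSingletonClass μ] : logHaz μ = μ := by
  rw [logHaz]
  simp [measureReal_def, atomFactor]

theorem le_exp_logHaz_allCause (hν : ν.Regular η T) (a : Fin 2) (x : 𝒳) :
    η ≤ Real.exp (-(logHaz (ν.allCause a x)).real univ) := by
  rw [real_univ_eq _ (logHaz_eq_zero (hν.allCause_support a x)), ← hν.surv_eq]
  exact (hν.lt_surv _ _ _).le

theorem le_exp_logHaz_cens (hν : ν.Regular η T) (a : Fin 2) (x : 𝒳) :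
    η ≤ Real.exp (-(logHaz (ν.haz 0 a x)).real univ) := by
  rw [real_univ_eq _ (logHaz_eq_zero (hν.support 0 a x)), ← hν.censSurv_eq]
  exact (hν.lt_censSurv _ _ _).le

section

variable (hν : ν.Regular η T) (hν' : ν'.Regular η T)
  (hcont : ∀ δ a x, NullSingletonClass (ν.haz δ a x)) (h : ν.CloseAt ν' T a x ε)

include hν hν' hcont h

theorem abs_surv_sub_le (t : ℝ) :
    |ν'.surv t a x - ν.surv t a x| ≤ (2 + 4 / η ^ 2) * ε := by
  have := hν.isFiniteMeasure_allCause a x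
  have := hν'.isFiniteMeasure_allCause a x
  have := nullSingletonClass_allCause hcont a x
  rw [hν.surv_eq, hν'.surv_eq, logHaz_of_nullSingletonClass (ν.allCause a x)]
  exact (abs_exp_logHaz_sub_le hν.eta_pos (hν'.allCause_atom a x) (hν'.le_exp_logHaz_allCause a x)
    (hν.closeAt_allCause_Iic hν' h) (isLowerSet_Iic t) measurableSet_Iic).trans_eq (by ring)

theorem abs_survLeft_sub_le (t : ℝ) :
    |ν'.survLeft t a x - ν.survLeft t a x| ≤ (2 + 4 / η ^ 2) * ε := by
  have := hν.isFiniteMeasure_allCause a x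
  have := hν'.isFiniteMeasure_allCause a x
  have := nullSingletonClass_allCause hcont a x
  rw [hν.survLeft_eq, hν'.survLeft_eq, logHaz_of_nullSingletonClass (ν.allCause a x)]
  exact (abs_exp_logHaz_sub_le hν.eta_pos (hν'.allCause_atom a x) (hν'.le_exp_logHaz_allCause a x)
    (hν.closeAt_allCause_Iic hν' h) (isLowerSet_Iio t) measurableSet_Iio).trans_eq (by ring)

theorem abs_censSurv_sub_le (t : ℝ) :
    |ν'.censSurv t a x - ν.censSurv t a x| ≤ (2 + 4 / η ^ 2) * ε := by
  have := hν.finite 0 a x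
  have := hν'.finite 0 a x
  have := hcont 0 a x
  have hε := hν.eps_nonneg h
  rw [hν.censSurv_eq, hν'.censSurv_eq, logHaz_of_nullSingletonClass (ν.haz 0 a x)]
  refine (abs_exp_logHaz_sub_le hν.eta_pos (hν'.cens_atom a x) (hν'.le_exp_logHaz_cens a x)
    (hν.closeAt_Iic hν' h 0) (isLowerSet_Iic t) measurableSet_Iic).trans ?_
  have hη := hν.eta_pos
  have : (1 + 2 / η ^ 2) * ε + (1 + 2 / η ^ 2) * ε = (2 + 4 / η ^ 2) * ε := by ring
  have h2 : 0 ≤ (1 + 2 / η ^ 2) * ε := by positivity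
  linarith

theorem abs_cif_sub_le (j : Fin 2) (t : ℝ) :
    |ν'.cif j t a x - ν.cif j t a x| ≤ ((2 + 4 / η ^ 2) / η + 1) * ε := by
  have hf := hν.finite j.succ a x
  have hf' := hν'.finite j.succ a x
  have hη := hν.eta_pos
  have hε := hν.eps_nonneg h
  have h1 := abs_integral_sub_le_of_antitone
    (abs_sub_Iic_restrict_le (hν.closeAt_Iic hν' h j.succ) t)
    (hν.survLeft_antitone a x) (M := 1) (fun s => (hη.trans (hν.lt_survLeft s a x)).le)
    (fun s => hν.survLeft_le_one s a x)
  have h2 := norm_setIntegral_le_of_norm_le_const (μ := ν'.haz j.succ a x) (s := Iic t)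
    (C := (2 + 4 / η ^ 2) * ε) (f := fun s => ν'.survLeft s a x - ν.survLeft s a x)
    (measure_lt_top _ _) (fun s _ => hν.abs_survLeft_sub_le hν' hcont h s)
  rw [integral_sub (hν'.integrable_survLeft a x _) (hν.integrable_survLeft a x _)] at h2
  have h3 : (2 + 4 / η ^ 2) * ε * (ν'.haz j.succ a x).real (Iic t) ≤
      (2 + 4 / η ^ 2) * ε * (1 / η) := mul_le_mul_of_nonneg_left
    ((measureReal_mono (subset_univ _)).trans (hν'.haz_le j.succ a x)) (by positivity)
  rw [hν.cif_eq, hν'.cif_eq]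
  -- first change the integrand, then the monotone integrand `S` allows to change the hazard
  refine (abs_sub_le _ (∫ s in Iic t, ν.survLeft s a x ∂(ν'.haz j.succ a x)) _).trans ?_
  have h4 := h2.trans h3
  rw [Real.norm_eq_abs] at h4
  calc _ ≤ (2 + 4 / η ^ 2) * ε * (1 / η) + 1 * ε := add_le_add h4 h1
    _ = _ := by ring

end

end Regular

end Nuisance

namespace Nuisance

variable {𝒳 : Type*}

/-- The integrand `H_ij(s, T) / S_C(s)` of the martingale part of the influence function. -/
def integrand (ν : Nuisance 𝒳) (i j : Fin 2) (T : ℝ) (a : Fin 2) (x : 𝒳) (s : ℝ) : ℝ :=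
  ν.H i j s T a x / ν.censSurv s a x

/-- The martingale part of the influence function, before inverse propensity weighting. -/
def martingalePart (ν : Nuisance 𝒳) (j : Fin 2) (T : ℝ) (o : Obs 𝒳) : ℝ :=
  ∑ i : Fin 2, ν.martingaleIntegral i (ν.integrand i j T o.arm o.cov) T o

/-- The signed inverse propensity weight `1(A = 1) / π(1 | X) - 1(A = 0) / π(0 | X)`. -/
def signedWeight (ν : Nuisance 𝒳) (a : Fin 2) (x : 𝒳) : ℝ :=
  (if a = 1 then 1 else 0) / ν.ps 1 x - (if a = 0 then 1 else 0) / ν.ps 0 x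

theorem phi_eq (ν : Nuisance 𝒳) (j : Fin 2) (T : ℝ) (o : Obs 𝒳) :
    ν.phi j T o = ν.cate j T o.cov + ν.signedWeight o.arm o.cov * ν.martingalePart j T o := rfl

namespace Regular

variable {ν ν' : Nuisance 𝒳} {η T : ℝ} {a : Fin 2} {x : 𝒳} {ε : ℝ}

theorem abs_H_le (hν : ν.Regular η T) (i j : Fin 2) {s : ℝ} (hs : s ∈ Icc 0 T) :
    |ν.H i j s T a x| ≤ (1 + 1 / η ^ 2) * T := by
  have hη := hν.eta_pos
  have h1 : ∀ u ∈ uIoc s T,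
      ‖(if i = j then (1 : ℝ) else 0) + (ν.cif j s a x - ν.cif j u a x) / ν.surv s a x‖ ≤
        1 + 1 / η ^ 2 := fun u _ => by
    refine (norm_add_le _ _).trans (add_le_add (by split_ifs <;> simp) ?_)
    have h2 := hν.cif_nonneg j s a x
    have h3 := hν.cif_nonneg j u a x
    have h4 := hν.cif_le j s a x
    have h5 := hν.cif_le j u a x
    rw [norm_div, Real.norm_eq_abs, Real.norm_of_nonneg (hη.trans (hν.lt_surv s a x)).le,
      sq, ← div_div]
    exact div_le_div₀ (by positivity) (abs_le.2 ⟨by linarith, by linarith⟩) hη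
      (hν.lt_surv s a x).le
  refine (intervalIntegral.norm_integral_le_of_norm_le_const h1).trans ?_
  rw [abs_of_nonneg (by linarith [hs.2])]
  exact mul_le_mul_of_nonneg_left (by linarith [hs.1]) (by positivity)

theorem abs_H_sub_le (hν : ν.Regular η T) (hν' : ν'.Regular η T)
    (hcont : ∀ δ a x, NullSingletonClass (ν.haz δ a x)) (h : ν.CloseAt ν' T a x ε)
    (i j : Fin 2) {s : ℝ} (hs : s ∈ Icc 0 T) :
    |ν'.H i j s T a x - ν.H i j s T a x| ≤
      ((2 * ((2 + 4 / η ^ 2) / η + 1)) / η + (2 + 4 / η ^ 2) / η ^ 3) * ε * T := by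
  have hη := hν.eta_pos
  have hε := hν.eps_nonneg h
  have hint : ∀ {ν₁ : Nuisance 𝒳}, ν₁.Regular η T → IntervalIntegrable (fun u =>
      (if i = j then (1 : ℝ) else 0) + (ν₁.cif j s a x - ν₁.cif j u a x) / ν₁.surv s a x)
        volume s T := fun {ν₁} h₁ =>
    (intervalIntegrable_const.add ((intervalIntegrable_const.sub
      (h₁.cif_mono j a x).intervalIntegrable).div_const _))
  rw [H, H, ← intervalIntegral.integral_sub (hint hν') (hint hν)]
  have h1 : ∀ u ∈ uIoc s T,
      ‖((if i = j then (1 : ℝ) else 0) + (ν'.cif j s a x - ν'.cif j u a x) / ν'.surv s a x) -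
        ((if i = j then (1 : ℝ) else 0) + (ν.cif j s a x - ν.cif j u a x) / ν.surv s a x)‖ ≤
      ((2 * ((2 + 4 / η ^ 2) / η + 1)) / η + (2 + 4 / η ^ 2) / η ^ 3) * ε := fun u _ => by
    rw [add_sub_add_left_eq_sub]
    refine (abs_div_sub_div_le hη (hν'.lt_surv s a x).le (hν.lt_surv s a x).le).trans ?_
    have h2 := hν.cif_nonneg j s a x
    have h3 := hν.cif_nonneg j u a x
    have h4 := hν.cif_le j s a x
    have h5 := hν.cif_le j u a x
    have h6 := abs_le.1 (hν.abs_cif_sub_le hν' hcont h j s)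
    have h7 := abs_le.1 (hν.abs_cif_sub_le hν' hcont h j u)
    have h8 := hν.abs_surv_sub_le hν' hcont h s
    have h9 : |ν'.cif j s a x - ν'.cif j u a x - (ν.cif j s a x - ν.cif j u a x)| ≤
        2 * ((2 + 4 / η ^ 2) / η + 1) * ε := abs_le.2 ⟨by linarith, by linarith⟩
    have h10 : |ν.cif j s a x - ν.cif j u a x| ≤ 1 / η := abs_le.2 ⟨by linarith, by linarith⟩
    calc _ ≤ 2 * ((2 + 4 / η ^ 2) / η + 1) * ε / η + (1 / η) * ((2 + 4 / η ^ 2) * ε) / η ^ 2 := by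
          gcongr
      _ = _ := by field_simp
  refine (intervalIntegral.norm_integral_le_of_norm_le_const h1).trans ?_
  rw [abs_of_nonneg (by linarith [hs.2])]
  exact mul_le_mul_of_nonneg_left (by linarith [hs.1]) (by positivity)

theorem abs_integrand_le (hν : ν.Regular η T) (i j : Fin 2) {s : ℝ} (hs : s ∈ Icc 0 T) :
    |ν.integrand i j T a x s| ≤ (1 + 1 / η ^ 2) * T / η := by
  have hη := hν.eta_pos
  have hT := hν.time_pos
  rw [integrand, abs_div, abs_of_pos (hη.trans (hν.lt_censSurv s a x))]
  exact div_le_div₀ (by positivity) (hν.abs_H_le i j hs) hη (hν.lt_censSurv s a x).le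

theorem exists_abs_integrand_sub_le (η T : ℝ) : ∃ C : ℝ, ∀ {ν ν' : Nuisance 𝒳} {a : Fin 2}
    {x : 𝒳} {ε : ℝ}, ν.Regular η T → ν'.Regular η T →
    (∀ δ a x, NullSingletonClass (ν.haz δ a x)) → ν.CloseAt ν' T a x ε →
    ∀ i j : Fin 2, ∀ s ∈ Icc 0 T,
      |ν'.integrand i j T a x s - ν.integrand i j T a x s| ≤ C * ε := by
  refine ⟨((2 * ((2 + 4 / η ^ 2) / η + 1)) / η + (2 + 4 / η ^ 2) / η ^ 3) * T / η +
    (1 + 1 / η ^ 2) * T * (2 + 4 / η ^ 2) / η ^ 2, ?_⟩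
  intro ν ν' a x ε hν hν' hcont h i j s hs
  have hη := hν.eta_pos
  have hT := hν.time_pos
  have hε := hν.eps_nonneg h
  refine (abs_div_sub_div_le hη (hν'.lt_censSurv s a x).le (hν.lt_censSurv s a x).le).trans ?_
  have h1 := hν.abs_H_sub_le hν' hcont h i j hs
  have h2 := hν.abs_H_le (a := a) (x := x) i j hs
  have h3 := hν.abs_censSurv_sub_le hν' hcont h s
  calc _ ≤ ((2 * ((2 + 4 / η ^ 2) / η + 1)) / η + (2 + 4 / η ^ 2) / η ^ 3) * ε * T / η +
        ((1 + 1 / η ^ 2) * T) * ((2 + 4 / η ^ 2) * ε) / η ^ 2 := by gcongr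
    _ = _ := by ring

/-- On `(0, T]` the integrand is a combination of four bounded nonnegative monotone functions.
Hence its integrals against two hazards differ by at most a multiple of the uniform distance of the
cumulative hazards. -/
theorem integrand_eq (hν : ν.Regular η T) (i j : Fin 2) {s : ℝ} (hs : s ∈ Ioc 0 T) :
    ν.integrand i j T a x s =
      (if i = j then 1 else 0) *
        (T * (ν.censSurv s a x)⁻¹ - max 0 (min s T) * (ν.censSurv s a x)⁻¹) -
      (ν.futureLoss j T 0 a x * ((ν.surv s a x)⁻¹ * (ν.censSurv s a x)⁻¹) -
        (ν.futureLoss j T 0 a x - ν.futureLoss j T (max s 0) a x) *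
          ((ν.surv s a x)⁻¹ * (ν.censSurv s a x)⁻¹)) := by
  rw [integrand, hν.H_eq i j hs.2, min_eq_left hs.2, max_eq_right hs.1.le, max_eq_left hs.1.le]
  split_ifs <;> ring

theorem inv_surv_mono (hν : ν.Regular η T) (a : Fin 2) (x : 𝒳) :
    Monotone fun s => (ν.surv s a x)⁻¹ := fun _ t hst =>
  inv_anti₀ (hν.eta_pos.trans (hν.lt_surv t a x)) (hν.surv_antitone a x hst)

theorem inv_censSurv_mono (hν : ν.Regular η T) (a : Fin 2) (x : 𝒳) :
    Monotone fun s => (ν.censSurv s a x)⁻¹ := fun _ t hst =>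
  inv_anti₀ (hν.eta_pos.trans (hν.lt_censSurv t a x)) (hν.censSurv_antitone a x hst)

/-- The expression is that of `integrand_eq`; it is measurable on the whole real line, unlike the
integrand itself, which is not controlled beyond `T`. -/
theorem measurable_clampInv (hν : ν.Regular η T) (a : Fin 2) (x : 𝒳) (i j : Fin 2) :
    Measurable fun s => (if i = j then (1 : ℝ) else 0) *
        (T * (ν.censSurv s a x)⁻¹ - max 0 (min s T) * (ν.censSurv s a x)⁻¹) -
      (ν.futureLoss j T 0 a x * ((ν.surv s a x)⁻¹ * (ν.censSurv s a x)⁻¹) -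
        (ν.futureLoss j T 0 a x - ν.futureLoss j T (max s 0) a x) *
          ((ν.surv s a x)⁻¹ * (ν.censSurv s a x)⁻¹)) := by
  have h1 := (hν.inv_surv_mono a x).measurable
  have h2 := (hν.inv_censSurv_mono a x).measurable
  have h3 : Measurable fun s : ℝ => ν.futureLoss j T (max s 0) a x :=
    (hν.futureLoss_antitone j a x).measurable.comp (measurable_id.max measurable_const)
  fun_prop

theorem abs_integral_integrand_sub_le (hν : ν.Regular η T) (hν' : ν'.Regular η T)
    (h : ν.CloseAt ν' T a x ε) (i j : Fin 2) (t : ℝ) :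
    |∫ s in Iic t, ν.integrand i j T a x s ∂(ν'.haz i.succ a x) -
      ∫ s in Iic t, ν.integrand i j T a x s ∂(ν.haz i.succ a x)| ≤
        (4 * T / η + 4 * T / η ^ 3) * ε := by
  have hf := hν.finite i.succ a x
  have hf' := hν'.finite i.succ a x
  have hη := hν.eta_pos
  have hT := hν.time_pos
  have hε := hν.eps_nonneg h
  have hclose := abs_sub_Iic_restrict_le (hν.closeAt_Iic hν' h i.succ) t
  have hS : ∀ s, 0 ≤ (ν.surv s a x)⁻¹ := fun s =>
    inv_nonneg.2 (hη.trans (hν.lt_surv s a x)).le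
  have hC : ∀ s, 0 ≤ (ν.censSurv s a x)⁻¹ := fun s =>
    inv_nonneg.2 (hη.trans (hν.lt_censSurv s a x)).le
  have hS1 : ∀ s, (ν.surv s a x)⁻¹ ≤ 1 / η := fun s => by
    rw [one_div]; exact inv_anti₀ hη (hν.lt_surv s a x).le
  have hC1 : ∀ s, (ν.censSurv s a x)⁻¹ ≤ 1 / η := fun s => by
    rw [one_div]; exact inv_anti₀ hη (hν.lt_censSurv s a x).le
  have hV0 := hν.futureLoss_nonneg j 0 a x
  have hV1 := hν.futureLoss_le j 0 a x
  have hVs : ∀ s : ℝ, 0 ≤ ν.futureLoss j T 0 a x - ν.futureLoss j T (max s 0) a x := fun s =>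
    sub_nonneg.2 (hν.futureLoss_antitone j a x (le_max_right s 0))
  have hVs1 : ∀ s : ℝ,
      ν.futureLoss j T 0 a x - ν.futureLoss j T (max s 0) a x ≤ T / η := fun s => by
    have := hν.futureLoss_nonneg j (max s 0) a x
    linarith
  have hm2 : Monotone fun s => (ν.surv s a x)⁻¹ * (ν.censSurv s a x)⁻¹ :=
    (hν.inv_surv_mono a x).mul (hν.inv_censSurv_mono a x) hS hC
  have hC2 : ∀ s, (ν.surv s a x)⁻¹ * (ν.censSurv s a x)⁻¹ ≤ 1 / η * (1 / η) := fun s =>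
    mul_le_mul (hS1 s) (hC1 s) (hC s) (by positivity)
  set f1 : ℝ → ℝ := fun s => T * (ν.censSurv s a x)⁻¹ with hf1
  set f2 : ℝ → ℝ := fun s => max 0 (min s T) * (ν.censSurv s a x)⁻¹ with hf2
  set f3 : ℝ → ℝ := fun s =>
    ν.futureLoss j T 0 a x * ((ν.surv s a x)⁻¹ * (ν.censSurv s a x)⁻¹) with hf3
  set f4 : ℝ → ℝ := fun s => (ν.futureLoss j T 0 a x - ν.futureLoss j T (max s 0) a x) *
          ((ν.surv s a x)⁻¹ * (ν.censSurv s a x)⁻¹) with hf4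
  have m1 : Monotone f1 := (hν.inv_censSurv_mono a x).const_mul hT.le
  have m2 : Monotone f2 := Monotone.mul
    (fun s t hst => max_le_max le_rfl (min_le_min hst le_rfl)) (hν.inv_censSurv_mono a x)
    (fun s => le_max_left _ _) hC
  have m3 : Monotone f3 := hm2.const_mul hV0
  have m4 : Monotone f4 := Monotone.mul
    (fun s t hst => sub_le_sub_left (hν.futureLoss_antitone j a x (max_le_max hst le_rfl)) _) hm2
    hVs (fun s => mul_nonneg (hS s) (hC s))
  have n1 : ∀ s, 0 ≤ f1 s := fun s => mul_nonneg hT.le (hC s)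
  have n2 : ∀ s, 0 ≤ f2 s := fun s => mul_nonneg (le_max_left _ _) (hC s)
  have n3 : ∀ s, 0 ≤ f3 s := fun s => mul_nonneg hV0 (mul_nonneg (hS s) (hC s))
  have n4 : ∀ s, 0 ≤ f4 s := fun s => mul_nonneg (hVs s) (mul_nonneg (hS s) (hC s))
  have b1 : ∀ s, f1 s ≤ T * (1 / η) := fun s => mul_le_mul_of_nonneg_left (hC1 s) hT.le
  have b2 : ∀ s, f2 s ≤ T * (1 / η) := fun s =>
    mul_le_mul (max_le hT.le (min_le_right _ _)) (hC1 s) (hC s) hT.le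
  have b3 : ∀ s, f3 s ≤ T / η * (1 / η * (1 / η)) := fun s =>
    mul_le_mul hV1 (hC2 s) (mul_nonneg (hS s) (hC s)) (by positivity)
  have b4 : ∀ s, f4 s ≤ T / η * (1 / η * (1 / η)) := fun s =>
    mul_le_mul (hVs1 s) (hC2 s) (mul_nonneg (hS s) (hC s)) (by positivity)
  have hint : ∀ {f : ℝ → ℝ} {M : ℝ}, Monotone f → (∀ s, 0 ≤ f s) → (∀ s, f s ≤ M) →
      ∀ (m : Measure ℝ) [IsFiniteMeasure m], Integrable f m := fun hm hn hb m _ =>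
    Integrable.of_bound hm.measurable.aestronglyMeasurable _ (Eventually.of_forall fun s => by
      rw [Real.norm_of_nonneg (hn s)]; exact hb s)
  have key : ∀ {ν₁ : Nuisance 𝒳}, ν₁.Regular η T →
      ∫ s in Iic t, ν.integrand i j T a x s ∂(ν₁.haz i.succ a x) =
      (if i = j then 1 else 0) * (∫ s in Iic t, f1 s ∂(ν₁.haz i.succ a x) -
        ∫ s in Iic t, f2 s ∂(ν₁.haz i.succ a x)) -
      (∫ s in Iic t, f3 s ∂(ν₁.haz i.succ a x) - ∫ s in Iic t, f4 s ∂(ν₁.haz i.succ a x)) := by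
    intro ν₁ h₁
    have := h₁.finite i.succ a x
    have i1 := hint m1 n1 b1 ((ν₁.haz i.succ a x).restrict (Iic t))
    have i2 := hint m2 n2 b2 ((ν₁.haz i.succ a x).restrict (Iic t))
    have i3 := hint m3 n3 b3 ((ν₁.haz i.succ a x).restrict (Iic t))
    have i4 := hint m4 n4 b4 ((ν₁.haz i.succ a x).restrict (Iic t))
    have i12 : Integrable (fun s => (if i = j then (1 : ℝ) else 0) * (f1 s - f2 s))
        ((ν₁.haz i.succ a x).restrict (Iic t)) := (i1.sub i2).const_mul _
    have i34 : Integrable (fun s => f3 s - f4 s) ((ν₁.haz i.succ a x).restrict (Iic t)) :=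
      i3.sub i4
    rw [← integral_sub i1 i2, ← integral_sub i3 i4, ← integral_const_mul, ← integral_sub i12 i34]
    refine integral_congr_ae (ae_restrict_of_ae ?_)
    filter_upwards [h₁.ae_mem i.succ a x] with s hs
    exact hν.integrand_eq i j hs
  rw [key hν', key hν]
  have d1 := abs_le.1 (abs_integral_sub_le_of_monotone hclose m1 n1 b1)
  have d2 := abs_le.1 (abs_integral_sub_le_of_monotone hclose m2 n2 b2)
  have d3 := abs_le.1 (abs_integral_sub_le_of_monotone hclose m3 n3 b3)
  have d4 := abs_le.1 (abs_integral_sub_le_of_monotone hclose m4 n4 b4)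
  have e1 : (4 * T / η + 4 * T / η ^ 3) * ε =
    2 * (T * (1 / η) * (2 * ε)) + 2 * (T / η * (1 / η * (1 / η)) * (2 * ε)) := by
    field_simp
    ring
  rw [e1, abs_le]
  have p1 : 0 ≤ T * (1 / η) * (2 * ε) := by positivity
  split_ifs
  · constructor <;> linarith
  · constructor <;> linarith

theorem integrableOn_integrand (hν : ν.Regular η T) (hν' : ν'.Regular η T) (i j : Fin 2) (δ : Fin 3)
    (B : Set ℝ) : IntegrableOn (ν.integrand i j T a x) B (ν'.haz δ a x) := by
  have := hν'.finite δ a x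
  refine Integrable.integrableOn ?_
  refine Integrable.of_bound (C := (1 + 1 / η ^ 2) * T / η) ?_ ?_
  · refine (hν.measurable_clampInv a x i j).aestronglyMeasurable.congr ?_
    filter_upwards [hν'.ae_mem δ a x] with s hs
    exact (hν.integrand_eq i j hs).symm
  · filter_upwards [hν'.ae_mem δ a x] with s hs
    exact hν.abs_integrand_le i j ⟨hs.1.le, hs.2⟩

/-- The compensator may be integrated up to the observed time, as the hazards vanish beyond `T`. -/
theorem martingaleIntegral_eq (hν : ν.Regular η T) (i j : Fin 2) (o : Obs 𝒳) :
    ν.martingaleIntegral i (ν.integrand i j T o.arm o.cov) T o =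
      (if o.event = i.succ ∧ o.time ∈ Ioc 0 T then ν.integrand i j T o.arm o.cov o.time else 0) -
        ∫ s in Iic o.time, ν.integrand i j T o.arm o.cov s ∂(ν.haz i.succ o.arm o.cov) := by
  rw [martingaleIntegral]
  congr 2
  have h1 := restrict_Ioc_horizon (hν.support i.succ o.arm o.cov)
  have h2 : Ioc 0 (min T o.time) = Iic o.time ∩ Ioc 0 T := by
    ext s
    simp only [mem_Ioc, le_min_iff, mem_inter_iff, mem_Iic]
    tauto
  rw [h2, ← Measure.restrict_restrict measurableSet_Iic, h1]

theorem abs_martingaleIntegral_le (hν : ν.Regular η T) (i j : Fin 2) (o : Obs 𝒳) :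
    |ν.martingaleIntegral i (ν.integrand i j T o.arm o.cov) T o| ≤
      (1 + 1 / η ^ 2) * T / η * (1 + 1 / η) := by
  have hη := hν.eta_pos
  have hT := hν.time_pos
  have := hν.finite i.succ o.arm o.cov
  rw [hν.martingaleIntegral_eq, mul_add, mul_one]
  refine (abs_sub _ _).trans (add_le_add ?_ ?_)
  · split_ifs with h
    · exact hν.abs_integrand_le i j ⟨h.2.1.le, h.2.2⟩
    · rw [abs_zero]; positivity
  · have hm : (ν.haz i.succ o.arm o.cov).real (Iic o.time) ≤ 1 / η :=
      (measureReal_mono (subset_univ _)).trans (hν.haz_le i.succ o.arm o.cov)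
    refine (norm_setIntegral_le_of_norm_le_const_ae' (C := (1 + 1 / η ^ 2) * T / η)
      (f := fun s => ν.integrand i j T o.arm o.cov s)
        (measure_lt_top _ _) ?_).trans (mul_le_mul_of_nonneg_left hm (by positivity))
    filter_upwards [hν.ae_mem i.succ o.arm o.cov] with s hs _
    exact hν.abs_integrand_le i j ⟨hs.1.le, hs.2⟩

theorem exists_abs_martingaleIntegral_sub_le (η T : ℝ) : ∃ C : ℝ, ∀ {ν ν' : Nuisance 𝒳}
    {o : Obs 𝒳} {ε : ℝ}, ν.Regular η T → ν'.Regular η T →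
    (∀ δ a x, NullSingletonClass (ν.haz δ a x)) → ν.CloseAt ν' T o.arm o.cov ε →
    ∀ i j : Fin 2, |ν'.martingaleIntegral i (ν'.integrand i j T o.arm o.cov) T o -
      ν.martingaleIntegral i (ν.integrand i j T o.arm o.cov) T o| ≤ C * ε := by
  obtain ⟨C, hC⟩ := exists_abs_integrand_sub_le (𝒳 := 𝒳) η T
  refine ⟨|C| + (|C| * (1 / η) + (4 * T / η + 4 * T / η ^ 3)), ?_⟩
  intro ν ν' o ε hν hν' hcont h i j
  have hη := hν.eta_pos
  have hT := hν.time_pos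
  have hε := hν.eps_nonneg h
  have hf' := hν'.finite i.succ o.arm o.cov
  have hCs : ∀ s ∈ Icc 0 T, |ν'.integrand i j T o.arm o.cov s -
      ν.integrand i j T o.arm o.cov s| ≤ |C| * ε := fun s hs =>
    (hC hν hν' hcont h i j s hs).trans (mul_le_mul_of_nonneg_right (le_abs_self C) hε)
  rw [hν.martingaleIntegral_eq, hν'.martingaleIntegral_eq, sub_sub_sub_comm, add_mul]
  refine (abs_sub _ _).trans (add_le_add ?_ ?_)
  · split_ifs with h1
    · exact hCs _ ⟨h1.2.1.le, h1.2.2⟩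
    · rw [sub_zero, abs_zero]; positivity
  · refine (abs_sub_le _ (∫ s in Iic o.time, ν.integrand i j T o.arm o.cov s
      ∂(ν'.haz i.succ o.arm o.cov)) _).trans ?_
    rw [add_mul]
    refine add_le_add ?_ (hν.abs_integral_integrand_sub_le hν' h i j o.time)
    -- the integrands are uniformly close, and the hazards have bounded mass
    rw [← integral_sub (hν'.integrableOn_integrand hν' i j i.succ _)
      (hν.integrableOn_integrand hν' i j i.succ _)]
    have hm : (ν'.haz i.succ o.arm o.cov).real (Iic o.time) ≤ 1 / η :=
      (measureReal_mono (subset_univ _)).trans (hν'.haz_le i.succ o.arm o.cov)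
    rw [mul_right_comm]
    refine (norm_setIntegral_le_of_norm_le_const_ae' (C := |C| * ε)
      (f := fun s => ν'.integrand i j T o.arm o.cov s - ν.integrand i j T o.arm o.cov s)
      (measure_lt_top _ _) ?_).trans (mul_le_mul_of_nonneg_left hm (by positivity))
    filter_upwards [hν'.ae_mem i.succ o.arm o.cov] with s hs _
    exact hCs s ⟨hs.1.le, hs.2⟩

theorem abs_lifeYearsLost_sub_le (hν : ν.Regular η T) (hν' : ν'.Regular η T)
    (hcont : ∀ δ a x, NullSingletonClass (ν.haz δ a x)) (h : ν.CloseAt ν' T a x ε) (j : Fin 2) :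
    |ν'.lifeYearsLost j T a x - ν.lifeYearsLost j T a x| ≤
      ((2 + 4 / η ^ 2) / η + 1) * ε * T := by
  rw [lifeYearsLost, lifeYearsLost, ← intervalIntegral.integral_sub
    (hν'.cif_mono j a x).intervalIntegrable (hν.cif_mono j a x).intervalIntegrable]
  refine (intervalIntegral.norm_integral_le_of_norm_le_const
    (f := fun u => ν'.cif j u a x - ν.cif j u a x) fun u _ =>
      hν.abs_cif_sub_le hν' hcont h j u).trans_eq ?_
  rw [sub_zero, abs_of_pos hν.time_pos]

theorem abs_lifeYearsLost_le (hν : ν.Regular η T) (j : Fin 2) (a : Fin 2) (x : 𝒳) :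
    |ν.lifeYearsLost j T a x| ≤ 1 / η * T := by
  refine (intervalIntegral.norm_integral_le_of_norm_le_const (C := 1 / η)
    (f := fun u => ν.cif j u a x) fun u _ => ?_).trans_eq ?_
  · rw [Real.norm_of_nonneg (hν.cif_nonneg j u a x)]
    exact hν.cif_le j u a x
  · rw [sub_zero, abs_of_pos hν.time_pos]

theorem abs_cate_le (hν : ν.Regular η T) (j : Fin 2) (x : 𝒳) :
    |ν.cate j T x| ≤ 2 * (1 / η * T) := by
  refine (abs_sub _ _).trans ?_
  have := hν.abs_lifeYearsLost_le j 1 x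
  have := hν.abs_lifeYearsLost_le j 0 x
  linarith

theorem abs_signedWeight_le (hν : ν.Regular η T) (a : Fin 2) (x : 𝒳) :
    |ν.signedWeight a x| ≤ 1 / η := by
  have h : ∀ b, |1 / ν.ps b x| ≤ 1 / η := fun b => by
    rw [abs_of_pos (one_div_pos.2 (hν.eta_pos.trans (hν.lt_ps b x)))]
    exact one_div_le_one_div_of_le hν.eta_pos (hν.lt_ps b x).le
  fin_cases a
  · simpa [signedWeight] using h 0
  · simpa [signedWeight] using h 1

theorem abs_signedWeight_sub_le (hν : ν.Regular η T) (hν' : ν'.Regular η T) (a : Fin 2) (x : 𝒳) :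
    |ν'.signedWeight a x - ν.signedWeight a x| ≤ |ν'.ps a x - ν.ps a x| / η ^ 2 := by
  have h : ∀ b, |1 / ν'.ps b x - 1 / ν.ps b x| ≤ |ν'.ps b x - ν.ps b x| / η ^ 2 := fun b => by
    have := abs_div_sub_div_le (p := 1) (r := 1) hν.eta_pos (hν'.lt_ps b x).le (hν.lt_ps b x).le
    simpa using this
  fin_cases a
  · have := h 0
    rw [abs_sub_comm] at this
    simpa [signedWeight, sub_eq_add_neg, add_comm] using this
  · simpa [signedWeight] using h 1

/-- A bound on the influence function that is uniform over regular nuisance parameters. -/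
theorem exists_abs_phi_le (η T : ℝ) : ∃ C : ℝ, ∀ {ν : Nuisance 𝒳}, ν.Regular η T →
    ∀ (j : Fin 2) (o : Obs 𝒳), |ν.phi j T o| ≤ C := by
  refine ⟨2 * (1 / η * T) + 1 / η * (2 * ((1 + 1 / η ^ 2) * T / η * (1 + 1 / η))), ?_⟩
  intro ν hν j o
  have hη := hν.eta_pos
  rw [phi_eq]
  refine (abs_add_le _ _).trans (add_le_add (hν.abs_cate_le j o.cov) ?_)
  rw [abs_mul]
  refine mul_le_mul (hν.abs_signedWeight_le _ _) ?_ (abs_nonneg _) (by positivity)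
  rw [martingalePart, Fin.sum_univ_two]
  have h0 := hν.abs_martingaleIntegral_le 0 j o
  have h1 := hν.abs_martingaleIntegral_le 1 j o
  refine (abs_add_le _ _).trans ?_
  linarith

/-- The influence function is Lipschitz in the nuisance parameter, in the metrics of the
consistency assumption. -/
theorem exists_abs_phi_sub_le (η T : ℝ) : ∃ C : ℝ, 0 ≤ C ∧ ∀ {ν ν' : Nuisance 𝒳}
    {o : Obs 𝒳} {ε : ℝ}, ν.Regular η T → ν'.Regular η T →
    (∀ δ a x, NullSingletonClass (ν.haz δ a x)) → (∀ a, ν.CloseAt ν' T a o.cov ε) →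
    ∀ j : Fin 2, |ν'.phi j T o - ν.phi j T o| ≤
      C * (ε + |ν'.ps o.arm o.cov - ν.ps o.arm o.cov|) := by
  obtain ⟨C, hC⟩ := exists_abs_martingaleIntegral_sub_le (𝒳 := 𝒳) η T
  set B := (1 + 1 / η ^ 2) * T / η * (1 + 1 / η) with hB
  refine ⟨|2 * (((2 + 4 / η ^ 2) / η + 1) * T) + 1 / η * (2 * |C|)| + |1 / η ^ 2 * (2 * B)|,
    by positivity, ?_⟩
  intro ν ν' o ε hν hν' hcont h j
  have hη := hν.eta_pos
  have hT := hν.time_pos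
  have hε := hν.eps_nonneg (h 0)
  set d := |ν'.ps o.arm o.cov - ν.ps o.arm o.cov| with hd
  have hd0 : 0 ≤ d := abs_nonneg _
  have hM : |ν'.martingalePart j T o - ν.martingalePart j T o| ≤ 2 * |C| * ε := by
    have h0 := hC hν hν' hcont (h o.arm) 0 j
    have h1 := hC hν hν' hcont (h o.arm) 1 j
    have h2 : C * ε ≤ |C| * ε := mul_le_mul_of_nonneg_right (le_abs_self C) hε
    rw [martingalePart, martingalePart, Fin.sum_univ_two, Fin.sum_univ_two, add_sub_add_comm]
    refine (abs_add_le _ _).trans ?_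
    linarith
  have hM' : |ν'.martingalePart j T o| ≤ 2 * B := by
    rw [martingalePart, Fin.sum_univ_two]
    have h0 := hν'.abs_martingaleIntegral_le 0 j o
    have h1 := hν'.abs_martingaleIntegral_le 1 j o
    refine (abs_add_le _ _).trans ?_
    linarith
  have hτ : |ν'.cate j T o.cov - ν.cate j T o.cov| ≤
      2 * (((2 + 4 / η ^ 2) / η + 1) * T) * ε := by
    have h0 := abs_le.1 (hν.abs_lifeYearsLost_sub_le hν' hcont (h 0) j)
    have h1 := abs_le.1 (hν.abs_lifeYearsLost_sub_le hν' hcont (h 1) j)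
    rw [cate, cate, abs_le]
    constructor <;> linarith
  have hW := hν.abs_signedWeight_sub_le hν' o.arm o.cov
  have hW0 := hν.abs_signedWeight_le o.arm o.cov
  -- telescoping: change the contrast, then the weight, then the martingale part
  have hdec : ν'.phi j T o - ν.phi j T o = (ν'.cate j T o.cov - ν.cate j T o.cov) +
      (ν'.signedWeight o.arm o.cov - ν.signedWeight o.arm o.cov) * ν'.martingalePart j T o +
      ν.signedWeight o.arm o.cov * (ν'.martingalePart j T o - ν.martingalePart j T o) := by
    rw [phi_eq, phi_eq]; ring
  have hB0 : 0 ≤ B := by positivity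
  rw [hdec]
  calc _ ≤ 2 * (((2 + 4 / η ^ 2) / η + 1) * T) * ε + d / η ^ 2 * (2 * B) +
        1 / η * (2 * |C| * ε) := by
        refine (abs_add_le _ _).trans (add_le_add ((abs_add_le _ _).trans (add_le_add hτ ?_)) ?_)
        · rw [abs_mul]; gcongr
        · rw [abs_mul]; gcongr
    _ = (2 * (((2 + 4 / η ^ 2) / η + 1) * T) + 1 / η * (2 * |C|)) * ε +
        (1 / η ^ 2 * (2 * B)) * d := by ring
    _ ≤ _ := by
        set c1 := 2 * (((2 + 4 / η ^ 2) / η + 1) * T) + 1 / η * (2 * |C|)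
        set c2 := 1 / η ^ 2 * (2 * B)
        nlinarith [mul_le_mul_of_nonneg_right (le_abs_self c1) hε,
          mul_le_mul_of_nonneg_right (le_abs_self c2) hd0, mul_nonneg (abs_nonneg c1) hd0,
          mul_nonneg (abs_nonneg c2) hε]

end Regular

end Nuisance

/-! ### Measurability in the nuisance parameter -/

section Kernel

variable {Z : Type*} [MeasurableSpace Z]

/-- A kernel of finite measures, without a uniform bound on the masses, is s-finite. -/
theorem isSFiniteKernel_of_isFiniteMeasure (κ : Kernel Z ℝ) (h : ∀ z, IsFiniteMeasure (κ z)) :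
    IsSFiniteKernel κ := by
  classical
  have hmeas : Measurable fun z => ⌊(κ z univ).toReal⌋₊ :=
    Nat.measurable_floor.comp (κ.measurable_coe MeasurableSet.univ).ennreal_toReal
  have hs : ∀ n : ℕ, MeasurableSet {z | ⌊(κ z univ).toReal⌋₊ = n} := fun n =>
    hmeas (measurableSet_singleton n)
  -- cut the parameter space according to the integer part of the mass
  refine ⟨⟨fun n => Kernel.piecewise (hs n) κ 0, fun n => ⟨⟨ENNReal.ofReal (n + 1),
    ENNReal.ofReal_lt_top, fun z => ?_⟩⟩, ?_⟩⟩
  · rw [Kernel.piecewise_apply]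
    split_ifs with hz
    · rw [← ENNReal.ofReal_toReal (measure_ne_top (κ z) univ)]
      refine ENNReal.ofReal_le_ofReal ?_
      have h1 := Nat.lt_floor_add_one (κ z univ).toReal
      have h2 : ⌊(κ z univ).toReal⌋₊ = n := hz
      rw [h2] at h1
      exact h1.le
    · simp
  · ext z A hA
    rw [Kernel.sum_apply' _ _ hA, tsum_eq_single ⌊(κ z univ).toReal⌋₊]
    · simp [Kernel.piecewise_apply]
    · intro n hn
      simp [Kernel.piecewise_apply, hn.symm]

variable {m : Z → Measure ℝ}

theorem measurable_lintegral_of_isFiniteMeasure (hm : Measurable m)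
    (hfin : ∀ z, IsFiniteMeasure (m z)) {F : Z × ℝ → ℝ≥0∞} (hF : Measurable F) :
    Measurable fun z => ∫⁻ s, F (z, s) ∂(m z) := by
  have := isSFiniteKernel_of_isFiniteMeasure ⟨m, hm⟩ hfin
  exact hF.lintegral_kernel_prod_right' (κ := ⟨m, hm⟩)

theorem measurable_integral_of_isFiniteMeasure (hm : Measurable m)
    (hfin : ∀ z, IsFiniteMeasure (m z)) {F : Z × ℝ → ℝ} (hF : Measurable F) :
    Measurable fun z => ∫ s, F (z, s) ∂(m z) := by
  have := isSFiniteKernel_of_isFiniteMeasure ⟨m, hm⟩ hfin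
  exact (hF.stronglyMeasurable.integral_kernel_prod_right' (κ := ⟨m, hm⟩)).measurable

theorem measurable_measure_section (hm : Measurable m)
    (hfin : ∀ z, IsFiniteMeasure (m z)) {A : Set (Z × ℝ)} (hA : MeasurableSet A) :
    Measurable fun z => m z {s | (z, s) ∈ A} := by
  have := isSFiniteKernel_of_isFiniteMeasure ⟨m, hm⟩ hfin
  exact Kernel.measurable_kernel_prodMk_left (κ := ⟨m, hm⟩) hA

theorem measurable_measureReal_atom (hm : Measurable m) (hfin : ∀ z, IsFiniteMeasure (m z)) :
    Measurable fun p : Z × ℝ => (m p.1).real {p.2} := by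
  have h := measurable_measure_section (m := fun p : Z × ℝ => m p.1) (hm.comp measurable_fst)
    (fun p => hfin p.1) (A := {q : (Z × ℝ) × ℝ | q.2 = q.1.2})
    (measurableSet_eq_fun measurable_snd (measurable_snd.comp measurable_fst))
  exact h.ennreal_toReal

theorem measurable_logHaz_section (hm : Measurable m) (hfin : ∀ z, IsFiniteMeasure (m z))
    {A : Set ((Z × ℝ) × ℝ)} (hA : MeasurableSet A) :
    Measurable fun p : Z × ℝ => (logHaz (m p.1)).real {s | (p, s) ∈ A} := by
  have hF : Measurable fun q : (Z × ℝ) × ℝ =>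
      ENNReal.ofReal (atomFactor ((m q.1.1).real {q.2})) :=
    (measurable_atomFactor.comp ((measurable_measureReal_atom hm hfin).comp
      ((measurable_fst.comp measurable_fst).prodMk measurable_snd))).ennreal_ofReal
  have h := measurable_lintegral_of_isFiniteMeasure (m := fun p : Z × ℝ => m p.1)
    (hm.comp measurable_fst) (fun p => hfin p.1) (hF.indicator hA)
  convert h.ennreal_toReal using 2 with p
  have hAp : MeasurableSet {s | (p, s) ∈ A} := measurable_prodMk_left hA
  rw [measureReal_def, logHaz, withDensity_apply _ hAp, ← lintegral_indicator hAp]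
  rfl

theorem measurable_logHaz_Iic (hm : Measurable m) (hfin : ∀ z, IsFiniteMeasure (m z)) :
    Measurable fun p : Z × ℝ => (logHaz (m p.1)).real (Iic p.2) :=
  measurable_logHaz_section hm hfin (A := {q : (Z × ℝ) × ℝ | q.2 ≤ q.1.2})
    (measurableSet_le measurable_snd (measurable_snd.comp measurable_fst))

theorem measurable_logHaz_Iio (hm : Measurable m) (hfin : ∀ z, IsFiniteMeasure (m z)) :
    Measurable fun p : Z × ℝ => (logHaz (m p.1)).real (Iio p.2) :=
  measurable_logHaz_section hm hfin (A := {q : (Z × ℝ) × ℝ | q.2 < q.1.2})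
    (measurableSet_lt measurable_snd (measurable_snd.comp measurable_fst))

/-- Parametric integrals over half-lines are jointly measurable in the parameter and the
endpoint. -/
theorem measurable_integral_section (hm : Measurable m) (hfin : ∀ z, IsFiniteMeasure (m z))
    {F : Z × ℝ → ℝ} (hF : Measurable F) {A : Set ((Z × ℝ) × ℝ)} (hA : MeasurableSet A) :
    Measurable fun p : Z × ℝ => ∫ s in {s | (p, s) ∈ A}, F (p.1, s) ∂(m p.1) := by
  have h := measurable_integral_of_isFiniteMeasure (m := fun p : Z × ℝ => m p.1)
    (hm.comp measurable_fst) (fun p => hfin p.1)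
    (F := A.indicator fun q => F (q.1.1, q.2)) ((hF.comp (by fun_prop)).indicator hA)
  convert h using 2 with p
  have hAp : MeasurableSet {s | (p, s) ∈ A} := measurable_prodMk_left hA
  rw [← integral_indicator hAp]
  rfl

end Kernel

namespace Nuisance

variable {Z : Type*}

/-- The integrand of the martingale part, by the formula of `Regular.H_eq`, which is jointly
measurable in covariates and time also beyond the time horizon. -/
def integrandExt (ν : Nuisance Z) (i j : Fin 2) (T : ℝ) (a : Fin 2) (z : Z) (s : ℝ) : ℝ :=
  ((if i = j then T - s else 0) - ν.futureLoss j T s a z / ν.surv s a z) / ν.censSurv s a z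

theorem Regular.integrandExt_eq {ν : Nuisance Z} {η T : ℝ} (hν : ν.Regular η T) (i j a : Fin 2)
    (z : Z) {s : ℝ} (hs : s ≤ T) : ν.integrandExt i j T a z s = ν.integrand i j T a z s := by
  rw [integrandExt, integrand, hν.H_eq i j hs]

variable [MeasurableSpace Z]

/-- The hazard measures and the propensity score depend measurably on the covariates. -/
structure IsMeasurable (ν : Nuisance Z) : Prop where
  haz : ∀ δ a, Measurable (ν.haz δ a)
  ps : ∀ a, Measurable (ν.ps a)

namespace IsMeasurable

variable {ν : Nuisance Z} {η T : ℝ}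

theorem allCause (hm : ν.IsMeasurable) (a : Fin 2) : Measurable (ν.allCause a) :=
  Measure.measurable_of_measurable_coe _ fun s hs => by
    simp only [Nuisance.allCause, Measure.add_apply]
    exact ((Measure.measurable_coe hs).comp (hm.haz 1 a)).add
      ((Measure.measurable_coe hs).comp (hm.haz 2 a))

theorem surv (hm : ν.IsMeasurable) (hν : ν.Regular η T) (a : Fin 2) :
    Measurable fun p : Z × ℝ => ν.surv p.2 a p.1 := by
  simp only [hν.surv_eq]
  exact (measurable_logHaz_Iic (hm.allCause a) (hν.isFiniteMeasure_allCause a)).neg.exp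

theorem survLeft (hm : ν.IsMeasurable) (hν : ν.Regular η T) (a : Fin 2) :
    Measurable fun p : Z × ℝ => ν.survLeft p.2 a p.1 := by
  simp only [hν.survLeft_eq]
  exact (measurable_logHaz_Iio (hm.allCause a) (hν.isFiniteMeasure_allCause a)).neg.exp

theorem censSurv (hm : ν.IsMeasurable) (hν : ν.Regular η T) (a : Fin 2) :
    Measurable fun p : Z × ℝ => ν.censSurv p.2 a p.1 := by
  simp only [hν.censSurv_eq]
  exact (measurable_logHaz_Iic (hm.haz 0 a) (hν.finite 0 a)).neg.exp

theorem futureLoss (hm : ν.IsMeasurable) (hν : ν.Regular η T) (j a : Fin 2) :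
    Measurable fun p : Z × ℝ => ν.futureLoss j T p.2 a p.1 :=
  measurable_integral_section (hm.haz j.succ a) (hν.finite j.succ a)
    (F := fun p => (T - p.2) * ν.survLeft p.2 a p.1)
    ((measurable_const.sub measurable_snd).mul (hm.survLeft hν a))
    (A := {q : (Z × ℝ) × ℝ | q.1.2 < q.2})
    (measurableSet_lt (measurable_snd.comp measurable_fst) measurable_snd)

theorem lifeYearsLost (hm : ν.IsMeasurable) (hν : ν.Regular η T) (j a : Fin 2) :
    Measurable fun z : Z => ν.lifeYearsLost j T a z := by
  simp only [hν.lifeYearsLost_eq]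
  exact measurable_integral_of_isFiniteMeasure (hm.haz j.succ a) (hν.finite j.succ a)
    (F := fun p => (T - p.2) * ν.survLeft p.2 a p.1)
    ((measurable_const.sub measurable_snd).mul (hm.survLeft hν a))

theorem integrandExt (hm : ν.IsMeasurable) (hν : ν.Regular η T) (i j a : Fin 2) :
    Measurable fun p : Z × ℝ => ν.integrandExt i j T a p.1 p.2 := by
  refine Measurable.div (Measurable.sub ?_ ((hm.futureLoss hν j a).div (hm.surv hν a)))
    (hm.censSurv hν a)
  split_ifs
  · exact measurable_const.sub measurable_snd
  · exact measurable_const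

theorem martingaleIntegral (hm : ν.IsMeasurable) (hν : ν.Regular η T) (i j : Fin 2) :
    Measurable fun o : Obs Z => ν.martingaleIntegral i (ν.integrand i j T o.arm o.cov) T o := by
  have h : ∀ o : Obs Z, ν.martingaleIntegral i (ν.integrand i j T o.arm o.cov) T o =
      (if o.event = i.succ ∧ o.time ∈ Ioc 0 T then
        ν.integrandExt i j T o.arm o.cov o.time else 0) -
        ∫ s in Iic o.time, ν.integrandExt i j T o.arm o.cov s ∂(ν.haz i.succ o.arm o.cov) := by
    intro o
    rw [hν.martingaleIntegral_eq]
    congr 1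
    · split_ifs with h1
      · rw [hν.integrandExt_eq i j _ _ h1.2.2]
      · rfl
    · refine integral_congr_ae (ae_restrict_of_ae ?_)
      filter_upwards [hν.ae_mem i.succ o.arm o.cov] with s hs
      rw [hν.integrandExt_eq i j _ _ hs.2]
  simp only [h]
  have harm : ∀ a : Fin 2, Measurable fun p : ℝ × Fin 3 × Z =>
      (if p.2.1 = i.succ ∧ p.1 ∈ Ioc 0 T then ν.integrandExt i j T a p.2.2 p.1 else 0) -
        ∫ s in Iic p.1, ν.integrandExt i j T a p.2.2 s ∂(ν.haz i.succ a p.2.2) := by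
    intro a
    refine Measurable.sub (Measurable.ite ?_ ?_ measurable_const) ?_
    · exact (measurable_fst.comp measurable_snd (measurableSet_singleton _)).inter
        (measurable_fst measurableSet_Ioc)
    · exact (hm.integrandExt hν i j a).comp
        ((measurable_snd.comp measurable_snd).prodMk measurable_fst)
    · have := measurable_integral_section (hm.haz i.succ a) (hν.finite i.succ a)
        (hm.integrandExt hν i j a) (A := {q : (Z × ℝ) × ℝ | q.2 ≤ q.1.2})
        (measurableSet_le measurable_snd (measurable_snd.comp measurable_fst))
      exact this.comp ((measurable_snd.comp measurable_snd).prodMk measurable_fst)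
  have hall : Measurable fun q : Fin 2 × (ℝ × Fin 3 × Z) =>
      (if q.2.2.1 = i.succ ∧ q.2.1 ∈ Ioc 0 T then
        ν.integrandExt i j T q.1 q.2.2.2 q.2.1 else 0) -
        ∫ s in Iic q.2.1, ν.integrandExt i j T q.1 q.2.2.2 s ∂(ν.haz i.succ q.1 q.2.2.2) :=
    measurable_from_prod_countable_right harm
  have hperm : Measurable fun o : Obs Z => (o.2.2.1, (o.1, o.2.1, o.2.2.2)) := by fun_prop
  exact hall.comp hperm

theorem signedWeight (hm : ν.IsMeasurable) :
    Measurable fun p : Fin 2 × Z => ν.signedWeight p.1 p.2 :=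
  measurable_from_prod_countable_right fun a => by
    have h (c d : ℝ) : Measurable fun z => c / ν.ps 1 z - d / ν.ps 0 z :=
      (measurable_const.div (hm.ps 1)).sub (measurable_const.div (hm.ps 0))
    exact h (if a = 1 then 1 else 0) (if a = 0 then 1 else 0)

theorem cate (hm : ν.IsMeasurable) (hν : ν.Regular η T) (j : Fin 2) : Measurable (ν.cate j T) :=
  (hm.lifeYearsLost hν j 1).sub (hm.lifeYearsLost hν j 0)

theorem phi (hm : ν.IsMeasurable) (hν : ν.Regular η T) (j : Fin 2) : Measurable (ν.phi j T) := by
  have hcov : Measurable (Obs.cov : Obs Z → Z) := measurable_snd.comp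
    (measurable_snd.comp measurable_snd)
  have harm : Measurable (Obs.arm : Obs Z → Fin 2) := measurable_fst.comp
    (measurable_snd.comp measurable_snd)
  have h : ν.phi j T = fun o => ν.cate j T o.cov +
      ν.signedWeight o.arm o.cov * ν.martingalePart j T o := by
    ext o
    exact ν.phi_eq j T o
  rw [h]
  exact ((hm.cate hν j).comp hcov).add ((hm.signedWeight.comp (harm.prodMk hcov)).mul
    (Finset.measurable_fun_sum _ fun i _ => hm.martingaleIntegral hν i j))

end IsMeasurable

end Nuisance

/-! ### Compensators and the distribution of an observation -/

/-- Integration by parts behind the inverse probability weighting: the integral of `g` up to `t`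
against a measure `m` and the compensated jump of `exp(Λ(t)) ∫ₜ exp(-Λ) g dm` add up to a
constant. -/
theorem exp_mul_integral_Ioi_add {Λ m : Measure ℝ} [IsFiniteMeasure Λ] [IsFiniteMeasure m]
    [NullSingletonClass Λ] {T : ℝ} (hT : Λ (Ioc 0 T)ᶜ = 0) {g : ℝ → ℝ} (hg : Measurable g) {C : ℝ}
    (hgC : ∀ s, |g s| ≤ C) (t : ℝ) :
    Real.exp (Λ.real (Iic t)) * (∫ u in Ioi t, Real.exp (-Λ.real (Iic u)) * g u ∂m) +
        ∫ u in Iic t, g u ∂m =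
      (∫ u, Real.exp (-Λ.real (Iic u)) * g u ∂m) +
        ∫ s in Iic t, Real.exp (Λ.real (Iic s)) *
          (∫ u in Ioi s, Real.exp (-Λ.real (Iic u)) * g u ∂m) ∂Λ := by
  have hmI := measurable_measureReal_Iic Λ
  have hC : 0 ≤ C := (abs_nonneg _).trans (hgC 0)
  set y : ℝ → ℝ := fun u => Real.exp (-Λ.real (Iic u)) * g u with hy
  have hym : Measurable y := by fun_prop
  have hyC : ∀ u, |y u| ≤ C := fun u => by
    rw [hy]
    simp only [abs_mul, Real.abs_exp]
    refine (mul_le_mul (Real.exp_le_one_iff.2 (neg_nonpos.2 measureReal_nonneg)) (hgC u)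
      (abs_nonneg _) zero_le_one).trans (one_mul C).le
  have hE : ∀ u, |Real.exp (Λ.real (Iic u))| ≤ Real.exp (Λ.real univ) := fun u => by
    rw [Real.abs_exp]
    exact Real.exp_le_exp.2 (measureReal_mono (subset_univ _))
  have hswap := integral_mul_setIntegral_swap (Λ.restrict (Iic t)) m
    (f := fun s => Real.exp (Λ.real (Iic s))) (g := y) (by fun_prop) hym hE hyC
    (D := {p | p.1 < p.2}) (measurableSet_lt measurable_fst measurable_snd)
  have hIic : ∀ v, ∫ s in Iic v, Real.exp (Λ.real (Iic s)) ∂Λ = Real.exp (Λ.real (Iic v)) - 1 :=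
    fun v => by
      have := exp_mul_Iic hT (one_ne_zero) v
      simp only [one_mul] at this
      linarith
  have hin : ∀ u, ∫ s in {s | (s, u) ∈ {p : ℝ × ℝ | p.1 < p.2}}, Real.exp (Λ.real (Iic s))
      ∂(Λ.restrict (Iic t)) = Real.exp (Λ.real (Iic (min u t))) - 1 := fun u => by
    change ∫ s in Iio u, _ ∂(Λ.restrict (Iic t)) = _
    rw [← hIic, Measure.restrict_restrict measurableSet_Iio]
    have : (Iio u ∩ Iic t : Set ℝ) =ᵐ[Λ] Iic (min u t) := by
      rw [← Iic_inter_Iic]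
      exact (Iio_ae_eq_Iic (μ := Λ) (a := u)).inter (ae_eq_refl _)
    rw [Measure.restrict_congr_set this]
  simp only [hin] at hswap
  change _ + _ = _ + ∫ s in Iic t, Real.exp (Λ.real (Iic s)) *
    (∫ u in {u | (s, u) ∈ {p : ℝ × ℝ | p.1 < p.2}}, y u ∂m) ∂Λ
  rw [hswap]
  have hyint : Integrable y m := Integrable.of_bound hym.aestronglyMeasurable C
    (ae_of_all _ hyC)
  have hprod : Integrable (fun u => y u * (Real.exp (Λ.real (Iic (min u t))) - 1)) m := by
    refine Integrable.mul_bdd (c := Real.exp (Λ.real univ) + 1) hyint ?_ (ae_of_all _ fun u => ?_)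
    · exact ((hmI.comp (measurable_id.min measurable_const)).exp.sub_const 1).aestronglyMeasurable
    · refine (norm_sub_le _ _).trans (add_le_add (hE _) ?_)
      simp
  rw [← integral_add hyint hprod]
  have hsplit := integral_add_compl (μ := m) (s := Iic t) measurableSet_Iic (hyint.add hprod)
  rw [compl_Iic] at hsplit
  simp only [Pi.add_apply] at hsplit
  rw [← hsplit, add_comm, ← integral_const_mul]
  congr 1
  · refine setIntegral_congr_fun measurableSet_Iic fun u hu => ?_
    simp only [hy, min_eq_left (mem_Iic.1 hu), Real.exp_neg]
    field_simp
    ring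
  · refine setIntegral_congr_fun measurableSet_Ioi fun u hu => ?_
    simp only [min_eq_right (mem_Ioi.1 hu).le]
    ring

theorem abs_setIntegral_le {m : Measure ℝ} [IsFiniteMeasure m] {f : ℝ → ℝ} {C M : ℝ}
    (hf : ∀ s, |f s| ≤ C) (hm : m.real univ ≤ M) (B : Set ℝ) : |∫ s in B, f s ∂m| ≤ C * M := by
  refine (norm_integral_le_of_norm_le_const (f := f) (C := C) (ae_of_all _ hf)).trans
    (mul_le_mul_of_nonneg_left ?_ ((abs_nonneg _).trans (hf 0)))
  rw [measureReal_restrict_apply MeasurableSet.univ, univ_inter]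
  exact (measureReal_mono (subset_univ _)).trans hm

namespace Obs

variable {𝒳 : Type*}

/-- The treatment arm together with the covariates. -/
def armCov (o : Obs 𝒳) : Fin 2 × 𝒳 := (o.arm, o.cov)

variable [MeasurableSpace 𝒳]

theorem measurable_time : Measurable (time : Obs 𝒳 → ℝ) := measurable_fst

theorem measurable_event : Measurable (event : Obs 𝒳 → Fin 3) :=
  measurable_fst.comp measurable_snd

theorem measurable_arm : Measurable (arm : Obs 𝒳 → Fin 2) :=
  measurable_fst.comp (measurable_snd.comp measurable_snd)

theorem measurable_cov : Measurable (cov : Obs 𝒳 → 𝒳) :=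
  measurable_snd.comp (measurable_snd.comp measurable_snd)

theorem measurable_armCov : Measurable (armCov : Obs 𝒳 → Fin 2 × 𝒳) :=
  measurable_arm.prodMk measurable_cov

end Obs

namespace Nuisance

variable {𝒳 : Type*} [MeasurableSpace 𝒳]

/-- `ν`, with hazards that vanish outside `(0, T]`, is the nuisance parameter of the distribution
`P` of an observation, and its cumulative hazards are continuous. -/
structure IsModel (ν : Nuisance 𝒳) (P : Measure (Obs 𝒳)) (T : ℝ) : Prop extends
    ν.IsMeasurable where
  noAtoms : ∀ δ a x, NullSingletonClass (ν.haz δ a x)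
  hazard : ∀ δ, ∀ t ∈ Icc 0 T, ∀ B : Set (Fin 2 × 𝒳), MeasurableSet B →
    P {o | o.time ≤ t ∧ o.event = δ ∧ (o.arm, o.cov) ∈ B} =
      ∫⁻ o in {o | (o.arm, o.cov) ∈ B}, ν.haz δ o.arm o.cov (Iic (min t o.time)) ∂P
  propensity : ∀ a, ∀ B : Set 𝒳, MeasurableSet B →
    P {o | o.arm = a ∧ o.cov ∈ B} = ∫⁻ o in {o | o.cov ∈ B}, ENNReal.ofReal (ν.ps a o.cov) ∂P

/-- The hazard measure as a function of the arm and the covariates. -/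
def hazOf (ν : Nuisance 𝒳) (δ : Fin 3) (w : Fin 2 × 𝒳) : Measure ℝ := ν.haz δ w.1 w.2

/-- The probability `S(s) S_C(s)` of being at risk at time `s`, given the arm and the covariates,
when `ν` is the true nuisance parameter. -/
def atRisk (ν : Nuisance 𝒳) (w : Fin 2 × 𝒳) (s : ℝ) : ℝ :=
  ν.surv s w.1 w.2 * ν.censSurv s w.1 w.2

theorem IsMeasurable.hazOf {ν : Nuisance 𝒳} (hm : ν.IsMeasurable) (δ : Fin 3) :
    Measurable (ν.hazOf δ) :=
  measurable_from_prod_countable_right fun a => hm.haz δ a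

namespace IsModel

variable {P : Measure (Obs 𝒳)} {ν : Nuisance 𝒳} {η T : ℝ}

/-- The cumulative hazards vanish at time `0`, hence no event occurs up to time `0`. -/
theorem time_pos (h : ν.IsModel P T) (hν : ν.Regular η T) : ∀ᵐ o ∂P, 0 < o.time := by
  have h0 : ∀ δ, P {o | o.time ≤ 0 ∧ o.event = δ ∧ (o.arm, o.cov) ∈ univ} = 0 := fun δ => by
    rw [h.hazard δ 0 ⟨le_rfl, hν.time_pos.le⟩ univ MeasurableSet.univ]
    simp only [mem_univ]
    refine (lintegral_congr fun o => ?_).trans lintegral_zero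
    refine measure_mono_null (fun s hs => ?_) (hν.support δ o.arm o.cov)
    exact fun hs' => absurd (hs.trans (min_le_left _ _)) (not_le.2 hs'.1)
  refine measure_mono_null (t := ⋃ δ, {o | o.time ≤ 0 ∧ o.event = δ ∧ (o.arm, o.cov) ∈ univ})
    (fun o ho => ?_) (measure_iUnion_null h0)
  exact mem_iUnion.2 ⟨o.event, not_lt.1 ho, rfl, mem_univ _⟩

theorem atRisk_eq (h : ν.IsModel P T) (hν : ν.Regular η T) (w : Fin 2 × 𝒳) (s : ℝ) :
    ν.atRisk w s =
      Real.exp (-(ν.hazOf 0 w + (ν.hazOf 1 w + ν.hazOf 2 w)).real (Iic s)) := by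
  have := h.noAtoms
  have := Regular.nullSingletonClass_allCause h.noAtoms w.1 w.2
  have := hν.finite
  have := hν.isFiniteMeasure_allCause w.1 w.2
  rw [atRisk, hν.surv_eq, hν.censSurv_eq, Regular.logHaz_of_nullSingletonClass,
    Regular.logHaz_of_nullSingletonClass, ← Real.exp_add, ← neg_add, add_comm]
  exact congrArg (fun r => Real.exp (-r))
    (measureReal_add_apply (μ₁ := ν.haz 0 w.1 w.2) (μ₂ := ν.allCause w.1 w.2)).symm

variable [IsProbabilityMeasure P]

/-- The process `1(T̃ ≤ t, Δ̃ = δ) - ∫₀ᵗ 1(T̃ ≥ s) Λ_δ(ds | A, X)` has mean zero when integrated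
against a bounded function of time, arm and covariates. The model assumption is the case of
indicator functions of `(0, t] × B`, which determine both sides as measures. -/
theorem integral_event (h : ν.IsModel P T) (hν : ν.Regular η T) (δ : Fin 3)
    {f : (Fin 2 × 𝒳) × ℝ → ℝ} (hf : Measurable f) {C : ℝ} (hfC : ∀ p, |f p| ≤ C) :
    ∫ o, (if o.event = δ ∧ o.time ∈ Ioc 0 T then f (o.armCov, o.time) else 0) ∂P =
      ∫ o, ∫ s in Iic o.time, f (o.armCov, s) ∂(ν.haz δ o.arm o.cov) ∂P := by
  have hfin : ∀ w, IsFiniteMeasure (ν.hazOf δ w) := fun w => hν.finite δ w.1 w.2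
  have hκm : Measurable fun o : Obs 𝒳 => (ν.hazOf δ o.armCov).restrict (Iic o.time) := by
    refine Measure.measurable_of_measurable_coe _ fun s hs => ?_
    simp only [Measure.restrict_apply hs]
    exact measurable_measure_section (m := fun o : Obs 𝒳 => ν.hazOf δ o.armCov)
      ((h.toIsMeasurable.hazOf δ).comp Obs.measurable_armCov) (fun o => hfin _)
      (A := {q : Obs 𝒳 × ℝ | q.2 ∈ s ∧ q.2 ≤ q.1.time})
      ((measurable_snd hs).inter (measurableSet_le measurable_snd
        (Obs.measurable_time.comp measurable_fst)))
  let κ : Kernel (Obs 𝒳) ℝ := ⟨_, hκm⟩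
  have hκ : ∀ o, κ o = (ν.haz δ o.arm o.cov).restrict (Iic o.time) := fun o => rfl
  have hκfin : IsFiniteKernel κ := ⟨⟨ENNReal.ofReal (1 / η), ENNReal.ofReal_lt_top, fun o => by
    have := hν.finite δ o.arm o.cov
    rw [hκ, Measure.restrict_apply MeasurableSet.univ, univ_inter]
    refine (measure_mono (subset_univ _)).trans ?_
    rw [← ENNReal.ofReal_toReal (measure_ne_top _ univ)]
    exact ENNReal.ofReal_le_ofReal (hν.haz_le δ o.arm o.cov)⟩⟩
  have hE : MeasurableSet {o : Obs 𝒳 | o.event = δ ∧ o.time ∈ Ioc 0 T} :=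
    (Obs.measurable_event (measurableSet_singleton δ)).inter
      (Obs.measurable_time measurableSet_Ioc)
  have hφ : Measurable fun o : Obs 𝒳 => (o.armCov, o.time) :=
    Obs.measurable_armCov.prodMk Obs.measurable_time
  have hψ : Measurable fun p : Obs 𝒳 × ℝ => (p.1.armCov, p.2) :=
    (Obs.measurable_armCov.comp measurable_fst).prodMk measurable_snd
  have hmeas : (P.restrict {o | o.event = δ ∧ o.time ∈ Ioc 0 T}).map
      (fun o => (o.armCov, o.time)) = (P ⊗ₘ κ).map fun p => (p.1.armCov, p.2) := by
    refine Measure.ext_prod fun {B A} hB hA => ?_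
    have key : (((P.restrict {o | o.event = δ ∧ o.time ∈ Ioc 0 T}).map
        (fun o => (o.armCov, o.time))).restrict (B ×ˢ univ)).map Prod.snd =
        (((P ⊗ₘ κ).map fun p => (p.1.armCov, p.2)).restrict (B ×ˢ univ)).map Prod.snd := by
      refine Measure.ext_of_Iic _ _ fun t => ?_
      have hR : MeasurableSet (Prod.snd ⁻¹' Iic t ∩ B ×ˢ univ : Set ((Fin 2 × 𝒳) × ℝ)) :=
        (measurable_snd measurableSet_Iic).inter (hB.prod MeasurableSet.univ)
      rw [Measure.map_apply measurable_snd measurableSet_Iic,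
        Measure.map_apply measurable_snd measurableSet_Iic,
        Measure.restrict_apply (measurable_snd measurableSet_Iic),
        Measure.restrict_apply (measurable_snd measurableSet_Iic),
        Measure.map_apply hφ hR, Measure.map_apply hψ hR, Measure.restrict_apply (hφ hR),
        Measure.compProd_apply (hψ hR)]
      have hT := hν.time_pos
      have ht' : max 0 (min t T) ∈ Icc 0 T := ⟨le_max_left _ _, max_le hT.le (min_le_right _ _)⟩
      have h1 : P ((fun o : Obs 𝒳 => (o.armCov, o.time)) ⁻¹' (Prod.snd ⁻¹' Iic t ∩ B ×ˢ univ) ∩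
          {o | o.event = δ ∧ o.time ∈ Ioc 0 T}) =
          P {o | o.time ≤ max 0 (min t T) ∧ o.event = δ ∧ (o.arm, o.cov) ∈ B} := by
        refine measure_congr ?_
        filter_upwards [h.time_pos hν] with o ho
        refine propext ⟨?_, ?_⟩
        · rintro ⟨⟨h1, h2, -⟩, h3, -, h4⟩
          exact ⟨le_max_of_le_right (le_min h1 h4), h3, h2⟩
        · rintro ⟨h1, h2, h3⟩
          have h4 : o.time ≤ min t T := by
            rcases le_max_iff.1 h1 with h | h
            · exact absurd ho (not_lt.2 h)
            · exact h
          exact ⟨⟨h4.trans (min_le_left _ _), h3, mem_univ _⟩, h2, ho, h4.trans (min_le_right _ _)⟩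
      rw [h1, h.hazard δ _ ht' B hB,
        ← lintegral_indicator (show MeasurableSet {o : Obs 𝒳 | (o.arm, o.cov) ∈ B} from
          Obs.measurable_armCov hB)]
      refine lintegral_congr fun o => ?_
      by_cases ho : o.armCov ∈ B
      · rw [indicator_of_mem (show o ∈ {o : Obs 𝒳 | (o.arm, o.cov) ∈ B} from ho), hκ,
          Measure.restrict_apply (measurable_prodMk_left (hψ hR))]
        refine measure_congr ?_
        filter_upwards [hν.ae_mem δ o.arm o.cov] with s hs
        refine propext ⟨fun h1 => ?_, fun h1 => ?_⟩
        · have h2 : s ≤ max 0 (min t T) := (mem_Iic.1 h1).trans (min_le_left _ _)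
          have h3 : s ≤ min t T := by
            rcases le_max_iff.1 h2 with h | h
            · exact absurd hs.1 (not_lt.2 h)
            · exact h
          exact ⟨⟨h3.trans (min_le_left _ _), ho, mem_univ _⟩,
            mem_Iic.2 ((mem_Iic.1 h1).trans (min_le_right _ _))⟩
        · exact mem_Iic.2 (le_min (le_max_of_le_right (le_min h1.1.1 hs.2)) h1.2)
      · rw [indicator_of_notMem (show o ∉ {o : Obs 𝒳 | (o.arm, o.cov) ∈ B} from ho)]
        refine (measure_mono_null (fun s hs => ?_) measure_empty).symm
        exact ho hs.2.1
    have := congrArg (fun m => m A) key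
    simp only [Measure.map_apply measurable_snd hA,
      Measure.restrict_apply (measurable_snd hA)] at this
    have hset : (Prod.snd ⁻¹' A ∩ B ×ˢ univ : Set ((Fin 2 × 𝒳) × ℝ)) = B ×ˢ A := by
      ext p
      simp [and_comm]
    rwa [hset] at this
  have hL : ∫ o, (if o.event = δ ∧ o.time ∈ Ioc 0 T then f (o.armCov, o.time) else 0) ∂P =
      ∫ p, f p ∂((P.restrict {o | o.event = δ ∧ o.time ∈ Ioc 0 T}).map
        fun o => (o.armCov, o.time)) := by
    rw [integral_map hφ.aemeasurable hf.aestronglyMeasurable, ← integral_indicator hE]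
    simp only [indicator_apply, mem_ofPred_eq]
  rw [hL, hmeas, integral_map hψ.aemeasurable hf.aestronglyMeasurable,
    Measure.integral_compProd (f := fun p : Obs 𝒳 × ℝ => f (p.1.armCov, p.2))
      (Integrable.of_bound (hf.comp hψ).aestronglyMeasurable C (ae_of_all _ fun p => hfC _))]
  rfl

/-- At time `s` the conditional probability of being at risk is `S(s) S_C(s)`, in the form
integrated against a hazard `m`. Conditional distributions are avoided: the pathwise identity
`exp_mul_integral_Ioi_add`, with `Λ` the total hazard of an event or censoring, expresses the
difference of the two sides as a mean-zero compensated jump. -/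
theorem integral_Iic_time (h : ν.IsModel P T) (hν : ν.Regular η T)
    {m : Fin 2 × 𝒳 → Measure ℝ} (hm : Measurable m) (hfin : ∀ w, IsFiniteMeasure (m w))
    {Cm : ℝ} (hmC : ∀ w, (m w).real univ ≤ Cm) (hmT : ∀ w, m w (Ioc 0 T)ᶜ = 0)
    {g : (Fin 2 × 𝒳) × ℝ → ℝ} (hg : Measurable g) {C : ℝ} (hgC : ∀ p, |g p| ≤ C) :
    ∫ o, ∫ s in Iic o.time, g (o.armCov, s) ∂(m o.armCov) ∂P =
      ∫ o, ∫ s, ν.atRisk o.armCov s * g (o.armCov, s) ∂(m o.armCov) ∂P := by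
  have hη := hν.eta_pos
  set Λ : Fin 2 × 𝒳 → Measure ℝ := fun w => ν.hazOf 0 w + (ν.hazOf 1 w + ν.hazOf 2 w) with hΛ
  have hhaz : ∀ δ w, IsFiniteMeasure (ν.hazOf δ w) := fun δ w => hν.finite δ w.1 w.2
  have hatom : ∀ δ w, NullSingletonClass (ν.hazOf δ w) := fun δ w => h.noAtoms δ w.1 w.2
  have hΛfin : ∀ w, IsFiniteMeasure (Λ w) := fun w => inferInstance
  have hΛatom : ∀ w, NullSingletonClass (Λ w) := fun w => ⟨fun s => by simp [hΛ]⟩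
  have hΛm : Measurable Λ := Measure.measurable_of_measurable_coe _ fun s hs => by
    simp only [hΛ, Measure.add_apply]
    have h1 := fun δ => (Measure.measurable_coe hs).comp (h.toIsMeasurable.hazOf δ)
    exact (h1 0).add ((h1 1).add (h1 2))
  have hΛT : ∀ w, Λ w (Ioc 0 T)ᶜ = 0 := fun w => by
    simp [hΛ, hazOf, hν.support]
  have hΛle : ∀ w, (Λ w).real univ ≤ 1 / η + (1 / η + 1 / η) := fun w => by
    rw [hΛ]
    simp only [measureReal_add_apply (measure_ne_top _ _) (measure_ne_top _ _)]
    exact add_le_add (hν.haz_le 0 w.1 w.2) (add_le_add (hν.haz_le 1 w.1 w.2)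
      (hν.haz_le 2 w.1 w.2))
  have hIm : Measurable fun p : (Fin 2 × 𝒳) × ℝ => (Λ p.1).real (Iic p.2) :=
    (measurable_measure_section (m := fun p : (Fin 2 × 𝒳) × ℝ => Λ p.1)
      (hΛm.comp measurable_fst) (fun p => hΛfin p.1)
      (A := {q : ((Fin 2 × 𝒳) × ℝ) × ℝ | q.2 ≤ q.1.2})
      (measurableSet_le measurable_snd (measurable_snd.comp measurable_fst))).ennreal_toReal
  have hym : Measurable fun p : (Fin 2 × 𝒳) × ℝ => Real.exp (-(Λ p.1).real (Iic p.2)) * g p :=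
    hIm.neg.exp.mul hg
  have hyC : ∀ p : (Fin 2 × 𝒳) × ℝ, |Real.exp (-(Λ p.1).real (Iic p.2)) * g p| ≤ C := fun p => by
    rw [abs_mul, Real.abs_exp]
    refine (mul_le_mul (Real.exp_le_one_iff.2 (neg_nonpos.2 measureReal_nonneg)) (hgC p)
      (abs_nonneg _) zero_le_one).trans (one_mul C).le
  set K : (Fin 2 × 𝒳) × ℝ → ℝ := fun p =>
    ∫ u in Ioi p.2, Real.exp (-(Λ p.1).real (Iic u)) * g (p.1, u) ∂(m p.1) with hK
  have hKm : Measurable K := measurable_integral_section hm hfin hym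
    (A := {q : ((Fin 2 × 𝒳) × ℝ) × ℝ | q.1.2 < q.2})
    (measurableSet_lt (measurable_snd.comp measurable_fst) measurable_snd)
  have hKC : ∀ p, |K p| ≤ C * Cm := fun p =>
    abs_setIntegral_le (fun s => hyC (p.1, s)) (hmC p.1) _
  -- `f` is the predictable integrand of the compensated jump
  set f : (Fin 2 × 𝒳) × ℝ → ℝ := fun p => Real.exp ((Λ p.1).real (Iic p.2)) * K p with hf
  have hfm : Measurable f := hIm.exp.mul hKm
  have hfC : ∀ p, |f p| ≤ Real.exp (1 / η + (1 / η + 1 / η)) * (C * Cm) := fun p => by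
    rw [hf]
    simp only [abs_mul, Real.abs_exp]
    exact mul_le_mul (Real.exp_le_exp.2 ((measureReal_mono (subset_univ _)).trans (hΛle p.1)))
      (hKC p) (abs_nonneg _) (Real.exp_pos _).le
  have hf0 : ∀ w s, T ≤ s → f (w, s) = 0 := fun w s hs => by
    have h0 : m w (Ioi s) = 0 := measure_mono_null (t := (Ioc 0 T)ᶜ)
      (fun u hu hu' => absurd (hs.trans_lt hu) (not_lt.2 hu'.2)) (hmT w)
    simp only [hf, hK]
    rw [Measure.restrict_eq_zero.2 h0, integral_zero_measure, mul_zero]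
  have hpair : Measurable fun o : Obs 𝒳 => (o.armCov, o.time) :=
    Obs.measurable_armCov.prodMk Obs.measurable_time
  have hbdd : ∀ {φ : Obs 𝒳 → ℝ} {c : ℝ}, Measurable φ → (∀ o, |φ o| ≤ c) → Integrable φ P :=
    fun hφ hc => Integrable.of_bound hφ.aestronglyMeasurable _ (ae_of_all _ hc)
  have hsec : ∀ {m' : Fin 2 × 𝒳 → Measure ℝ} {φ : (Fin 2 × 𝒳) × ℝ → ℝ} {c M : ℝ},
      Measurable m' → (∀ w, IsFiniteMeasure (m' w)) → (∀ w, (m' w).real univ ≤ M) →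
      Measurable φ → (∀ p, |φ p| ≤ c) →
      Integrable (fun o => ∫ s in Iic o.time, φ (o.armCov, s) ∂(m' o.armCov)) P :=
    fun {m' φ c M} hm' hfin' hM hφ hc => hbdd ((measurable_integral_section hm' hfin' hφ
      (A := {q : ((Fin 2 × 𝒳) × ℝ) × ℝ | q.2 ≤ q.1.2})
      (measurableSet_le measurable_snd (measurable_snd.comp measurable_fst))).comp hpair)
      fun o => abs_setIntegral_le (fun s => hc _) (hM _) _
  have hI : ∀ δ, Integrable (fun o =>
      ∫ s in Iic o.time, f (o.armCov, s) ∂(ν.hazOf δ o.armCov)) P := fun δ =>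
    hsec (h.toIsMeasurable.hazOf δ) (hhaz δ) (fun w => hν.haz_le δ w.1 w.2) hfm hfC
  -- the observed time is the time of exactly one of the three kinds of events
  have hev : ∀ᵐ o ∂P, f (o.armCov, o.time) = ∑ δ : Fin 3,
      if o.event = δ ∧ o.time ∈ Ioc 0 T then f (o.armCov, o.time) else 0 := by
    filter_upwards [h.time_pos hν] with o ho
    by_cases hoT : o.time ≤ T
    · simp [ho, hoT]
    · simp [hoT, hf0 o.armCov o.time (not_le.1 hoT).le]
  have hevI : ∀ δ : Fin 3, Integrable (fun o : Obs 𝒳 =>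
      if o.event = δ ∧ o.time ∈ Ioc 0 T then f (o.armCov, o.time) else 0) P := fun δ => by
    refine hbdd (c := Real.exp (1 / η + (1 / η + 1 / η)) * (C * Cm))
      (Measurable.ite ((Obs.measurable_event (measurableSet_singleton δ)).inter
      (Obs.measurable_time measurableSet_Ioc)) (hfm.comp hpair) measurable_const) fun o => ?_
    split_ifs
    · exact hfC _
    · rw [abs_zero]
      exact (abs_nonneg _).trans (hfC (o.armCov, 0))
  have hpath : ∀ o : Obs 𝒳, f (o.armCov, o.time) + ∫ s in Iic o.time, g (o.armCov, s)
      ∂(m o.armCov) = (∫ s, ν.atRisk o.armCov s * g (o.armCov, s) ∂(m o.armCov)) +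
        ∑ δ : Fin 3, ∫ s in Iic o.time, f (o.armCov, s) ∂(ν.hazOf δ o.armCov) := fun o => by
    have := exp_mul_integral_Ioi_add (m := m o.armCov) (hΛT o.armCov)
      (hg.comp measurable_prodMk_left) (fun s => hgC (o.armCov, s)) o.time
    simp only [h.atRisk_eq hν]
    refine this.trans (congrArg _ ?_)
    have hfs : ∀ δ, Integrable (fun s => f (o.armCov, s))
        ((ν.hazOf δ o.armCov).restrict (Iic o.time)) := fun δ =>
      (Integrable.of_bound (hfm.comp measurable_prodMk_left).aestronglyMeasurable _
        (ae_of_all _ fun s => hfC (o.armCov, s))).restrict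
    rw [Fin.sum_univ_three, add_assoc, ← integral_add_measure (hfs 1) (hfs 2),
      ← integral_add_measure (hfs 0) ((hfs 1).add_measure (hfs 2)), ← Measure.restrict_add,
      ← Measure.restrict_add]
    rfl
  have hfo : Integrable (fun o : Obs 𝒳 => f (o.armCov, o.time)) P :=
    hbdd (hfm.comp hpair) fun o => hfC _
  have hgo := hsec hm hfin hmC hg hgC
  have hg0 : Integrable (fun o : Obs 𝒳 =>
      ∫ s, ν.atRisk o.armCov s * g (o.armCov, s) ∂(m o.armCov)) P := by
    have : (fun o : Obs 𝒳 => ∫ s, ν.atRisk o.armCov s * g (o.armCov, s) ∂(m o.armCov)) =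
      fun o => f (o.armCov, o.time) + (∫ s in Iic o.time, g (o.armCov, s) ∂(m o.armCov)) -
        ∑ δ : Fin 3, ∫ s in Iic o.time, f (o.armCov, s) ∂(ν.hazOf δ o.armCov) := by
      ext o
      rw [hpath o, add_sub_cancel_right]
    rw [this]
    exact (hfo.add hgo).sub (integrable_finsetSum _ fun δ _ => hI δ)
  have hsum : ∫ o, f (o.armCov, o.time) ∂P =
      ∑ δ : Fin 3, ∫ o, ∫ s in Iic o.time, f (o.armCov, s) ∂(ν.hazOf δ o.armCov) ∂P := by
    rw [integral_congr_ae hev, integral_finsetSum _ fun δ _ => hevI δ]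
    exact Finset.sum_congr rfl fun δ _ => h.integral_event hν δ hfm hfC
  have htot := integral_congr_ae (ae_of_all P hpath)
  rw [integral_add hfo hgo, integral_add hg0 (integrable_finsetSum _ fun δ _ => hI δ),
    integral_finsetSum _ fun δ _ => hI δ, hsum] at htot
  linarith

end IsModel

end Nuisance

/-! ### The bias of the estimated influence function -/

namespace Nuisance

variable {𝒳 : Type*}

/-- The weighted integrand of the martingale part, cut off outside `(0, T]`. -/
def weightedIntegrand (ν : Nuisance 𝒳) (i j : Fin 2) (T : ℝ)
    (p : (Fin 2 × 𝒳) × ℝ) : ℝ :=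
  if p.2 ∈ Ioc 0 T then ν.signedWeight p.1.1 p.1.2 * ν.integrandExt i j T p.1.1 p.1.2 p.2 else 0

variable {ν ν' : Nuisance 𝒳} {η T : ℝ}

theorem Regular.abs_weightedIntegrand_le (hν : ν.Regular η T)
    (i j : Fin 2) (p : (Fin 2 × 𝒳) × ℝ) :
    |ν.weightedIntegrand i j T p| ≤ 1 / η * ((1 + 1 / η ^ 2) * T / η) := by
  have hη := hν.eta_pos
  have hT := hν.time_pos
  rw [weightedIntegrand]
  split_ifs with hp
  · rw [hν.integrandExt_eq i j _ _ hp.2, abs_mul]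
    exact mul_le_mul (hν.abs_signedWeight_le _ _) (hν.abs_integrand_le i j ⟨hp.1.le, hp.2⟩)
      (abs_nonneg _) (by positivity)
  · rw [abs_zero]
    positivity

theorem Regular.signedWeight_mul_martingaleIntegral
    (hν : ν.Regular η T) (i j : Fin 2) (o : Obs 𝒳) :
    ν.signedWeight o.arm o.cov *
        ν.martingaleIntegral i (ν.integrand i j T o.arm o.cov) T o =
      (if o.event = i.succ ∧ o.time ∈ Ioc 0 T then
          ν.weightedIntegrand i j T (o.armCov, o.time) else 0) -
        ∫ s in Iic o.time, ν.weightedIntegrand i j T (o.armCov, s) ∂(ν.hazOf i.succ o.armCov) := by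
  rw [hν.martingaleIntegral_eq, mul_sub, ← integral_const_mul]
  congr 1
  · split_ifs with h1
    · rw [weightedIntegrand, if_pos h1.2, hν.integrandExt_eq i j _ _ h1.2.2]
      rfl
    · rw [mul_zero]
  · refine integral_congr_ae (ae_restrict_of_ae ?_)
    filter_upwards [hν.ae_mem i.succ o.arm o.cov] with s hs
    rw [weightedIntegrand, if_pos hs, hν.integrandExt_eq i j _ _ hs.2]
    rfl

theorem Regular.atRisk_nonneg (hν : ν.Regular η T) (w : Fin 2 × 𝒳) (s : ℝ) : 0 ≤ ν.atRisk w s :=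
  mul_nonneg (hν.eta_pos.trans (hν.lt_surv s w.1 w.2)).le
    (hν.eta_pos.trans (hν.lt_censSurv s w.1 w.2)).le

theorem Regular.abs_atRisk_le (hν : ν.Regular η T) (w : Fin 2 × 𝒳) (s : ℝ) :
    |ν.atRisk w s| ≤ 1 := by
  rw [abs_of_nonneg (hν.atRisk_nonneg w s)]
  exact mul_le_one₀ (hν.surv_le_one s w.1 w.2) (hν.eta_pos.trans (hν.lt_censSurv s w.1 w.2)).le
    (hν.censSurv_le_one s w.1 w.2)

/-- The conditional mean, given arm and covariates, of the weighted martingale part of `ν'`,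
when `ν` is the true nuisance parameter. -/
def drift (ν ν' : Nuisance 𝒳) (j : Fin 2) (T : ℝ) (w : Fin 2 × 𝒳) : ℝ :=
  ∑ i : Fin 2, ((∫ s, ν.atRisk w s * ν'.weightedIntegrand i j T (w, s) ∂(ν.hazOf i.succ w)) -
    ∫ s, ν.atRisk w s * ν'.weightedIntegrand i j T (w, s) ∂(ν'.hazOf i.succ w))

/-- The contribution of the covariates `x` to the remainder of arm `a`. -/
def remainderAt (ν ν' : Nuisance 𝒳) (j : Fin 2) (T : ℝ) (a : Fin 2) (x : 𝒳) : ℝ :=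
  ∑ i : Fin 2,
    ((∫ s in Ioc 0 T, ν.surv s a x * ν'.H i j s T a x *
        (1 - ν.ps a x * ν.censSurv s a x / (ν'.ps a x * ν'.censSurv s a x))
          ∂(ν'.haz i.succ a x)) -
      ∫ s in Ioc 0 T, ν.surv s a x * ν'.H i j s T a x *
        (1 - ν.ps a x * ν.censSurv s a x / (ν'.ps a x * ν'.censSurv s a x))
          ∂(ν.haz i.succ a x))

theorem signedWeight_eq (a : Fin 2) (x : 𝒳) :
    ν.signedWeight a x = (if a = 1 then 1 else -1) / ν.ps a x := by
  fin_cases a <;> simp [signedWeight, neg_div]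

/-- The summand `1` in the weight `1 - π S_C / (π' S_C')` of the remainder produces, by the von
Mises expansion, the difference of the life-years lost, and the other summand the drift. -/
theorem Regular.remainderAt_eq (hν : ν.Regular η T) (hν' : ν'.Regular η T)
    (hcont : ∀ δ a x, NullSingletonClass (ν.haz δ a x)) (j a : Fin 2) (x : 𝒳) :
    ν.remainderAt ν' j T a x = (ν'.lifeYearsLost j T a x - ν.lifeYearsLost j T a x) +
      (if a = 1 then 1 else -1) * (ν.ps a x * ν.drift ν' j T (a, x)) := by
  have hη := hν.eta_pos
  rw [← hν.lifeYearsLost_sub hν' hcont j a x, remainderAt, drift, Finset.mul_sum, Finset.mul_sum,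
    ← Finset.sum_add_distrib]
  refine Finset.sum_congr rfl fun i _ => ?_
  have key : ∀ {ν'' : Nuisance 𝒳}, ν''.Regular η T →
      (∫ s in Ioc 0 T, ν.surv s a x * ν'.H i j s T a x *
        (1 - ν.ps a x * ν.censSurv s a x / (ν'.ps a x * ν'.censSurv s a x))
          ∂(ν''.haz i.succ a x)) =
      (∫ s, ν.surv s a x * ν'.H i j s T a x ∂(ν''.haz i.succ a x)) -
        (if a = 1 then 1 else -1) * (ν.ps a x *
          ∫ s, ν.atRisk (a, x) s * ν'.weightedIntegrand i j T ((a, x), s)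
            ∂(ν''.hazOf i.succ (a, x))) := by
    intro ν'' hν''
    have := hν''.finite i.succ a x
    have hbd : ∀ {f : ℝ → ℝ}, Measurable f → (∀ s, |f s| ≤ 1) →
        Integrable (fun s => f s * ν'.integrand i j T a x s) (ν''.haz i.succ a x) := by
      intro f hf hf1
      have := hν'.integrableOn_integrand (a := a) (x := x) hν'' i j i.succ univ
      rw [integrableOn_univ] at this
      exact this.bdd_mul hf.aestronglyMeasurable (ae_of_all _ hf1)
    have hcut : Measure.restrict (ν''.haz i.succ a x) (Ioc 0 T) = ν''.haz i.succ a x :=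
      Measure.restrict_eq_self_of_ae_mem (hν''.ae_mem i.succ a x)
    have hS : Measurable fun s => ν.surv s a x := (hν.surv_antitone a x).measurable
    have hG : Measurable fun s => ν.censSurv s a x := (hν.censSurv_antitone a x).measurable
    have hG' : Measurable fun s => ν'.censSurv s a x := (hν'.censSurv_antitone a x).measurable
    have hbound : ∀ {ρ : Nuisance 𝒳}, ρ.Regular η T → ∀ s, |ρ.surv s a x| ≤ 1 ∧
        |ρ.censSurv s a x| ≤ 1 := fun hρ s => by
      rw [abs_of_pos (hη.trans (hρ.lt_surv s a x)), abs_of_pos (hη.trans (hρ.lt_censSurv s a x))]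
      exact ⟨hρ.surv_le_one s a x, hρ.censSurv_le_one s a x⟩
    have hI1 : Integrable (fun s => ν.surv s a x * ν'.H i j s T a x) (ν''.haz i.succ a x) := by
      refine (hbd (hS.mul hG') fun s => ?_).congr (ae_of_all _ fun s => ?_)
      · rw [Pi.mul_apply, abs_mul]
        exact mul_le_one₀ (hbound hν s).1 (abs_nonneg _) (hbound hν' s).2
      · have := hη.trans (hν'.lt_censSurv s a x)
        simp only [Pi.mul_apply, integrand]
        field_simp
    have hW : ∀ᵐ s ∂(ν''.haz i.succ a x), ν.atRisk (a, x) s *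
        ν'.weightedIntegrand i j T ((a, x), s) = ν'.signedWeight a x *
          (ν.surv s a x * ν.censSurv s a x * ν'.integrand i j T a x s) := by
      filter_upwards [hν''.ae_mem i.succ a x] with s hs
      rw [weightedIntegrand, if_pos hs, hν'.integrandExt_eq i j _ _ hs.2, atRisk]
      ring
    rw [hcut]
    change _ = _ - _ * (_ * ∫ s, _ ∂(ν''.haz i.succ a x))
    rw [integral_congr_ae hW, integral_const_mul, ← integral_const_mul (ν'.signedWeight a x),
      ← integral_const_mul, ← integral_const_mul, ← integral_sub hI1]
    · refine integral_congr_ae (ae_of_all _ fun s => ?_)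
      have h1 := hη.trans (hν'.lt_censSurv s a x)
      have h2 := hη.trans (hν'.lt_ps a x)
      simp only [integrand, signedWeight_eq]
      fin_cases a
      · simp
        field_simp
        ring
      · simp
        field_simp
    · refine Integrable.const_mul (Integrable.const_mul (Integrable.const_mul ?_ _) _) _
      refine hbd (hS.mul hG) fun s => ?_
      simp only [abs_mul]
      exact mul_le_one₀ (hbound hν s).1 (abs_nonneg _) (hbound hν s).2
  rw [key hν', key hν]
  simp only [hazOf]
  ring

variable [MeasurableSpace 𝒳]

theorem measurable_of_arm {F : Fin 2 → 𝒳 → ℝ → ℝ}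
    (hF : ∀ a, Measurable fun p : 𝒳 × ℝ => F a p.1 p.2) :
    Measurable fun p : (Fin 2 × 𝒳) × ℝ => F p.1.1 p.1.2 p.2 := by
  have h : Measurable fun q : Fin 2 × (𝒳 × ℝ) => F q.1 q.2.1 q.2.2 :=
    measurable_from_prod_countable_right hF
  have hperm : Measurable fun p : (Fin 2 × 𝒳) × ℝ => (p.1.1, (p.1.2, p.2)) := by fun_prop
  exact h.comp hperm

theorem IsMeasurable.weightedIntegrand (hm : ν.IsMeasurable)
    (hν : ν.Regular η T) (i j : Fin 2) : Measurable (ν.weightedIntegrand i j T) := by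
  refine Measurable.ite (measurable_snd measurableSet_Ioc) ?_ measurable_const
  refine (hm.signedWeight.comp measurable_fst).mul ?_
  exact measurable_of_arm (F := ν.integrandExt i j T) (hm.integrandExt hν i j)

namespace IsModel

variable {P : Measure (Obs 𝒳)} [IsProbabilityMeasure P] {ν ν' : Nuisance 𝒳} {η T : ℝ}

theorem integrable_ps (h : ν.IsModel P T) (hν : ν.Regular η T) (a : Fin 2) :
    Integrable (fun o => ν.ps a o.cov) P := by
  refine ⟨((h.ps a).comp Obs.measurable_cov).aestronglyMeasurable, ?_⟩
  have h1 := h.propensity a univ MeasurableSet.univ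
  simp only [mem_univ, and_true, ofPred_true, Measure.restrict_univ] at h1
  rw [hasFiniteIntegral_iff_ofReal (f := fun o : Obs 𝒳 => ν.ps a o.cov)
    (ae_of_all _ fun o => (hν.eta_pos.trans (hν.lt_ps a o.cov)).le), ← h1]
  exact measure_lt_top _ _

/-- The propensity score disintegrates the distribution of the arm given the covariates. -/
theorem integral_armCov (h : ν.IsModel P T) (hν : ν.Regular η T) {q : Fin 2 × 𝒳 → ℝ}
    (hq : Measurable q) {C : ℝ} (hqC : ∀ w, |q w| ≤ C) :
    ∫ o, q o.armCov ∂P = ∫ o, (ν.ps 0 o.cov * q (0, o.cov) + ν.ps 1 o.cov * q (1, o.cov)) ∂P := by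
  have hqa : ∀ a, Measurable fun x => q (a, x) := fun a => hq.comp measurable_prodMk_left
  have hps : ∀ a, Measurable fun x => ENNReal.ofReal (ν.ps a x) := fun a =>
    (h.ps a).ennreal_ofReal
  have harm : ∀ a, MeasurableSet {o : Obs 𝒳 | o.arm = a} := fun a =>
    Obs.measurable_arm (measurableSet_singleton a)
  have hmeas : ∀ a, (P.restrict {o | o.arm = a}).map Obs.cov =
      (P.map Obs.cov).withDensity fun x => ENNReal.ofReal (ν.ps a x) := fun a => by
    ext B hB
    rw [Measure.map_apply Obs.measurable_cov hB, withDensity_apply _ hB,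
      Measure.restrict_apply (Obs.measurable_cov hB), setLIntegral_map hB (hps a)
      Obs.measurable_cov]
    refine Eq.trans ?_ (h.propensity a B hB)
    congr 1
    ext o
    exact and_comm
  have hone : ∀ a, ∫ o, {o : Obs 𝒳 | o.arm = a}.indicator (fun o => q (a, o.cov)) o ∂P =
      ∫ o, ν.ps a o.cov * q (a, o.cov) ∂P := fun a => by
    rw [integral_indicator (harm a), ← integral_map (f := fun x => q (a, x))
      Obs.measurable_cov.aemeasurable (hqa a).aestronglyMeasurable, hmeas a,
      integral_withDensity_eq_integral_toReal_smul (hps a)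
        (ae_of_all _ fun x => ENNReal.ofReal_lt_top),
      integral_map (f := fun x => (ENNReal.ofReal (ν.ps a x)).toReal • q (a, x))
        Obs.measurable_cov.aemeasurable
        ((hps a).ennreal_toReal.smul (hqa a)).aestronglyMeasurable]
    refine integral_congr_ae (ae_of_all _ fun o => ?_)
    simp only [smul_eq_mul]
    rw [ENNReal.toReal_ofReal (hν.eta_pos.trans (hν.lt_ps a o.cov)).le]
  have hint : ∀ a, Integrable (fun o : Obs 𝒳 => q (a, o.cov)) P := fun a =>
    Integrable.of_bound ((hqa a).comp Obs.measurable_cov).aestronglyMeasurable C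
      (ae_of_all _ fun o => hqC _)
  have hint' : ∀ a, Integrable (fun o : Obs 𝒳 => ν.ps a o.cov * q (a, o.cov)) P := fun a =>
    (h.integrable_ps hν a).mul_bdd
      ((hqa a).comp Obs.measurable_cov).aestronglyMeasurable (ae_of_all _ fun o => hqC _)
  rw [integral_add (hint' 0) (hint' 1), ← hone 0, ← hone 1,
    ← integral_add ((hint 0).indicator (harm 0)) ((hint 1).indicator (harm 1))]
  refine integral_congr_ae (ae_of_all _ fun o => ?_)
  have : o.arm = 0 ∨ o.arm = 1 := by omega
  rcases this with ho | ho <;> simp [Obs.armCov, ho, indicator]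

theorem measurable_atRisk (hm : ν.IsMeasurable) (hν : ν.Regular η T) :
    Measurable fun p : (Fin 2 × 𝒳) × ℝ => ν.atRisk p.1 p.2 :=
  measurable_of_arm (F := fun a x s => ν.atRisk (a, x) s) fun a => by
    simp only [atRisk]
    exact (hm.surv hν a).mul (hm.censSurv hν a)

theorem measurable_drift (hm : ν.IsMeasurable) (hν : ν.Regular η T) (hm' : ν'.IsMeasurable)
    (hν' : ν'.Regular η T) (j : Fin 2) : Measurable (ν.drift ν' j T) := by
  refine Finset.measurable_fun_sum _ fun i _ => Measurable.sub ?_ ?_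
  · exact measurable_integral_of_isFiniteMeasure (hm.hazOf i.succ)
      (fun w => hν.finite i.succ w.1 w.2)
      ((measurable_atRisk hm hν).mul (hm'.weightedIntegrand hν' i j))
  · exact measurable_integral_of_isFiniteMeasure (hm'.hazOf i.succ)
      (fun w => hν'.finite i.succ w.1 w.2)
      ((measurable_atRisk hm hν).mul (hm'.weightedIntegrand hν' i j))

/-- The bias formula: under the model `ν`, the mean of the influence function at `ν'` differs from
the parameter by the difference of the remainders of the two arms. -/
theorem integral_phi_sub_psi (h : ν.IsModel P T) (hν : ν.Regular η T) (hm' : ν'.IsMeasurable)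
    (hν' : ν'.Regular η T) (j : Fin 2) :
    ∫ o, ν'.phi j T o ∂P - psi P ν j T = remainder P ν ν' j T 1 - remainder P ν ν' j T 0 := by
  have hη := hν.eta_pos
  have hT := hν.time_pos
  set C := 1 / η * ((1 + 1 / η ^ 2) * T / η) with hC
  have hw := fun i => hm'.weightedIntegrand hν' i j
  have hwC := fun i => hν'.abs_weightedIntegrand_le i j
  have hatC : ∀ i p, |ν.atRisk p.1 p.2 * ν'.weightedIntegrand i j T p| ≤ C := fun i p => by
    rw [abs_mul]
    exact (mul_le_mul (hν.abs_atRisk_le p.1 p.2) (hwC i p) (abs_nonneg _) zero_le_one).trans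
      (one_mul C).le
  have hbdd : ∀ {φ : Obs 𝒳 → ℝ} {c : ℝ}, Measurable φ → (∀ o, |φ o| ≤ c) → Integrable φ P :=
    fun hφ hc => Integrable.of_bound hφ.aestronglyMeasurable _ (ae_of_all _ hc)
  -- the conditional mean of the weighted martingale integrals is the drift
  have hpair : Measurable fun o : Obs 𝒳 => (o.armCov, o.time) :=
    Obs.measurable_armCov.prodMk Obs.measurable_time
  have hev : ∀ i : Fin 2, Integrable (fun o : Obs 𝒳 => if o.event = i.succ ∧ o.time ∈ Ioc 0 T then
      ν'.weightedIntegrand i j T (o.armCov, o.time) else 0) P := fun i => by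
    refine hbdd (c := C) (Measurable.ite ((Obs.measurable_event (measurableSet_singleton _)).inter
      (Obs.measurable_time measurableSet_Ioc)) ((hw i).comp hpair) measurable_const) fun o => ?_
    split_ifs
    · exact hwC i _
    · rw [abs_zero]
      positivity
  have hcomp : ∀ i : Fin 2, Integrable (fun o : Obs 𝒳 => ∫ s in Iic o.time,
      ν'.weightedIntegrand i j T (o.armCov, s) ∂(ν'.hazOf i.succ o.armCov)) P := fun i => by
    have hfin : ∀ w, IsFiniteMeasure (ν'.hazOf i.succ w) := fun w => hν'.finite i.succ w.1 w.2
    exact hbdd ((measurable_integral_section (hm'.hazOf i.succ) hfin (hw i)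
      (A := {q : ((Fin 2 × 𝒳) × ℝ) × ℝ | q.2 ≤ q.1.2})
      (measurableSet_le measurable_snd (measurable_snd.comp measurable_fst))).comp hpair)
      fun o => by
        have := hν'.finite i.succ o.arm o.cov
        exact abs_setIntegral_le (m := ν'.haz i.succ o.arm o.cov) (fun s => hwC i _)
          (hν'.haz_le i.succ _ _) _
  have hmean : ∀ {ρ : Nuisance 𝒳} (i : Fin 2), ρ.IsMeasurable → ρ.Regular η T →
      Integrable (fun o : Obs 𝒳 => ∫ s, ν.atRisk o.armCov s *
        ν'.weightedIntegrand i j T (o.armCov, s) ∂(ρ.hazOf i.succ o.armCov)) P := by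
    intro ρ i hρm hρ
    have hfin : ∀ w, IsFiniteMeasure (ρ.hazOf i.succ w) := fun w => hρ.finite i.succ w.1 w.2
    refine hbdd (c := C * (1 / η)) ((measurable_integral_of_isFiniteMeasure (hρm.hazOf i.succ) hfin
      ((measurable_atRisk h.toIsMeasurable hν).mul (hw i))).comp Obs.measurable_armCov)
      fun o => ?_
    have := hρ.finite i.succ o.arm o.cov
    rw [← setIntegral_univ]
    exact abs_setIntegral_le (m := ρ.haz i.succ o.arm o.cov)
      (fun s => hatC i (o.armCov, s)) (hρ.haz_le i.succ _ _) _
  have hmart : ∫ o, ν'.signedWeight o.arm o.cov * ν'.martingalePart j T o ∂P =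
      ∫ o, ν.drift ν' j T o.armCov ∂P := by
    simp only [martingalePart, Finset.mul_sum, hν'.signedWeight_mul_martingaleIntegral, drift]
    rw [integral_finsetSum _ fun i _ => (hev i).sub' (hcomp i), integral_finsetSum _ fun i _ =>
      (hmean i h.toIsMeasurable hν).sub' (hmean i hm' hν')]
    refine Finset.sum_congr rfl fun i _ => ?_
    rw [integral_sub (hev i) (hcomp i), integral_sub (hmean i h.toIsMeasurable hν)
      (hmean i hm' hν'), h.integral_event hν i.succ (hw i) (hwC i),
      h.integral_Iic_time hν (hm'.hazOf i.succ) (fun w => hν'.finite i.succ w.1 w.2)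
        (fun w => hν'.haz_le i.succ w.1 w.2) (fun w => hν'.support i.succ w.1 w.2) (hw i) (hwC i)]
    congr 1
    exact h.integral_Iic_time hν (h.toIsMeasurable.hazOf i.succ)
      (fun w => hν.finite i.succ w.1 w.2) (fun w => hν.haz_le i.succ w.1 w.2)
      (fun w => hν.support i.succ w.1 w.2) (hw i) (hwC i)
  have hdm := measurable_drift h.toIsMeasurable hν hm' hν' j
  have hdC : ∀ w, |ν.drift ν' j T w| ≤ ∑ i : Fin 2, (C * (1 / η) + C * (1 / η)) := fun w => by
    refine (Finset.abs_sum_le_sum_abs _ _).trans (Finset.sum_le_sum fun i _ => ?_)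
    have hfin := hν.finite i.succ w.1 w.2
    have hfin' := hν'.finite i.succ w.1 w.2
    refine (abs_sub _ _).trans (add_le_add ?_ ?_)
    · rw [← setIntegral_univ]
      exact abs_setIntegral_le (m := ν.haz i.succ w.1 w.2) (fun s => hatC i (w, s))
        (hν.haz_le i.succ _ _) _
    · rw [← setIntegral_univ]
      exact abs_setIntegral_le (m := ν'.haz i.succ w.1 w.2) (fun s => hatC i (w, s))
        (hν'.haz_le i.succ _ _) _
  have hps : ∀ a, Integrable (fun o => ν.ps a o.cov * ν.drift ν' j T (a, o.cov)) P := fun a =>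
    (h.integrable_ps hν a).mul_bdd
      ((hdm.comp measurable_prodMk_left).comp Obs.measurable_cov).aestronglyMeasurable
      (ae_of_all _ fun o => hdC _)
  have hL : ∀ {ρ : Nuisance 𝒳}, ρ.IsMeasurable → ρ.Regular η T → ∀ a,
      Integrable (fun o => ρ.lifeYearsLost j T a o.cov) P := fun hρm hρ a =>
    hbdd ((hρm.lifeYearsLost hρ j a).comp Obs.measurable_cov)
      fun o => hρ.abs_lifeYearsLost_le j a o.cov
  have hcate : ∀ {ρ : Nuisance 𝒳}, ρ.IsMeasurable → ρ.Regular η T →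
      Integrable (fun o => ρ.cate j T o.cov) P := fun hρm hρ => (hL hρm hρ 1).sub (hL hρm hρ 0)
  have hWM : Integrable (fun o => ν'.signedWeight o.arm o.cov * ν'.martingalePart j T o) P := by
    simp only [martingalePart, Finset.mul_sum, hν'.signedWeight_mul_martingaleIntegral]
    exact integrable_finsetSum _ fun i _ => (hev i).sub' (hcomp i)
  have hR : ∀ a, Integrable (fun o => ν.remainderAt ν' j T a o.cov) P := fun a => by
    simp only [hν.remainderAt_eq hν' h.noAtoms]
    exact ((hL hm' hν' a).sub (hL h.toIsMeasurable hν a)).add ((hps a).const_mul _)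
  change _ = ∫ o, ν.remainderAt ν' j T 1 o.cov ∂P - ∫ o, ν.remainderAt ν' j T 0 o.cov ∂P
  simp only [phi_eq]
  rw [integral_add (hcate hm' hν') hWM, hmart, h.integral_armCov hν hdm hdC, psi,
    ← integral_add (hcate hm' hν') ((hps 0).fun_add (hps 1)),
    ← integral_sub ((hcate hm' hν').fun_add ((hps 0).fun_add (hps 1))) (hcate h.toIsMeasurable hν),
    ← integral_sub (hR 1) (hR 0)]
  refine integral_congr_ae (ae_of_all _ fun o => ?_)
  simp only [hν.remainderAt_eq hν' h.noAtoms, cate]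
  simp
  ring

/-- The remainder vanishes at the true nuisance parameter. -/
theorem integral_phi (h : ν.IsModel P T) (hν : ν.Regular η T) (j : Fin 2) :
    ∫ o, ν.phi j T o ∂P = psi P ν j T := by
  have := h.integral_phi_sub_psi hν h.toIsMeasurable hν j
  simpa [remainder, sub_eq_zero] using this

end IsModel

end Nuisance

/-! ### Cross-fitted empirical averages -/

section Resampling

variable {X : Type*} [MeasurableSpace X] {n : ℕ}

theorem measurable_update_pair (i : Fin n) :
    Measurable fun p : (Fin n → X) × X => Function.update p.1 i p.2 :=
  measurable_pi_iff.2 fun l => by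
    by_cases hl : l = i
    · subst hl
      simpa using measurable_snd
    · simp only [Function.update_of_ne hl]
      exact (measurable_pi_apply l).comp measurable_fst

variable {P : Measure X} [IsProbabilityMeasure P]

/-- Resampling one coordinate of an i.i.d. sample does not change its distribution. -/
theorem map_update_pi (i : Fin n) :
    ((Measure.pi fun _ : Fin n => P).prod P).map (fun p => Function.update p.1 i p.2) =
      Measure.pi fun _ : Fin n => P := by
  refine (Measure.pi_eq fun s hs => ?_).symm
  rw [Measure.map_apply (measurable_update_pair i) (MeasurableSet.univ_pi hs)]
  have hset : (fun p : (Fin n → X) × X => Function.update p.1 i p.2) ⁻¹' (univ.pi s) =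
      (univ.pi (Function.update s i univ)) ×ˢ (s i) := by
    ext p
    simp only [mem_preimage, mem_univ_pi, mem_prod]
    refine ⟨fun h => ⟨fun l => ?_, by simpa using h i⟩, fun h l => ?_⟩
    · by_cases hl : l = i
      · subst hl
        simp
      · simpa [hl] using h l
    · by_cases hl : l = i
      · subst hl
        simpa using h.2
      · simpa [hl] using h.1 l
  rw [hset, Measure.prod_prod, Measure.pi_pi, ← Finset.mul_prod_erase _ _ (Finset.mem_univ i),
    ← Finset.mul_prod_erase _ (fun l => P (s l)) (Finset.mem_univ i), Function.update_self,
    measure_univ, one_mul, mul_comm]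
  congr 1
  exact Finset.prod_congr rfl fun l hl => by
    rw [Function.update_of_ne (Finset.ne_of_mem_erase hl)]

/-- If `F d` does not depend on the coordinate `d i`, then `d i` may be replaced by an independent
copy. -/
theorem integral_pi_eval {F : (Fin n → X) → X → ℝ}
    (hF : Measurable fun p : (Fin n → X) × X => F p.1 p.2) {C : ℝ} (hC : ∀ d x, |F d x| ≤ C)
    (i : Fin n) (hi : ∀ d x, F (Function.update d i x) = F d) :
    ∫ d, F d (d i) ∂(Measure.pi fun _ : Fin n => P) =
      ∫ d, ∫ x, F d x ∂P ∂(Measure.pi fun _ : Fin n => P) := by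
  have hFi : Measurable fun d : Fin n → X => F d (d i) :=
    hF.comp (measurable_id.prodMk (measurable_pi_apply i))
  conv_lhs => rw [← map_update_pi i]
  rw [integral_map (measurable_update_pair i).aemeasurable hFi.aestronglyMeasurable]
  simp only [hi, Function.update_self]
  exact integral_prod _ (Integrable.of_bound hF.aestronglyMeasurable C
    (ae_of_all _ fun p => hC _ _))

/-- Conditionally on the data outside `T`, the centered sum over `T` of a function that was fitted
on the data outside `T` has variance at most `#T` times the second moment of that function. -/
theorem integral_sq_sum_le {g : (Fin n → X) → X → ℝ}
    (hg : Measurable fun p : (Fin n → X) × X => g p.1 p.2) {C : ℝ} (hC : ∀ d x, |g d x| ≤ C)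
    (T : Finset (Fin n)) (hi : ∀ i ∈ T, ∀ d x, g (Function.update d i x) = g d) :
    ∫ d, (∑ i ∈ T, (g d (d i) - ∫ x, g d x ∂P)) ^ 2 ∂(Measure.pi fun _ : Fin n => P) ≤
      T.card * ∫ d, ∫ x, g d x ^ 2 ∂P ∂(Measure.pi fun _ : Fin n => P) := by
  set Q := Measure.pi fun _ : Fin n => P with hQ
  have hGm : Measurable fun d => ∫ x, g d x ∂P :=
    (hg.stronglyMeasurable.integral_prod_right (ν := P)).measurable
  have hG2m : Measurable fun d => ∫ x, g d x ^ 2 ∂P :=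
    ((hg.pow_const 2).stronglyMeasurable.integral_prod_right (ν := P)).measurable
  have hgd : ∀ d, Integrable (g d) P := fun d => Integrable.of_bound
    (hg.comp measurable_prodMk_left).aestronglyMeasurable C (ae_of_all _ (hC d))
  have hgd2 : ∀ d, Integrable (fun x => g d x ^ 2) P := fun d => Integrable.of_bound
    ((hg.comp measurable_prodMk_left).pow_const 2).aestronglyMeasurable (C ^ 2)
    (ae_of_all _ fun x => by
      rw [Real.norm_eq_abs, abs_pow]
      exact pow_le_pow_left₀ (abs_nonneg _) (hC d x) 2)
  have hGC : ∀ d, |∫ x, g d x ∂P| ≤ C := fun d => by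
    have := norm_integral_le_of_norm_le_const (μ := P) (f := g d) (C := C) (ae_of_all _ (hC d))
    simpa using this
  set h : (Fin n → X) → X → ℝ := fun d x => g d x - ∫ x, g d x ∂P with hh
  have hhm : Measurable fun p : (Fin n → X) × X => h p.1 p.2 :=
    hg.sub (hGm.comp measurable_fst)
  have hhC : ∀ d x, |h d x| ≤ 2 * C := fun d x => by
    refine (abs_sub _ _).trans ?_
    have := hC d x
    have := hGC d
    linarith
  have hhi : ∀ i ∈ T, ∀ d x, h (Function.update d i x) = h d := fun i hiT d x => by
    simp only [hh, hi i hiT]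
  have hhT : ∀ i, Measurable fun d : Fin n → X => h d (d i) := fun i =>
    hhm.comp (measurable_id.prodMk (measurable_pi_apply i))
  have hmul : ∀ i l, Integrable (fun d => h d (d i) * h d (d l)) Q := fun i l =>
    Integrable.of_bound ((hhT i).mul (hhT l)).aestronglyMeasurable (2 * C * (2 * C))
      (ae_of_all _ fun d => by
        rw [Real.norm_eq_abs, abs_mul]
        exact mul_le_mul (hhC _ _) (hhC _ _) (abs_nonneg _)
          ((abs_nonneg _).trans (hhC d (d i))))
  have hmean : ∀ d, ∫ x, h d x ∂P = 0 := fun d => by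
    simp only [hh]
    rw [integral_sub (hgd d) (integrable_const _)]
    simp
  -- distinct terms are uncorrelated: resample the coordinate `i`, on which `h` and `d l` do not
  -- depend
  have hoff : ∀ i ∈ T, ∀ l ∈ T, l ≠ i → ∫ d, h d (d i) * h d (d l) ∂Q = 0 := by
    intro i hiT l hlT hl
    have := integral_pi_eval (P := P) (F := fun d x => h d x * h d (d l))
      (hhm.mul ((hhT l).comp measurable_fst)) (C := 2 * C * (2 * C)) (fun d x => by
        rw [abs_mul]
        exact mul_le_mul (hhC _ _) (hhC _ _) (abs_nonneg _)
          ((abs_nonneg _).trans (hhC d x))) i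
      (fun d x => by simp only [hhi i hiT, Function.update_of_ne hl])
    simp only [integral_mul_const, hmean, zero_mul, integral_zero] at this
    exact this
  -- the variance is at most the second moment
  have hdiag : ∀ i ∈ T, ∫ d, h d (d i) * h d (d i) ∂Q ≤ ∫ d, ∫ x, g d x ^ 2 ∂P ∂Q := by
    intro i hiT
    have := integral_pi_eval (P := P) (F := fun d x => h d x * h d x)
      (hhm.mul hhm) (C := 2 * C * (2 * C)) (fun d x => by
        rw [abs_mul]
        exact mul_le_mul (hhC _ _) (hhC _ _) (abs_nonneg _)
          ((abs_nonneg _).trans (hhC d x))) i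
      (fun d x => by simp only [hhi i hiT])
    rw [this]
    have hle : ∀ d, ∫ x, h d x * h d x ∂P ≤ ∫ x, g d x ^ 2 ∂P := fun d => by
      have h1 : ∀ x, h d x * h d x = g d x ^ 2 - 2 * (∫ x, g d x ∂P) * g d x +
          (∫ x, g d x ∂P) ^ 2 := fun x => by
        simp only [hh]
        ring
      simp only [h1]
      rw [integral_add ((hgd2 d).sub' ((hgd d).const_mul _)) (integrable_const _),
        integral_sub (hgd2 d) ((hgd d).const_mul _), integral_const_mul]
      simp only [integral_const, probReal_univ, smul_eq_mul, one_mul]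
      nlinarith [sq_nonneg (∫ x, g d x ∂P)]
    refine integral_mono ?_ ?_ hle
    · refine Integrable.of_bound ((hhm.mul hhm).stronglyMeasurable.integral_prod_right
        (ν := P)).aestronglyMeasurable (2 * C * (2 * C)) (ae_of_all _ fun d => ?_)
      have := norm_integral_le_of_norm_le_const (μ := P) (f := fun x => h d x * h d x)
        (C := 2 * C * (2 * C)) (ae_of_all _ fun x => by
          rw [Real.norm_eq_abs, abs_mul]
          exact mul_le_mul (hhC _ _) (hhC _ _) (abs_nonneg _)
            ((abs_nonneg _).trans (hhC d x)))
      simpa using this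
    · refine Integrable.of_bound hG2m.aestronglyMeasurable (C ^ 2) (ae_of_all _ fun d => ?_)
      have := norm_integral_le_of_norm_le_const (μ := P) (f := fun x => g d x ^ 2)
        (C := C ^ 2) (ae_of_all _ fun x => by
          rw [Real.norm_eq_abs, abs_pow]
          exact pow_le_pow_left₀ (abs_nonneg _) (hC d x) 2)
      simpa using this
  calc ∫ d, (∑ i ∈ T, (g d (d i) - ∫ x, g d x ∂P)) ^ 2 ∂Q
      = ∑ i ∈ T, ∑ l ∈ T, ∫ d, h d (d i) * h d (d l) ∂Q := by
        simp only [pow_two, Finset.sum_mul_sum]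
        rw [integral_finsetSum _ fun i _ => integrable_finsetSum _ fun l _ => hmul i l]
        exact Finset.sum_congr rfl fun i _ => integral_finsetSum _ fun l _ => hmul i l
    _ = ∑ i ∈ T, ∫ d, h d (d i) * h d (d i) ∂Q := Finset.sum_congr rfl fun i hiT =>
        Finset.sum_eq_single_of_mem i hiT fun l hlT hl => hoff i hiT l hlT hl
    _ ≤ ∑ i ∈ T, ∫ d, ∫ x, g d x ^ 2 ∂P ∂Q := Finset.sum_le_sum hdiag
    _ = _ := by rw [Finset.sum_const, nsmul_eq_mul]

end Resampling

section InMeasure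

variable {Ω : Type*} [MeasurableSpace Ω] {μ : Measure Ω}

/-- The nonnegative variables `v n` converge to zero in measure. -/
def SmallInMeasure (μ : Measure Ω) (v : ℕ → Ω → ℝ≥0∞) : Prop :=
  ∀ ε : ℝ≥0∞, 0 < ε → Tendsto (fun n => μ {ω | ε ≤ v n ω}) atTop (𝓝 0)

theorem edist_zero_ennreal (x : ℝ≥0∞) : edist x 0 = x := by
  induction x with
  | top => exact (ENNReal.edist_eq_top_iff _ _).2 ⟨ENNReal.top_ne_zero, Or.inl rfl⟩
  | coe x =>
    change edist x 0 = (x : ℝ≥0∞)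
    simp [edist_nndist, NNReal.nndist_zero_eq_val']

theorem TendstoInMeasure.small_ennreal {f : ℕ → Ω → ℝ≥0∞}
    (h : TendstoInMeasure μ f atTop fun _ => 0) : SmallInMeasure μ f := fun ε hε => by
  simpa only [edist_zero_ennreal] using h ε hε

theorem TendstoInMeasure.small_enorm {f : ℕ → Ω → ℝ}
    (h : TendstoInMeasure μ f atTop fun _ => 0) : SmallInMeasure μ fun n ω => ‖f n ω‖ₑ :=
  fun ε hε => by simpa only [edist_zero_right] using h ε hε

theorem SmallInMeasure.tendstoInMeasure {f : ℕ → Ω → ℝ}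
    (h : SmallInMeasure μ fun n ω => ‖f n ω‖ₑ) : TendstoInMeasure μ f atTop fun _ => 0 :=
  fun ε hε => by simpa only [edist_zero_right] using h ε hε

/-- Finite linear combinations with a constant coefficient, and almost sure domination, preserve
convergence to zero in measure. -/
theorem SmallInMeasure.of_le_sum {ι : Type*} [Fintype ι] {u : ι → ℕ → Ω → ℝ≥0∞}
    (hu : ∀ i, SmallInMeasure μ (u i)) {v : ℕ → Ω → ℝ≥0∞} {c : ℝ≥0∞} (hc : c ≠ ∞)
    (hv : ∀ n, ∀ᵐ ω ∂μ, v n ω ≤ c * ∑ i, u i n ω) : SmallInMeasure μ v := by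
  intro ε hε
  obtain ⟨δ, hδ, hδε⟩ := ENNReal.exists_nnreal_pos_mul_lt
    (ENNReal.mul_ne_top (ENNReal.natCast_ne_top (Fintype.card ι)) hc) hε.ne'
  have hlim : Tendsto (fun n => ∑ i, μ {ω | (δ : ℝ≥0∞) ≤ u i n ω}) atTop (𝓝 0) := by
    have := tendsto_finsetSum Finset.univ fun i (_ : i ∈ Finset.univ) =>
      hu i δ (ENNReal.coe_pos.2 hδ)
    simpa using this
  refine tendsto_of_tendsto_of_tendsto_of_le_of_le tendsto_const_nhds hlim
    (fun _ => zero_le) fun n => ?_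
  refine (measure_mono_ae ?_).trans (measure_iUnion_fintype_le μ _)
  filter_upwards [hv n] with ω hω hεω
  by_contra hcon
  have hlt : ∀ i, u i n ω ≤ δ := fun i => by
    by_contra hi
    exact hcon (mem_iUnion.2 ⟨i, (not_le.1 hi).le⟩)
  have h1 : ε ≤ c * ∑ i, u i n ω := le_trans hεω hω
  have h2 : c * ∑ i, u i n ω ≤ δ * (Fintype.card ι * c) := by
    calc c * ∑ i, u i n ω ≤ c * ∑ _i : ι, (δ : ℝ≥0∞) := by gcongr with i; exact hlt i
      _ = δ * (Fintype.card ι * c) := by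
        rw [Finset.sum_const, Finset.card_univ, nsmul_eq_mul]
        ring
  exact absurd (h1.trans h2) (not_le.2 hδε)

variable [IsProbabilityMeasure μ]

/-- Bounded convergence in measure. -/
theorem SmallInMeasure.tendsto_integral {V : ℕ → Ω → ℝ} (hV : ∀ n, Measurable (V n))
    (hV0 : ∀ n ω, 0 ≤ V n ω) {C : ℝ} (hVC : ∀ n ω, V n ω ≤ C)
    (h : SmallInMeasure μ fun n ω => ‖V n ω‖ₑ) :
    Tendsto (fun n => ∫ ω, V n ω ∂μ) atTop (𝓝 0) := by
  rw [Metric.tendsto_atTop]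
  intro ε hε
  have hev := (ENNReal.tendsto_toReal ENNReal.zero_ne_top).comp
    (h (ENNReal.ofReal (ε / 2)) (ENNReal.ofReal_pos.2 (by positivity)))
  have hev' : Tendsto (fun n => ε / 2 + C * μ.real {ω | ε / 2 ≤ V n ω}) atTop
      (𝓝 (ε / 2 + C * 0)) := by
    refine (Tendsto.const_mul C ?_).const_add _
    rw [← ENNReal.toReal_zero]
    convert hev using 2 with n
    simp only [Function.comp_apply, measureReal_def]
    congr 2
    ext ω
    simp only [mem_ofPred_eq, Real.enorm_of_nonneg (hV0 n ω)]
    exact (ENNReal.ofReal_le_ofReal_iff (hV0 n ω)).symm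
  rw [mul_zero, add_zero] at hev'
  obtain ⟨N, hN⟩ := eventually_atTop.1 (hev'.eventually (gt_mem_nhds (half_lt_self hε)))
  refine ⟨N, fun n hn => ?_⟩
  have hint : Integrable (V n) μ := Integrable.of_bound (hV n).aestronglyMeasurable C
    (ae_of_all _ fun ω => by rw [Real.norm_of_nonneg (hV0 n ω)]; exact hVC n ω)
  have hset : MeasurableSet {ω | ε / 2 ≤ V n ω} := measurableSet_le measurable_const (hV n)
  have hle : ∫ ω, V n ω ∂μ ≤ ε / 2 + C * μ.real {ω | ε / 2 ≤ V n ω} := by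
    calc ∫ ω, V n ω ∂μ ≤ ∫ ω, (ε / 2 + {ω | ε / 2 ≤ V n ω}.indicator (fun _ => C) ω) ∂μ := by
          refine integral_mono hint ((integrable_const _).add
            ((integrable_const _).indicator hset)) fun ω => ?_
          by_cases hω : ε / 2 ≤ V n ω
          · simp only [indicator_of_mem (show ω ∈ {ω | ε / 2 ≤ V n ω} from hω)]
            linarith [hVC n ω]
          · simp only [indicator_of_notMem (show ω ∉ {ω | ε / 2 ≤ V n ω} from hω)]
            linarith
      _ = _ := by
          rw [integral_add (integrable_const _) ((integrable_const _).indicator hset),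
            integral_indicator_const _ hset]
          simp [mul_comm]
  rw [Real.dist_eq, sub_zero, abs_of_nonneg (integral_nonneg (hV0 n))]
  exact hle.trans_lt (hN n hn)

end InMeasure

section CrossFit

variable {Ω X : Type*} [MeasurableSpace Ω] [MeasurableSpace X] {μ : Measure Ω}
  [IsProbabilityMeasure μ] {P : Measure X} {K : ℕ}

/-- The fold labels and the data are independent, and the data are i.i.d. -/
theorem map_split_data {n : ℕ} {split : Ω → Fin n → Fin K} (hsplit : Measurable split)
    {O : ℕ → Ω → X} (hO : ∀ i, Measurable (O i)) (hO_indep : iIndepFun O μ)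
    (hO_law : ∀ i, μ.map (O i) = P) (hindep : IndepFun split (fun ω (i : Fin n) => O i ω) μ) :
    μ.map (fun ω => (split ω, fun i : Fin n => O i ω)) =
      (μ.map split).prod (Measure.pi fun _ : Fin n => P) := by
  have hdata : Measurable fun ω (i : Fin n) => O i ω := measurable_pi_iff.2 fun i => hO i
  rw [(indepFun_iff_map_prod_eq_prod_map_map hsplit.aemeasurable hdata.aemeasurable).1 hindep]
  congr 1
  have := (iIndepFun_iff_map_fun_eq_pi_map (f := fun i : Fin n => O i)
    fun i => (hO i).aemeasurable).1 (hO_indep.precomp Fin.val_injective)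
  rw [this]
  simp only [hO_law]

variable [IsProbabilityMeasure P]

/-- The empirical process part of a cross-fitted average is negligible when the fitted functions
tend to zero in mean square. No Donsker condition is needed, since on fold `k` the fitted function
is independent of the observations at which it is evaluated. -/
theorem tendstoInMeasure_crossFit {O : ℕ → Ω → X} (hO : ∀ i, Measurable (O i))
    (hO_indep : iIndepFun O μ) (hO_law : ∀ i, μ.map (O i) = P)
    {split : (n : ℕ) → Ω → (Fin n → Fin K)} (hsplit : ∀ n, Measurable (split n))
    (hindep : ∀ n, IndepFun (split n) (fun ω (i : Fin n) => O i ω) μ) (k : Fin K)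
    {g : (n : ℕ) → (Fin n → Fin K) → (Fin n → X) → X → ℝ}
    (hg : ∀ n s, Measurable fun p : (Fin n → X) × X => g n s p.1 p.2) {C : ℝ}
    (hC : ∀ n s d x, |g n s d x| ≤ C)
    (hleave : ∀ n s d d', (∀ i, s i ≠ k → d i = d' i) → g n s d = g n s d')
    (hsmall : SmallInMeasure μ fun n ω =>
      ∫⁻ x, ‖g n (split n ω) (fun i => O i ω) x‖ₑ ^ 2 ∂P) :
    TendstoInMeasure μ (fun (n : ℕ) ω => (√(n : ℝ))⁻¹ * ∑ i : Fin n with split n ω i = k,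
      (g n (split n ω) (fun i => O i ω) (O i ω) -
        ∫ x, g n (split n ω) (fun i => O i ω) x ∂P)) atTop fun _ => 0 := by
  set data : (n : ℕ) → Ω → (Fin n → X) := fun n ω i => O i ω with hdata
  have hdatam : ∀ n, Measurable (data n) := fun n => measurable_pi_iff.2 fun i => hO i
  set W : (n : ℕ) → (Fin n → Fin K) × (Fin n → X) → ℝ := fun n p => (√(n : ℝ))⁻¹ *
    ∑ i : Fin n with p.1 i = k, (g n p.1 p.2 (p.2 i) - ∫ x, g n p.1 p.2 x ∂P) with hW
  set V : (n : ℕ) → (Fin n → Fin K) × (Fin n → X) → ℝ := fun n p =>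
    ∫ x, g n p.1 p.2 x ^ 2 ∂P with hV
  have hC0 : ∀ n s d x, |g n s d x ^ 2| ≤ C ^ 2 := fun n s d x => by
    rw [abs_pow]
    exact pow_le_pow_left₀ (abs_nonneg _) (hC n s d x) 2
  have hVs : ∀ n s, Measurable fun d => V n (s, d) := fun n s =>
    (((hg n s).pow_const 2).stronglyMeasurable.integral_prod_right (ν := P)).measurable
  have hVm : ∀ n, Measurable (V n) := fun n => measurable_from_prod_countable_right (hVs n)
  have hWs : ∀ n s, Measurable fun d => W n (s, d) := fun n s => by
    refine measurable_const.mul (Finset.measurable_fun_sum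
      (f := fun i d => g n s d (d i) - ∫ x, g n s d x ∂P)
      (Finset.univ.filter fun i => s i = k) fun i _ => Measurable.sub ?_ ?_)
    · exact (hg n s).comp (measurable_id.prodMk (measurable_pi_apply i))
    · exact ((hg n s).stronglyMeasurable.integral_prod_right (ν := P)).measurable
  have hWm : ∀ n, Measurable (W n) := fun n => measurable_from_prod_countable_right (hWs n)
  have hV0 : ∀ n p, 0 ≤ V n p := fun n p => integral_nonneg fun x => sq_nonneg _
  have hVC : ∀ n p, V n p ≤ C ^ 2 := fun n p => by
    have := norm_integral_le_of_norm_le_const (μ := P) (f := fun x => g n p.1 p.2 x ^ 2)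
      (C := C ^ 2) (ae_of_all _ fun x => hC0 n p.1 p.2 x)
    rw [probReal_univ, mul_one] at this
    exact (le_abs_self _).trans this
  have hGC : ∀ n (p : (Fin n → Fin K) × (Fin n → X)), |∫ x, g n p.1 p.2 x ∂P| ≤ C := fun n p => by
    have := norm_integral_le_of_norm_le_const (μ := P) (f := fun x => g n p.1 p.2 x)
      (C := C) (ae_of_all _ fun x => hC n p.1 p.2 x)
    simpa using this
  have hWC : ∀ n p, |W n p| ≤ (√(n : ℝ))⁻¹ * (n * (2 * C)) := fun n p => by
    rw [hW]
    simp only [abs_mul, abs_of_nonneg (inv_nonneg.2 (Real.sqrt_nonneg (n : ℝ)))]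
    refine mul_le_mul_of_nonneg_left ?_ (inv_nonneg.2 (Real.sqrt_nonneg _))
    rcases n.eq_zero_or_pos with rfl | hn
    · simp
    have hCnn : 0 ≤ C := by
      obtain ⟨x⟩ := nonempty_of_isProbabilityMeasure P
      exact (abs_nonneg _).trans (hC n p.1 p.2 x)
    refine (Finset.abs_sum_le_sum_abs _ _).trans ((Finset.sum_le_card_nsmul _ _ (2 * C)
      fun i _ => ?_).trans ?_)
    · have h1 := hC n p.1 p.2 (p.2 i)
      have h2 := hGC n p
      exact (abs_sub _ _).trans (by linarith)
    · rw [nsmul_eq_mul]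
      refine mul_le_mul_of_nonneg_right ?_ (by positivity)
      exact_mod_cast (Finset.card_filter_le _ _).trans (by simp)
  -- given the fold labels, the second moment is controlled by that of the fitted function
  have hsecond : ∀ n, ∫ ω, W n (split n ω, data n ω) ^ 2 ∂μ ≤
      ∫ ω, V n (split n ω, data n ω) ∂μ := fun n => by
    have hpair : Measurable fun ω => (split n ω, data n ω) := (hsplit n).prodMk (hdatam n)
    have hlaw := map_split_data (hsplit n) hO hO_indep hO_law (hindep n)
    have := Measure.isProbabilityMeasure_map (μ := μ) (hsplit n).aemeasurable
    have hWI : Integrable (fun p => W n p ^ 2)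
        ((μ.map (split n)).prod (Measure.pi fun _ : Fin n => P)) := by
      refine Integrable.of_bound ((hWm n).pow_const 2).aestronglyMeasurable
        (((√(n : ℝ))⁻¹ * (n * (2 * C))) ^ 2) (ae_of_all _ fun p => ?_)
      rw [Real.norm_eq_abs, abs_pow]
      exact pow_le_pow_left₀ (abs_nonneg _) (hWC n p) 2
    have hVI : Integrable (V n) ((μ.map (split n)).prod (Measure.pi fun _ : Fin n => P)) :=
      Integrable.of_bound (hVm n).aestronglyMeasurable (C ^ 2) (ae_of_all _ fun p => by
        rw [Real.norm_of_nonneg (hV0 n p)]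
        exact hVC n p)
    rw [← integral_map (f := fun p => W n p ^ 2) hpair.aemeasurable
      ((hWm n).pow_const 2).aestronglyMeasurable,
      ← integral_map (f := V n) hpair.aemeasurable (hVm n).aestronglyMeasurable, hdata, hlaw,
      integral_prod _ hWI, integral_prod _ hVI]
    refine integral_mono hWI.integral_prod_left hVI.integral_prod_left fun s => ?_
    have hmain := integral_sq_sum_le (P := P) (hg n s) (hC n s)
      (Finset.univ.filter fun i => s i = k) fun i hi d x => hleave n s _ _ fun l hl => by
        rw [Function.update_of_ne]
        rintro rfl
        exact hl (Finset.mem_filter.1 hi).2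
    simp only [hW, mul_pow, integral_const_mul]
    rw [inv_pow, Real.sq_sqrt (Nat.cast_nonneg n)]
    rcases n.eq_zero_or_pos with rfl | hn
    · simp only [Nat.cast_zero, inv_zero, zero_mul]
      exact integral_nonneg fun d => hV0 0 _
    have hn' : (0 : ℝ) < n := Nat.cast_pos.2 hn
    rw [inv_mul_le_iff₀ hn']
    refine hmain.trans (mul_le_mul_of_nonneg_right ?_ (integral_nonneg fun d => hV0 n (s, d)))
    exact_mod_cast (Finset.card_filter_le _ _).trans (by simp)
  have hVsmall : SmallInMeasure μ fun n ω => ‖V n (split n ω, data n ω)‖ₑ := by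
    intro ε hε
    refine (hsmall ε hε).congr fun n => ?_
    congr 1
    ext ω
    simp only [mem_ofPred_eq]
    rw [Real.enorm_of_nonneg (hV0 n _), hV, ofReal_integral_eq_lintegral_ofReal]
    · refine iff_of_eq (congrArg _ (lintegral_congr fun x => ?_))
      rw [← Real.enorm_of_nonneg (sq_nonneg _), enorm_pow]
    · exact Integrable.of_bound (((hg n _).comp measurable_prodMk_left).pow_const
        2).aestronglyMeasurable (C ^ 2) (ae_of_all _ fun x => hC0 _ _ _ _)
    · exact ae_of_all _ fun x => sq_nonneg _
  have hEV := hVsmall.tendsto_integral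
    (fun n => (hVm n).comp ((hsplit n).prodMk (hdatam n))) (fun n ω => hV0 n _) fun n ω => hVC n _
  have hEW : Tendsto (fun n => ∫ ω, W n (split n ω, data n ω) ^ 2 ∂μ) atTop (𝓝 0) :=
    tendsto_of_tendsto_of_tendsto_of_le_of_le tendsto_const_nhds hEV
      (fun n => integral_nonneg fun ω => sq_nonneg _) hsecond
  -- Chebyshev's inequality
  rw [tendstoInMeasure_iff_norm]
  intro ε hε
  have hlim : Tendsto (fun n => ENNReal.ofReal ((∫ ω, W n (split n ω, data n ω) ^ 2 ∂μ) / ε ^ 2))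
      atTop (𝓝 0) := by
    have := ENNReal.tendsto_ofReal (hEW.div_const (ε ^ 2))
    simpa using this
  refine tendsto_of_tendsto_of_tendsto_of_le_of_le tendsto_const_nhds hlim
    (fun _ => zero_le) fun n => ?_
  have hint : Integrable (fun ω => W n (split n ω, data n ω) ^ 2) μ := by
    refine Integrable.of_bound (((hWm n).comp
      ((hsplit n).prodMk (hdatam n))).pow_const 2).aestronglyMeasurable
        (((√(n : ℝ))⁻¹ * (n * (2 * C))) ^ 2) (ae_of_all _ fun ω => ?_)
    rw [Real.norm_eq_abs, abs_pow]
    exact pow_le_pow_left₀ (abs_nonneg _) (hWC n _) 2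
  have hcheb := mul_meas_ge_le_integral_of_nonneg (ae_of_all μ fun ω => sq_nonneg
    (W n (split n ω, data n ω))) hint (ε ^ 2)
  rw [← le_div_iff₀' (by positivity)] at hcheb
  refine le_trans ?_ (ENNReal.ofReal_le_ofReal hcheb)
  rw [measureReal_def, ENNReal.ofReal_toReal (measure_ne_top _ _)]
  refine measure_mono fun ω hω => ?_
  have hω' : ε ≤ |W n (split n ω, data n ω)| := by simpa [hW] using hω
  rw [mem_ofPred_eq, ← sq_abs (W n _)]
  exact pow_le_pow_left₀ hε.le hω' 2

end CrossFit

/-! ### Mean square consistency of the estimated influence function -/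

/-- Distribution functions are right-continuous, hence controlled by their values at rationals. -/
theorem exists_seq_rat_tendsto_measureReal_Iic (s : ℝ) : ∃ q : ℕ → ℚ,
    ∀ (ρ : Measure ℝ) [IsFiniteMeasure ρ],
      Tendsto (fun n => ρ.real (Iic (q n : ℝ))) atTop (𝓝 (ρ.real (Iic s))) := by
  obtain ⟨u, hu, hus, hlim⟩ := Dense.exists_seq_strictAnti_tendsto
    (s := range ((↑) : ℚ → ℝ)) Rat.denseRange_cast s
  choose q hq using fun n => (hus n).2
  refine ⟨q, fun ρ _ => ?_⟩
  simp only [hq]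
  have hU : ⋂ n, Iic (u n) = Iic s := by
    ext x
    simp only [mem_iInter, mem_Iic]
    exact ⟨fun h => ge_of_tendsto' hlim h, fun hx n => hx.trans (le_of_lt (hus n).1)⟩
  have ht : Tendsto (ρ ∘ fun n => Iic (u n)) atTop (𝓝 (ρ (⋂ n, Iic (u n)))) :=
    tendsto_measure_iInter_atTop (fun n => measurableSet_Iic.nullMeasurableSet)
      (fun m n h => Iic_subset_Iic.2 (hu.antitone h)) ⟨0, measure_ne_top _ _⟩
  rw [hU] at ht
  exact (ENNReal.tendsto_toReal (measure_ne_top ρ _)).comp ht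

namespace Nuisance

section

variable {𝒳 : Type*} {ν ν' : Nuisance 𝒳} {η T : ℝ}

/-- The uniform distance of two cumulative hazards. The supremum is over the rational times, to be
measurable in the covariates. -/
def hazDist (ν ν' : Nuisance 𝒳) (δ : Fin 3) (a : Fin 2) (x : 𝒳) : ℝ≥0∞ :=
  ⨆ q : ℚ, ‖(ν'.haz δ a x).real (Iic (q : ℝ)) - (ν.haz δ a x).real (Iic (q : ℝ))‖ₑ

theorem Regular.hazDist_le (hν : ν.Regular η T) (hν' : ν'.Regular η T) (δ : Fin 3) (a : Fin 2)
    (x : 𝒳) :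
    ν.hazDist ν' δ a x ≤ ⨆ s ∈ Icc 0 T, ‖ν'.cumHaz δ s a x - ν.cumHaz δ s a x‖ₑ := by
  have hT := hν.time_pos.le
  refine iSup_le fun q => ?_
  have key : ∀ {ρ : Nuisance 𝒳}, ρ.Regular η T →
      (ρ.haz δ a x).real (Iic (q : ℝ)) = ρ.cumHaz δ (max 0 (min q T)) a x := fun {ρ} hρ => by
    rw [hρ.cumHaz_eq, measureReal_def, measureReal_def]
    congr 1
    refine measure_congr ?_
    filter_upwards [hρ.ae_mem δ a x] with s hs
    refine propext ⟨fun h => ?_, fun h => ?_⟩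
    · exact mem_Iic.2 (le_max_of_le_right (le_min h hs.2))
    · rcases le_max_iff.1 (show s ≤ max 0 (min (q : ℝ) T) from h) with h | h
      · exact absurd hs.1 (not_lt.2 h)
      · exact mem_Iic.2 (h.trans (min_le_left _ _))
  rw [key hν, key hν']
  exact le_iSup₂ (f := fun s (_ : s ∈ Icc 0 T) => ‖ν'.cumHaz δ s a x - ν.cumHaz δ s a x‖ₑ)
    (max 0 (min (q : ℝ) T)) ⟨le_max_left _ _, max_le hT (min_le_right _ _)⟩

theorem Regular.hazDist_ne_top (hν : ν.Regular η T) (hν' : ν'.Regular η T) (δ : Fin 3) (a : Fin 2)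
    (x : 𝒳) : ν.hazDist ν' δ a x ≠ ∞ := by
  refine ne_top_of_le_ne_top (ENNReal.ofReal_ne_top (r := 1 / η)) (iSup_le fun q => ?_)
  have := hν.finite δ a x
  have := hν'.finite δ a x
  rw [Real.enorm_eq_ofReal_abs]
  refine ENNReal.ofReal_le_ofReal (abs_sub_le_iff.2 ⟨?_, ?_⟩)
  · have := (measureReal_mono (μ := ν'.haz δ a x) (subset_univ (Iic (q : ℝ)))).trans
      (hν'.haz_le δ a x)
    linarith [measureReal_nonneg (μ := ν.haz δ a x) (s := Iic (q : ℝ))]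
  · have := (measureReal_mono (μ := ν.haz δ a x) (subset_univ (Iic (q : ℝ)))).trans
      (hν.haz_le δ a x)
    linarith [measureReal_nonneg (μ := ν'.haz δ a x) (s := Iic (q : ℝ))]

theorem Regular.abs_cumHaz_sub_le_hazDist (hν : ν.Regular η T) (hν' : ν'.Regular η T) (δ : Fin 3)
    (s : ℝ) (a : Fin 2) (x : 𝒳) :
    |ν'.cumHaz δ s a x - ν.cumHaz δ s a x| ≤ (ν.hazDist ν' δ a x).toReal := by
  have := hν.finite δ a x
  have := hν'.finite δ a x
  rw [hν.cumHaz_eq, hν'.cumHaz_eq]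
  obtain ⟨q, hq⟩ := exists_seq_rat_tendsto_measureReal_Iic s
  refine le_of_tendsto ((hq (ν'.haz δ a x)).sub (hq (ν.haz δ a x))).abs
    (Eventually.of_forall fun n => ?_)
  rw [← Real.norm_eq_abs, ← toReal_enorm]
  exact ENNReal.toReal_mono (hν.hazDist_ne_top hν' δ a x) (le_iSup (fun q : ℚ =>
    ‖(ν'.haz δ a x).real (Iic (q : ℝ)) - (ν.haz δ a x).real (Iic (q : ℝ))‖ₑ) (q n))

/-- The errors of the estimated cumulative hazards and propensity scores at given covariates. -/
def nuisanceError (ν ν' : Nuisance 𝒳) (x : 𝒳) : (Fin 3 × Fin 2) ⊕ Fin 2 → ℝ≥0∞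
  | .inl p => ν.hazDist ν' p.1 p.2 x
  | .inr a => ‖ν'.ps a x - ν.ps a x‖ₑ

theorem le_sum_prod {ι κ : Type*} [Fintype ι] [Fintype κ] (F : ι → κ → ℝ≥0∞) (i : ι) (l : κ) :
    F i l ≤ ∑ p : ι × κ, F p.1 p.2 :=
  Finset.single_le_sum (f := fun p : ι × κ => F p.1 p.2) (fun _ _ => zero_le)
    (Finset.mem_univ (i, l))

theorem Regular.exists_enorm_phi_sub_le (η T : ℝ) : ∃ C : ℝ≥0∞, C ≠ ∞ ∧
    ∀ {ν ν' : Nuisance 𝒳}, ν.Regular η T → ν'.Regular η T →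
      (∀ δ a x, NullSingletonClass (ν.haz δ a x)) → ∀ (j : Fin 2) (o : Obs 𝒳),
        ‖ν'.phi j T o - ν.phi j T o‖ₑ ≤ C * ∑ i, ν.nuisanceError ν' o.cov i := by
  obtain ⟨C, hC0, hC⟩ := Regular.exists_abs_phi_sub_le (𝒳 := 𝒳) η T
  refine ⟨ENNReal.ofReal C, ENNReal.ofReal_ne_top, fun {ν ν'} hν hν' hcont j o => ?_⟩
  have hfin := fun i => hν.hazDist_ne_top hν' (i : Fin 3 × Fin 2).1 i.2 o.cov
  have hclose : ∀ a, ν.CloseAt ν' T a o.cov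
      (∑ i : Fin 3 × Fin 2, ν.hazDist ν' i.1 i.2 o.cov).toReal := fun a δ s _ =>
    (hν.abs_cumHaz_sub_le_hazDist hν' δ s a o.cov).trans (ENNReal.toReal_mono
      (ENNReal.sum_ne_top.2 fun i _ => hfin i)
      (le_sum_prod (fun δ a => ν.hazDist ν' δ a o.cov) δ a))
  rw [Real.enorm_eq_ofReal_abs]
  refine (ENNReal.ofReal_le_ofReal (hC hν hν' hcont hclose j)).trans ?_
  rw [ENNReal.ofReal_mul hC0, Fintype.sum_sum_type]
  refine mul_le_mul_right ?_ _
  rw [ENNReal.ofReal_add ENNReal.toReal_nonneg (abs_nonneg _),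
    ENNReal.ofReal_toReal (ENNReal.sum_ne_top.2 fun i _ => hfin i), ← Real.enorm_eq_ofReal_abs]
  exact add_le_add le_rfl (Finset.single_le_sum
    (f := fun a => ‖ν'.ps a o.cov - ν.ps a o.cov‖ₑ) (fun _ _ => zero_le) (Finset.mem_univ _))

end

section

variable {𝒳 : Type*} [MeasurableSpace 𝒳]

theorem measurable_nuisanceError {ν ν' : Nuisance 𝒳} (hm : ν.IsMeasurable)
    (hm' : ν'.IsMeasurable) :
    ∀ i, Measurable fun x => ν.nuisanceError ν' x i
  | .inl p => by
    refine Measurable.iSup fun q => Measurable.enorm (Measurable.sub ?_ ?_)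
    · exact ((Measure.measurable_coe measurableSet_Iic).comp (hm'.haz p.1 p.2)).ennreal_toReal
    · exact ((Measure.measurable_coe measurableSet_Iic).comp (hm.haz p.1 p.2)).ennreal_toReal
  | .inr a => ((hm'.ps a).sub (hm.ps a)).enorm

/-- The mean square errors that the consistency assumption requires to vanish: of the cumulative
hazards, uniformly in time, and of the propensity scores. The supremum over time need not be
measurable; it dominates `hazDist`, which is. -/
def meanSquareError (P : Measure (Obs 𝒳)) (T : ℝ) (ν ν' : Nuisance 𝒳) :
    (Fin 3 × Fin 2) ⊕ Fin 2 → ℝ≥0∞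
  | .inl p => ∫⁻ o, (⨆ s ∈ Icc 0 T, ‖ν'.cumHaz p.1 s p.2 o.cov - ν.cumHaz p.1 s p.2 o.cov‖ₑ) ^ 2 ∂P
  | .inr a => ∫⁻ o, ‖ν'.ps a o.cov - ν.ps a o.cov‖ₑ ^ 2 ∂P

/-- The influence function is Lipschitz in mean square in the nuisance parameter. -/
theorem exists_lintegral_phi_sub_le (P : Measure (Obs 𝒳)) (η T : ℝ) : ∃ C : ℝ≥0∞, C ≠ ∞ ∧
    ∀ {ν ν' : Nuisance 𝒳}, ν.IsMeasurable → ν.Regular η T → ν'.IsMeasurable → ν'.Regular η T →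
      (∀ δ a x, NullSingletonClass (ν.haz δ a x)) → ∀ j : Fin 2,
        ∫⁻ o, ‖ν'.phi j T o - ν.phi j T o‖ₑ ^ 2 ∂P ≤ C * ∑ i, meanSquareError P T ν ν' i := by
  obtain ⟨C, hCtop, hC⟩ := Regular.exists_enorm_phi_sub_le (𝒳 := 𝒳) η T
  refine ⟨C ^ 2 * 8, ENNReal.mul_ne_top (ENNReal.pow_ne_top hCtop) (by norm_num),
    fun {ν ν'} hm hν hm' hν' hcont j => ?_⟩
  have hpt : ∀ o : Obs 𝒳, ‖ν'.phi j T o - ν.phi j T o‖ₑ ^ 2 ≤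
      C ^ 2 * 8 * ∑ i, ν.nuisanceError ν' o.cov i ^ 2 := fun o => by
    refine (pow_le_pow_left₀ zero_le (hC hν hν' hcont j o) 2).trans ?_
    rw [mul_pow, mul_assoc]
    gcongr
    have := ENNReal.rpow_sum_le_const_mul_sum_rpow Finset.univ (fun i => ν.nuisanceError ν' o.cov i)
      (p := 2) (by norm_num)
    norm_num at this
    simpa using this
  refine (lintegral_mono hpt).trans ?_
  have hme : ∀ i, Measurable fun o : Obs 𝒳 => ν.nuisanceError ν' o.cov i := fun i =>
    (measurable_nuisanceError hm hm' i).comp Obs.measurable_cov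
  rw [lintegral_const_mul _ (Finset.measurable_fun_sum _ fun i _ => (hme i).pow_const 2),
    lintegral_finsetSum _ fun i _ => (hme i).pow_const 2]
  gcongr with i
  match i with
  | .inl p => exact lintegral_mono fun o =>
      pow_le_pow_left₀ zero_le (hν.hazDist_le hν' p.1 p.2 o.cov) 2
  | .inr a => exact le_rfl

end

end Nuisance

/-! ### Asymptotic linearity for regular learners -/

namespace Learner

variable {𝒳 : Type*} {K : ℕ}

/-- The estimates of a learner, as one nuisance parameter whose covariates include the data. Joint
measurability in data and covariates then is `Nuisance.IsMeasurable`. -/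
def joint (alg : Learner 𝒳 K) (n : ℕ) (k : Fin K) (s : Fin n → Fin K) :
    Nuisance ((Fin n → Obs 𝒳) × 𝒳) where
  haz δ a p := (alg n k s p.1).haz δ a p.2
  ps a p := (alg n k s p.1).ps a p.2

theorem joint_regular {alg : Learner 𝒳 K} {η T : ℝ} {n : ℕ} {k : Fin K} {s : Fin n → Fin K}
    (hη : 0 < η) (hT : 0 < T) (h : ∀ d, (alg n k s d).Regular η T) :
    (alg.joint n k s).Regular η T where
  eta_pos := hη
  time_pos := hT
  support δ a p := (h p.1).support δ a p.2
  finite δ a p := (h p.1).finite δ a p.2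
  positive t ht a p := (h p.1).positive t ht a p.2

variable [MeasurableSpace 𝒳]

theorem measurable_phi {alg : Learner 𝒳 K} {η T : ℝ} {n : ℕ} {k : Fin K} {s : Fin n → Fin K}
    (hη : 0 < η) (hT : 0 < T) (h : ∀ d, (alg n k s d).Regular η T)
    (hm : (alg.joint n k s).IsMeasurable) (j : Fin 2) :
    Measurable fun p : (Fin n → Obs 𝒳) × Obs 𝒳 => (alg n k s p.1).phi j T p.2 := by
  have h1 := hm.phi (joint_regular hη hT h) j
  have hperm : Measurable fun p : (Fin n → Obs 𝒳) × Obs 𝒳 =>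
      ((p.2.1, p.2.2.1, p.2.2.2.1, (p.1, p.2.2.2.2)) : Obs ((Fin n → Obs 𝒳) × 𝒳)) := by
    fun_prop
  exact h1.comp hperm

theorem isMeasurable_of_joint {alg : Learner 𝒳 K} {n : ℕ} {k : Fin K} {s : Fin n → Fin K}
    (hm : (alg.joint n k s).IsMeasurable) (d : Fin n → Obs 𝒳) : (alg n k s d).IsMeasurable where
  haz δ a := (hm.haz δ a).comp measurable_prodMk_left
  ps a := (hm.ps a).comp measurable_prodMk_left

end Learner

section

variable {𝒳 : Type*} [MeasurableSpace 𝒳]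

/-- The centered, scaled cross-fitted estimator splits into empirical process terms and biases. -/
theorem sqrt_mul_crossFit_sub {P : Measure (Obs 𝒳)} {ν : Nuisance 𝒳} {T : ℝ} {K : ℕ}
    (alg : Learner 𝒳 K) (j : Fin 2) {n : ℕ} (s : Fin n → Fin K) (d : Fin n → Obs 𝒳)
    (G : Fin K → ℝ) :
    √(n : ℝ) * (crossFit alg j T n s d - psi P ν j T - (1 / (n : ℝ)) *
        ∑ i : Fin n, psiTilde P ν j T (d i)) =
      ∑ k : Fin K, ((√(n : ℝ))⁻¹ * (∑ i : Fin n with s i = k,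
          (((alg n k s d).phi j T (d i) - ν.phi j T (d i)) - G k)) +
        ((Finset.univ.filter fun i => s i = k).card / n : ℝ) * (√(n : ℝ) * G k)) := by
  rcases n.eq_zero_or_pos with rfl | hn
  · simp
  have hn' : (0 : ℝ) < n := Nat.cast_pos.2 hn
  have hsq : (√(n : ℝ))⁻¹ = √(n : ℝ) * (1 / n) := by
    rw [mul_one_div, Real.sqrt_div_self', one_div]
  have h1 : ∑ i : Fin n, psiTilde P ν j T (d i) =
      ∑ k : Fin K, ∑ i : Fin n with s i = k, ν.phi j T (d i) - n * psi P ν j T := by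
    rw [Finset.sum_fiberwise]
    simp [psiTilde, Finset.sum_sub_distrib]
  simp only [crossFit, h1, hsq, Finset.sum_add_distrib, Finset.sum_sub_distrib, Finset.sum_const,
    nsmul_eq_mul]
  rw [← Finset.mul_sum, Finset.sum_sub_distrib, Finset.sum_sub_distrib]
  have h2 : ∑ k : Fin K, ((Finset.univ.filter fun i => s i = k).card / n : ℝ) * (√(n : ℝ) * G k) =
      √(n : ℝ) * (1 / n) * ∑ k : Fin K, (Finset.univ.filter fun i => s i = k).card * G k := by
    rw [Finset.mul_sum]
    exact Finset.sum_congr rfl fun k _ => by ring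
  rw [h2]
  field_simp
  ring

variable {Ω : Type*} [MeasurableSpace Ω] {μ : Measure Ω} [IsProbabilityMeasure μ]

/-- Asymptotic linearity of the cross-fitted estimator when every single estimate is regular. -/
theorem Learner.tendstoInMeasure_crossFit {P : Measure (Obs 𝒳)} [IsProbabilityMeasure P]
    {ν : Nuisance 𝒳} {η T : ℝ} (hP : ν.IsModel P T) (hν : ν.Regular η T)
    {O : ℕ → Ω → Obs 𝒳} (hO : ∀ i, Measurable (O i)) (hO_indep : iIndepFun O μ)
    (hO_law : ∀ i, μ.map (O i) = P) {K : ℕ}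
    {split : (n : ℕ) → Ω → (Fin n → Fin K)} (hsplit : ∀ n, Measurable (split n))
    (hindep : ∀ n, IndepFun (split n) (fun ω (i : Fin n) => O i ω) μ)
    {alg : Learner 𝒳 K} (hreg : ∀ n k s d, (alg n k s d).Regular η T)
    (hmeas : ∀ n k s, (alg.joint n k s).IsMeasurable)
    (hleave : ∀ n k s d d', (∀ i, s i ≠ k → d i = d' i) → alg n k s d = alg n k s d') (j : Fin 2)
    (hsmall : ∀ k i, SmallInMeasure μ fun n ω =>
      Nuisance.meanSquareError P T ν (alg n k (split n ω) fun i => O i ω) i)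
    (hrem : ∀ k a, TendstoInMeasure μ (fun (n : ℕ) ω =>
      √(n : ℝ) * remainder P ν (alg n k (split n ω) fun i => O i ω) j T a) atTop fun _ => 0) :
    TendstoInMeasure μ (fun (n : ℕ) ω => √(n : ℝ) *
      (crossFit alg j T n (split n ω) (fun i => O i ω) - psi P ν j T -
        (1 / (n : ℝ)) * ∑ i : Fin n, psiTilde P ν j T (O i ω))) atTop fun _ => 0 := by
  have hη := hν.eta_pos
  have hT := hν.time_pos
  have hνm := hP.toIsMeasurable
  obtain ⟨C, hC⟩ := Nuisance.Regular.exists_abs_phi_le (𝒳 := 𝒳) η T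
  obtain ⟨L, hLtop, hL⟩ := Nuisance.exists_lintegral_phi_sub_le P η T
  have hphi : Measurable (ν.phi j T) := hνm.phi hν j
  have hint : ∀ {ρ : Nuisance 𝒳}, ρ.IsMeasurable → ρ.Regular η T → Integrable (ρ.phi j T) P :=
    fun hρm hρ => Integrable.of_bound (hρm.phi hρ j).aestronglyMeasurable C
      (ae_of_all _ fun o => hC hρ j o)
  set g : (k : Fin K) → (n : ℕ) → (Fin n → Fin K) → (Fin n → Obs 𝒳) → Obs 𝒳 → ℝ :=
    fun k n s d o => (alg n k s d).phi j T o - ν.phi j T o with hg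
  have hmean : ∀ k n s d, ∫ o, g k n s d o ∂P =
      remainder P ν (alg n k s d) j T 1 - remainder P ν (alg n k s d) j T 0 := fun k n s d => by
    have hm := Learner.isMeasurable_of_joint (hmeas n k s) d
    rw [hg, integral_sub (hint hm (hreg n k s d)) (hint hνm hν), hP.integral_phi hν j,
      hP.integral_phi_sub_psi hν hm (hreg n k s d) j]
  have hemp : ∀ k, SmallInMeasure μ fun n ω => ‖(√(n : ℝ))⁻¹ *
      ∑ i : Fin n with split n ω i = k, (g k n (split n ω) (fun i => O i ω) (O i ω) -
        ∫ x, g k n (split n ω) (fun i => O i ω) x ∂P)‖ₑ := fun k =>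
    TendstoInMeasure.small_enorm <| LifeYearsLost.tendstoInMeasure_crossFit hO hO_indep hO_law
      hsplit hindep k
      (fun n s => (Learner.measurable_phi hη hT (hreg n k s) (hmeas n k s) j).sub
        (hphi.comp measurable_snd))
      (C := C + C) (fun n s d x => (abs_sub _ _).trans
        (add_le_add (hC (hreg n k s d) j x) (hC hν j x)))
      (fun n s d d' h => by simp only [hg, hleave n k s d d' h])
      (SmallInMeasure.of_le_sum (hsmall k) hLtop fun n => ae_of_all _ fun ω =>
        hL hνm hν (Learner.isMeasurable_of_joint (hmeas n k _) _) (hreg n k _ _) hP.noAtoms j)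
  refine SmallInMeasure.tendstoInMeasure (SmallInMeasure.of_le_sum (ι := Fin K ⊕ (Fin K × Fin 2))
    (u := Sum.elim (fun k n ω => ‖(√(n : ℝ))⁻¹ *
      ∑ i : Fin n with split n ω i = k, (g k n (split n ω) (fun i => O i ω) (O i ω) -
        ∫ x, g k n (split n ω) (fun i => O i ω) x ∂P)‖ₑ)
      fun p n ω => ‖√(n : ℝ) * remainder P ν (alg n p.1 (split n ω) fun i => O i ω) j T p.2‖ₑ)
    ?_ ENNReal.one_ne_top fun n => ae_of_all _ fun ω => ?_)
  · rintro (k | p)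
    · exact hemp k
    · exact TendstoInMeasure.small_enorm (hrem p.1 p.2)
  · rw [sqrt_mul_crossFit_sub alg j (split n ω) (fun i : Fin n => O i ω) fun k =>
      ∫ x, g k n (split n ω) (fun i => O i ω) x ∂P, one_mul, Fintype.sum_sum_type,
      Fintype.sum_prod_type, ← Finset.sum_add_distrib]
    refine (enorm_sum_le _ _).trans (Finset.sum_le_sum fun k _ => ?_)
    refine (enorm_add_le _ _).trans (add_le_add le_rfl ?_)
    rw [hmean, Fin.sum_univ_two, mul_sub, add_comm]
    simp only [Sum.elim_inr]
    refine le_trans ?_ (enorm_sub_le (E := ℝ))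
    rw [enorm_mul]
    refine mul_le_of_le_one_left zero_le ?_
    rw [Real.enorm_of_nonneg (by positivity), ENNReal.ofReal_le_one]
    refine div_le_one_of_le₀ ?_ (Nat.cast_nonneg n)
    exact_mod_cast (Finset.card_filter_le _ _).trans (by simp)

end

/-! ### Restriction to the time horizon and regularization -/

theorem prodIntegral_restrict {μ : Measure ℝ} {A B : Set ℝ} (hB : MeasurableSet B) (h : B ⊆ A) :
    prodIntegral (μ.restrict A) B = prodIntegral μ B := by
  have h1 : ∀ s : B, (μ.restrict A).real {(s : ℝ)} = μ.real {(s : ℝ)} := fun s => by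
    rw [measureReal_restrict_apply (measurableSet_singleton _),
      inter_eq_left.2 (singleton_subset_iff.2 (h s.2))]
  simp only [prodIntegral, h1]
  rw [measureReal_restrict_apply hB, inter_eq_left.2 h]

namespace Nuisance

section

variable {𝒳 : Type*}

/-- The nuisance parameter whose hazard measures are cut off outside `(0, T]`. All quantities of the
theorem involve the hazards on `(0, T]` only, so that they are unchanged. -/
def trim (ν : Nuisance 𝒳) (T : ℝ) : Nuisance 𝒳 where
  haz δ a x := (ν.haz δ a x).restrict (Ioc 0 T)
  ps := ν.ps

variable (ν : Nuisance 𝒳) {η T : ℝ}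

theorem trim_allCause (a : Fin 2) (x : 𝒳) :
    (ν.trim T).allCause a x = (ν.allCause a x).restrict (Ioc 0 T) :=
  (Measure.restrict_add _ _ _).symm

theorem trim_surv {t : ℝ} (ht : t ≤ T) (a : Fin 2) (x : 𝒳) :
    (ν.trim T).surv t a x = ν.surv t a x := by
  rw [surv, trim_allCause, prodIntegral_restrict measurableSet_Ioc (Ioc_subset_Ioc_right ht), surv]

theorem trim_survLeft {t : ℝ} (ht : t ≤ T) (a : Fin 2) (x : 𝒳) :
    (ν.trim T).survLeft t a x = ν.survLeft t a x := by
  rw [survLeft, trim_allCause, prodIntegral_restrict measurableSet_Ioo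
    (Ioo_subset_Ioc_self.trans (Ioc_subset_Ioc_right ht)), survLeft]

theorem trim_censSurv {t : ℝ} (ht : t ≤ T) (a : Fin 2) (x : 𝒳) :
    (ν.trim T).censSurv t a x = ν.censSurv t a x :=
  prodIntegral_restrict measurableSet_Ioc (Ioc_subset_Ioc_right ht)

theorem trim_restrict {t : ℝ} (ht : t ≤ T) (δ : Fin 3) (a : Fin 2) (x : 𝒳) :
    ((ν.trim T).haz δ a x).restrict (Ioc 0 t) = (ν.haz δ a x).restrict (Ioc 0 t) := by
  rw [trim, Measure.restrict_restrict measurableSet_Ioc,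
    inter_eq_left.2 (Ioc_subset_Ioc_right ht)]

theorem trim_cumHaz {t : ℝ} (ht : t ≤ T) (δ : Fin 3) (a : Fin 2) (x : 𝒳) :
    (ν.trim T).cumHaz δ t a x = ν.cumHaz δ t a x := by
  rw [cumHaz, trim, measureReal_restrict_apply measurableSet_Ioc,
    inter_eq_left.2 (Ioc_subset_Ioc_right ht), cumHaz]

theorem trim_cif {t : ℝ} (ht : t ≤ T) (j a : Fin 2) (x : 𝒳) :
    (ν.trim T).cif j t a x = ν.cif j t a x := by
  rw [cif, cif, trim_restrict ν ht]
  exact setIntegral_congr_fun measurableSet_Ioc fun s hs =>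
    ν.trim_survLeft (hs.2.trans ht) a x

theorem trim_lifeYearsLost (hT : 0 ≤ T) (j a : Fin 2) (x : 𝒳) :
    (ν.trim T).lifeYearsLost j T a x = ν.lifeYearsLost j T a x := by
  refine intervalIntegral.integral_congr fun u hu => ?_
  rw [uIcc_of_le hT] at hu
  exact ν.trim_cif hu.2 j a x

theorem trim_cate (hT : 0 ≤ T) (j : Fin 2) (x : 𝒳) :
    (ν.trim T).cate j T x = ν.cate j T x := by
  rw [cate, cate, trim_lifeYearsLost ν hT, trim_lifeYearsLost ν hT]

theorem trim_H {s : ℝ} (hs : s ≤ T) (i j a : Fin 2) (x : 𝒳) :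
    (ν.trim T).H i j s T a x = ν.H i j s T a x := by
  refine intervalIntegral.integral_congr fun u hu => ?_
  rw [uIcc_of_le hs] at hu
  simp only [trim_cif ν hs, trim_cif ν hu.2, trim_surv ν hs]

theorem trim_phi (hT : 0 ≤ T) (j : Fin 2) (o : Obs 𝒳) :
    (ν.trim T).phi j T o = ν.phi j T o := by
  have h : ∀ i, (ν.trim T).martingaleIntegral i (fun s =>
      (ν.trim T).H i j s T o.arm o.cov / (ν.trim T).censSurv s o.arm o.cov) T o =
      ν.martingaleIntegral i (fun s => ν.H i j s T o.arm o.cov / ν.censSurv s o.arm o.cov) T o := by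
    intro i
    rw [martingaleIntegral, martingaleIntegral, trim_restrict ν (min_le_left _ _)]
    congr 1
    · split_ifs with ho
      · rw [trim_H ν ho.2.2, trim_censSurv ν ho.2.2]
      · rfl
    · refine setIntegral_congr_fun measurableSet_Ioc fun s hs => ?_
      have hsT : s ≤ T := hs.2.trans (min_le_left _ _)
      simp only [trim_H ν hsT, trim_censSurv ν hsT]
  simp only [phi, trim_cate ν hT, h]
  rfl

/-- The survival functions and the propensity scores at the covariates `x` exceed `η`. -/
def PositiveAt (η T : ℝ) (x : 𝒳) : Prop :=
  ∀ t ∈ Icc 0 T, ∀ a, η < ν.surv t a x ∧ η < ν.censSurv t a x ∧ η < ν.ps a x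

open Classical in
/-- The nuisance parameter cut off at the time horizon, and with a trivial value (no hazard,
propensity score `1` for both arms) at the covariates where positivity fails. The result is regular
for every realization of the data, whereas an estimate satisfies positivity only almost surely. -/
def regularize (η T : ℝ) : Nuisance 𝒳 where
  haz δ a x := if ν.PositiveAt η T x then (ν.haz δ a x).restrict (Ioc 0 T) else 0
  ps a x := if ν.PositiveAt η T x then ν.ps a x else 1

variable {ν}

theorem regularize_eq_trim (h : ν.Positive η T) : ν.regularize η T = ν.trim T := by
  have : ∀ x, ν.PositiveAt η T x := fun x t ht a => h t ht a x
  simp only [regularize, trim, if_pos (this _)]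

theorem prodIntegral_zero (B : Set ℝ) : prodIntegral 0 B = 1 := by
  simp [prodIntegral]

theorem FiniteHazards.trim_regular (h : ν.FiniteHazards T) (hpos : ν.Positive η T) (hη : 0 < η)
    (hT : 0 < T) : (ν.trim T).Regular η T where
  eta_pos := hη
  time_pos := hT
  support δ a x := by
    rw [trim, Measure.restrict_apply measurableSet_Ioc.compl, compl_inter_self, measure_empty]
  finite δ a x := ⟨by
    rw [trim, Measure.restrict_apply MeasurableSet.univ, univ_inter]
    exact h δ a x⟩
  positive t ht a x := by
    rw [trim_surv ν ht.2, trim_censSurv ν ht.2]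
    exact hpos t ht a x

theorem FiniteHazards.regularize_regular (h : ν.FiniteHazards T) (hη : 0 < η) (hη1 : η < 1)
    (hT : 0 < T) : (ν.regularize η T).Regular η T where
  eta_pos := hη
  time_pos := hT
  support δ a x := by
    simp only [regularize]
    split_ifs
    · rw [Measure.restrict_apply measurableSet_Ioc.compl, compl_inter_self, measure_empty]
    · rfl
  finite δ a x := ⟨by
    simp only [regularize]
    split_ifs
    · rw [Measure.restrict_apply MeasurableSet.univ, univ_inter]
      exact h δ a x
    · simp⟩
  positive t ht a x := by
    by_cases hx : ν.PositiveAt η T x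
    · have h1 : (ν.regularize η T).surv t a x = (ν.trim T).surv t a x := by
        simp only [surv, allCause, regularize, if_pos hx, trim]
      have h2 : (ν.regularize η T).censSurv t a x = (ν.trim T).censSurv t a x := by
        simp only [censSurv, regularize, if_pos hx, trim]
      rw [h1, h2, trim_surv ν ht.2, trim_censSurv ν ht.2]
      simp only [regularize, if_pos hx]
      exact hx t ht a
    · simp only [surv, censSurv, allCause, regularize, if_neg hx, add_zero, prodIntegral_zero]
      exact ⟨hη1, hη1, hη1⟩

end

end Nuisance

/-- For a finite measure on `(0, T]`, positivity of the product integral can be read off the atoms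
and the value at the time horizon. The right-hand side is measurable in a parameter of `μ`. -/
theorem forall_lt_prodIntegral_iff {μ : Measure ℝ} [IsFiniteMeasure μ] {T η : ℝ} (hT0 : 0 ≤ T)
    (hη : 0 ≤ η) (hT : μ (Ioc 0 T)ᶜ = 0) :
    (∀ t ∈ Icc 0 T, η < prodIntegral μ (Ioc 0 t)) ↔
      μ {s | 1 ≤ μ.real {s}} = 0 ∧ η < Real.exp (-(logHaz μ).real (Iic T)) := by
  rw [← measureReal_eq_of_restrict_eq (restrict_Ioc_eq (logHaz_eq_zero hT) T)]
  have hatoms : μ {s | 1 ≤ μ.real {s}} = 0 ↔ ∀ s, μ.real {s} < 1 := by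
    refine ⟨fun h s => ?_, fun h => ?_⟩
    · by_contra hs
      have h0 : μ {s} = 0 := measure_mono_null (t := {s | 1 ≤ μ.real {s}})
        (singleton_subset_iff.2 (show 1 ≤ μ.real {s} from not_lt.1 hs)) h
      rw [measureReal_def, h0] at hs
      simp at hs
    · have : {s | 1 ≤ μ.real {s}} = ∅ := by
        ext s
        simpa using h s
      rw [this, measure_empty]
  rw [hatoms]
  refine ⟨fun h => ?_, fun h t ht => ?_⟩
  · have hat := atom_lt_one_of_prodIntegral_pos hT fun t ht => hη.trans_lt (h t ht)
    refine ⟨hat, ?_⟩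
    rw [← prodIntegral_eq_exp_neg_logHaz hat measurableSet_Ioc]
    exact h T ⟨hT0, le_rfl⟩
  · have := isFiniteMeasure_logHaz h.1
    rw [prodIntegral_eq_exp_neg_logHaz h.1 measurableSet_Ioc]
    refine h.2.trans_le (Real.exp_le_exp.2 (neg_le_neg ?_))
    exact measureReal_mono (Ioc_subset_Ioc_right ht.2)

theorem measurableSet_forall_lt_prodIntegral {Z : Type*} [MeasurableSpace Z] {m : Z → Measure ℝ}
    (hm : Measurable m) (hfin : ∀ z, IsFiniteMeasure (m z)) {T η : ℝ} (hT0 : 0 ≤ T) (hη : 0 ≤ η)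
    (hT : ∀ z, m z (Ioc 0 T)ᶜ = 0) :
    MeasurableSet {z | ∀ t ∈ Icc 0 T, η < prodIntegral (m z) (Ioc 0 t)} := by
  have h1 : MeasurableSet {z | m z {s | 1 ≤ (m z).real {s}} = 0} :=
    (measurable_measure_section hm hfin (A := {p : Z × ℝ | 1 ≤ (m p.1).real {p.2}})
      (measurableSet_le measurable_const (measurable_measureReal_atom hm hfin)))
      (measurableSet_singleton 0)
  have h2 : Measurable fun z => (logHaz (m z)).real (Iic T) := by
    have h := (measurable_logHaz_Iic hm hfin).comp (measurable_prodMk_right (y := T))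
    simpa only [Function.comp_def] using h
  have h3 : {z | ∀ t ∈ Icc 0 T, η < prodIntegral (m z) (Ioc 0 t)} =
      {z | m z {s | 1 ≤ (m z).real {s}} = 0} ∩
        {z | η < Real.exp (-(logHaz (m z)).real (Iic T))} := by
    ext z
    exact forall_lt_prodIntegral_iff hT0 hη (hT z)
  rw [h3]
  exact h1.inter (measurableSet_lt measurable_const h2.neg.exp)

namespace Nuisance

variable {𝒳 : Type*} [MeasurableSpace 𝒳] {ν : Nuisance 𝒳} {η T : ℝ}

theorem IsMeasurable.trim (hm : ν.IsMeasurable) : (ν.trim T).IsMeasurable where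
  haz δ a := Measure.measurable_of_measurable_coe _ fun s hs => by
    simp only [Nuisance.trim, Measure.restrict_apply hs]
    exact (Measure.measurable_coe (hs.inter measurableSet_Ioc)).comp (hm.haz δ a)
  ps := hm.ps

theorem IsMeasurable.measurableSet_positiveAt (hm : ν.IsMeasurable) (h : ν.FiniteHazards T)
    (hη : 0 < η) (hT : 0 < T) : MeasurableSet {x | ν.PositiveAt η T x} := by
  have hhaz : ∀ δ a x, IsFiniteMeasure ((ν.trim T).haz δ a x) := fun δ a x => ⟨by
    rw [Nuisance.trim, Measure.restrict_apply MeasurableSet.univ, univ_inter]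
    exact h δ a x⟩
  have hsupp : ∀ δ a x, (ν.trim T).haz δ a x (Ioc 0 T)ᶜ = 0 := fun δ a x => by
    rw [Nuisance.trim, Measure.restrict_apply measurableSet_Ioc.compl, compl_inter_self,
      measure_empty]
  have h1 : ∀ a, MeasurableSet {x | ∀ t ∈ Icc 0 T,
      η < prodIntegral ((ν.trim T).allCause a x) (Ioc 0 t)} := fun a =>
    measurableSet_forall_lt_prodIntegral (hm.trim.allCause a)
      (fun x => by rw [Nuisance.allCause]; infer_instance) hT.le hη.le fun x => by
        rw [Nuisance.allCause, Measure.add_apply, hsupp, hsupp, add_zero]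
  have h2 : ∀ a, MeasurableSet {x | ∀ t ∈ Icc 0 T,
      η < prodIntegral ((ν.trim T).haz 0 a x) (Ioc 0 t)} := fun a =>
    measurableSet_forall_lt_prodIntegral (hm.trim.haz 0 a) (fun x => hhaz 0 a x) hT.le hη.le
      fun x => hsupp 0 a x
  have h3 : ∀ a, MeasurableSet {x | η < ν.ps a x} := fun a =>
    measurableSet_lt measurable_const (hm.ps a)
  have : {x | ν.PositiveAt η T x} = ⋂ a,
      ({x | ∀ t ∈ Icc 0 T, η < prodIntegral ((ν.trim T).allCause a x) (Ioc 0 t)} ∩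
        ({x | ∀ t ∈ Icc 0 T, η < prodIntegral ((ν.trim T).haz 0 a x) (Ioc 0 t)} ∩
          {x | η < ν.ps a x})) := by
    ext x
    simp only [mem_iInter, mem_inter_iff, mem_ofPred_eq]
    refine ⟨fun hx a => ⟨fun t ht => ?_, fun t ht => ?_, (hx 0 ⟨le_rfl, hT.le⟩ a).2.2⟩,
      fun hx t ht a => ⟨?_, ?_, (hx a).2.2⟩⟩
    · have := (hx t ht a).1
      rwa [← trim_surv ν ht.2] at this
    · have := (hx t ht a).2.1
      rwa [← trim_censSurv ν ht.2] at this
    · rw [← trim_surv ν ht.2]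
      exact (hx a).1 t ht
    · rw [← trim_censSurv ν ht.2]
      exact (hx a).2.1 t ht
  rw [this]
  exact MeasurableSet.iInter fun a => (h1 a).inter ((h2 a).inter (h3 a))

theorem IsMeasurable.regularize (hm : ν.IsMeasurable) (h : ν.FiniteHazards T)
    (hη : 0 < η) (hT : 0 < T) : (ν.regularize η T).IsMeasurable where
  haz δ a := Measurable.ite (hm.measurableSet_positiveAt h hη hT) (hm.trim.haz δ a)
    measurable_const
  ps a := Measurable.ite (hm.measurableSet_positiveAt h hη hT) (hm.ps a) measurable_const

theorem remainder_trim (P : Measure (Obs 𝒳)) (ν ν' : Nuisance 𝒳) (j a : Fin 2) :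
    remainder P (ν.trim T) (ν'.trim T) j T a = remainder P ν ν' j T a := by
  refine integral_congr_ae (ae_of_all _ fun o => Finset.sum_congr rfl fun i _ => ?_)
  simp only
  rw [trim_restrict ν le_rfl, trim_restrict ν' le_rfl]
  congr 1 <;> refine setIntegral_congr_fun measurableSet_Ioc fun s hs => ?_ <;>
    simp only [trim_surv ν hs.2, trim_H ν' hs.2, trim_censSurv ν hs.2, trim_censSurv ν' hs.2] <;>
    rfl

theorem psi_trim (P : Measure (Obs 𝒳)) (ν : Nuisance 𝒳) (j : Fin 2) (hT : 0 ≤ T) :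
    psi P (ν.trim T) j T = psi P ν j T := by
  simp only [psi, trim_cate ν hT]

theorem psiTilde_trim (P : Measure (Obs 𝒳)) (ν : Nuisance 𝒳) (j : Fin 2) (hT : 0 ≤ T) :
    psiTilde P (ν.trim T) j T = psiTilde P ν j T := by
  ext o
  rw [psiTilde, psiTilde, trim_phi ν hT, psi_trim P ν j hT]

theorem meanSquareError_trim (P : Measure (Obs 𝒳)) (ν ν' : Nuisance 𝒳) :
    meanSquareError P T (ν.trim T) (ν'.trim T) = meanSquareError P T ν ν' := by
  ext i
  match i with
  | .inl p =>
    refine lintegral_congr fun o => ?_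
    congr 1
    exact iSup_congr fun s => iSup_congr fun hs => by rw [trim_cumHaz ν hs.2, trim_cumHaz ν' hs.2]
  | .inr a => rfl

end Nuisance

/-! ### Asymptotic normality -/

section

variable {𝒳 : Type*} [MeasurableSpace 𝒳]

/-- Hazard measures with a density have no atoms; cutting them off does not affect the model
assumption, which concerns times up to `T`. -/
theorem IsTrueNuisance.isModel {P : Measure (Obs 𝒳)} {T : ℝ}
    {lam : Fin 3 → ℝ → Fin 2 → 𝒳 → ℝ≥0} {ps : Fin 2 → 𝒳 → ℝ} (h : IsTrueNuisance P T lam ps) :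
    ((trueNuisance lam ps).trim T).IsModel P T where
  haz δ a := Measure.measurable_of_measurable_coe _ fun s hs => by
    simp only [Nuisance.trim, Measure.restrict_apply hs, trueNuisance,
      withDensity_apply _ (hs.inter measurableSet_Ioc)]
    exact Measurable.lintegral_prod_left' (f := fun p : ℝ × 𝒳 => (lam δ p.1 a p.2 : ℝ≥0∞))
      (h.measurable_lam δ a).coe_nnreal_ennreal
  ps := h.measurable_ps
  noAtoms δ a x := by
    simp only [Nuisance.trim, trueNuisance]
    infer_instance
  hazard δ t ht B hB := by
    rw [h.hazard δ t ht B hB]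
    refine lintegral_congr fun o => ?_
    rw [Nuisance.trim, Measure.restrict_apply measurableSet_Iic]
    congr 1
    ext s
    simp only [mem_Ioc, mem_inter_iff, mem_Iic]
    exact ⟨fun hs => ⟨hs.2, hs.1, (hs.2.trans (min_le_left _ _)).trans ht.2⟩,
      fun hs => ⟨hs.2.1, hs.1⟩⟩
  propensity := h.propensity

end

section

variable {𝒳 : Type*}

theorem Nuisance.Positive.mono {ν : Nuisance 𝒳} {η η' T : ℝ} (h : ν.Positive η T) (hη : η' ≤ η) :
    ν.Positive η' T := fun t ht a x =>
  ⟨hη.trans_lt (h t ht a x).1, hη.trans_lt (h t ht a x).2.1, hη.trans_lt (h t ht a x).2.2⟩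

/-- The learner with regularized estimates. -/
def Learner.regularize {K : ℕ} (alg : Learner 𝒳 K) (η T : ℝ) : Learner 𝒳 K :=
  fun n k s d => (alg n k s d).regularize η T

theorem crossFit_eq_of_phi {K : ℕ} {alg alg' : Learner 𝒳 K} {j : Fin 2} {T : ℝ} {n : ℕ}
    {s : Fin n → Fin K} {d : Fin n → Obs 𝒳}
    (h : ∀ k o, (alg' n k s d).phi j T o = (alg n k s d).phi j T o) :
    crossFit alg' j T n s d = crossFit alg j T n s d := by
  simp only [crossFit, h]

variable [MeasurableSpace 𝒳]

theorem Learner.IsLeaveOut.joint_regularize {K : ℕ} {alg : Learner 𝒳 K} {η T : ℝ}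
    (h : alg.IsLeaveOut T) (hη : 0 < η) (hT : 0 < T) (n : ℕ) (k : Fin K) (s : Fin n → Fin K) :
    ((alg.regularize η T).joint n k s).IsMeasurable := by
  have hm : (alg.joint n k s).IsMeasurable := ⟨h.measurable_haz n k s, h.measurable_ps n k s⟩
  exact hm.regularize (fun δ a p => h.finite n k s p.1 δ a p.2) hη hT

theorem Learner.measurable_crossFit {K : ℕ} {alg : Learner 𝒳 K} {η T : ℝ} (hη : 0 < η)
    (hT : 0 < T) (hreg : ∀ n k s d, (alg n k s d).Regular η T)
    (hm : ∀ n k s, (alg.joint n k s).IsMeasurable) (j : Fin 2) (n : ℕ) :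
    Measurable fun p : (Fin n → Fin K) × (Fin n → Obs 𝒳) => crossFit alg j T n p.1 p.2 :=
  measurable_from_prod_countable_right fun s => by
    refine measurable_const.mul (Finset.measurable_fun_sum
      (f := fun k d => ∑ i : Fin n with s i = k, (alg n k s d).phi j T (d i)) _ fun k _ =>
      Finset.measurable_fun_sum (f := fun i d => (alg n k s d).phi j T (d i)) _ fun i _ => ?_)
    exact (Learner.measurable_phi hη hT (hreg n k s) (hm n k s) j).comp
      (measurable_id.prodMk (measurable_pi_apply i))

end

end

end LifeYearsLost

open LifeYearsLost
theorem theorem1 {Ω 𝒳 : Type*} [MeasurableSpace Ω] [MeasurableSpace 𝒳]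
    (μ : Measure Ω) [IsProbabilityMeasure μ]
    -- the distribution of an observation, its hazards and its propensity score
    (P : Measure (Obs 𝒳)) (tstar : ℝ) (htstar : 0 < tstar)
    (lam : Fin 3 → ℝ → Fin 2 → 𝒳 → ℝ≥0) (ps : Fin 2 → 𝒳 → ℝ)
    (hP : IsTrueNuisance P tstar lam ps)
    -- an i.i.d. sample from this distribution
    (O : ℕ → Ω → Obs 𝒳) (hO_meas : ∀ i, Measurable (O i)) (hO_indep : iIndepFun O μ)
    (hO_law : ∀ i, μ.map (O i) = P)
    -- independent, uniformly distributed fold labels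
    (K : ℕ) (hK : 0 < K)
    (split : (n : ℕ) → Ω → (Fin n → Fin K)) (hsplit_meas : ∀ n, Measurable (split n))
    (hsplit_law : ∀ n s, μ (split n ⁻¹' {s}) = ((K : ℝ≥0∞)⁻¹) ^ n)
    (hsplit_indep : ∀ n, IndepFun (split n) (fun ω (i : Fin n) => O i ω) μ)
    -- the nuisance estimators, each fitted on the data outside its fold
    (alg : Learner 𝒳 K) (halg : alg.IsLeaveOut tstar)
    (j : Fin 2)
    (hnuis : ∀ k : Fin K, NuisanceAssumption μ P (trueNuisance lam ps) j tstar
      (fun n ω => alg n k (split n ω) (fun i => O i ω))) :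
    MemLp (psiTilde P (trueNuisance lam ps) j tstar) 2 P ∧
    ∫ o, psiTilde P (trueNuisance lam ps) j tstar o ∂P = 0 ∧
    TendstoInMeasure μ
      (fun (n : ℕ) ω => √(n : ℝ) *
        (crossFit alg j tstar n (split n ω) (fun i => O i ω) - psi P (trueNuisance lam ps) j tstar -
          (1 / (n : ℝ)) * ∑ i : Fin n, psiTilde P (trueNuisance lam ps) j tstar (O i ω)))
      atTop (fun _ => (0 : ℝ)) ∧
    TendstoInDistribution
      (fun (n : ℕ) ω => √(n : ℝ) *
        (crossFit alg j tstar n (split n ω) (fun i => O i ω) - psi P (trueNuisance lam ps) j tstar))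
      atTop (id : ℝ → ℝ) (fun _ => μ)
      (gaussianReal 0 (∫ o, psiTilde P (trueNuisance lam ps) j tstar o ^ 2 ∂P).toNNReal) := by
  have hPprob : IsProbabilityMeasure P := by
    rw [← hO_law 0]
    exact Measure.isProbabilityMeasure_map (hO_meas 0).aemeasurable
  have : Nonempty (Fin K) := ⟨⟨0, hK⟩⟩
  -- a common positivity constant for all folds, smaller than one
  choose ηk hηk hpos₀ hpos using fun k => (hnuis k).positivity
  obtain ⟨k₀, hk₀⟩ := Finite.exists_min ηk
  set η := min (ηk k₀) (1 / 2) with hη_def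
  have hη : 0 < η := lt_min (hηk k₀) (by norm_num)
  have hη1 : η < 1 := (min_le_right _ _).trans_lt (by norm_num)
  have hηle : ∀ k, η ≤ ηk k := fun k => (min_le_left _ _).trans (hk₀ k)
  -- cut off at the time horizon, and regularize where positivity fails
  set ν₀ := trueNuisance lam ps with hν₀
  have hmodel : (ν₀.trim tstar).IsModel P tstar := hP.isModel
  have hreg₀ : (ν₀.trim tstar).Regular η tstar :=
    hP.finite.trim_regular ((hpos₀ k₀).mono (hηle k₀)) hη htstar
  set alg' := alg.regularize η tstar with halg'
  have hreg : ∀ n k s d, (alg' n k s d).Regular η tstar := fun n k s d =>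
    (halg.finite n k s d).regularize_regular hη hη1 htstar
  have hjoint : ∀ n k s, (alg'.joint n k s).IsMeasurable := halg.joint_regularize hη htstar
  have htrim : ∀ n, ∀ᵐ ω ∂μ, ∀ k, alg' n k (split n ω) (fun i => O i ω) =
      (alg n k (split n ω) (fun i => O i ω)).trim tstar := fun n => by
    rw [ae_all_iff]
    intro k
    filter_upwards [hpos k n] with ω hω
    exact Nuisance.regularize_eq_trim (hω.mono (hηle k))
  have hcross : ∀ n, ∀ᵐ ω ∂μ, crossFit alg' j tstar n (split n ω) (fun i => O i ω) =
      crossFit alg j tstar n (split n ω) (fun i => O i ω) := fun n => by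
    filter_upwards [htrim n] with ω hω
    exact crossFit_eq_of_phi fun k o => by rw [hω k, Nuisance.trim_phi _ htstar.le]
  have hψ : psi P (ν₀.trim tstar) j tstar = psi P ν₀ j tstar :=
    Nuisance.psi_trim P ν₀ j htstar.le
  have hψt : psiTilde P (ν₀.trim tstar) j tstar = psiTilde P ν₀ j tstar :=
    Nuisance.psiTilde_trim P ν₀ j htstar.le
  -- almost surely the regularized estimates are the given ones cut off at the horizon, so that the
  -- consistency and remainder assumptions carry over to them
  have hlin := Learner.tendstoInMeasure_crossFit hmodel hreg₀ hO_meas hO_indep hO_law hsplit_meas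
    hsplit_indep hreg hjoint
    (fun n k s d d' h => by simp only [halg', Learner.regularize, halg.leaveOut n k s d d' h]) j
    (fun k i => by
      have hi : SmallInMeasure μ fun n ω =>
          Nuisance.meanSquareError P tstar ν₀ (alg n k (split n ω) fun i => O i ω) i :=
        match i with
        | .inl p => TendstoInMeasure.small_ennreal ((hnuis k).hazard_consistent p.1 p.2)
        | .inr a => TendstoInMeasure.small_ennreal ((hnuis k).ps_consistent a)
      refine SmallInMeasure.of_le_sum (ι := Unit) (fun _ => hi) ENNReal.one_ne_top fun n => ?_
      filter_upwards [htrim n] with ω hω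
      rw [hω k, Nuisance.meanSquareError_trim]
      simp)
    (fun k a => TendstoInMeasure.congr (fun n => by
      filter_upwards [htrim n] with ω hω
      rw [hω k, Nuisance.remainder_trim]) (ae_eq_refl _) ((hnuis k).remainder_small a))
  have hlin' : TendstoInMeasure μ (fun (n : ℕ) ω => √(n : ℝ) *
      (crossFit alg j tstar n (split n ω) (fun i => O i ω) - psi P ν₀ j tstar -
        (1 / (n : ℝ)) * ∑ i : Fin n, psiTilde P ν₀ j tstar (O i ω))) atTop fun _ => 0 := by
    refine TendstoInMeasure.congr (fun n => ?_) (ae_eq_refl _) hlin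
    filter_upwards [hcross n] with ω hω
    rw [hω, hψ, hψt]
  -- the influence function is bounded, hence square integrable
  have hphim : Measurable ((ν₀.trim tstar).phi j tstar) := hmodel.toIsMeasurable.phi hreg₀ j
  have hψm : Measurable (psiTilde P ν₀ j tstar) := by
    rw [← hψt]
    exact hphim.sub_const _
  obtain ⟨C, hC⟩ := Nuisance.Regular.exists_abs_phi_le (𝒳 := 𝒳) η tstar
  have hL2 : MemLp (psiTilde P ν₀ j tstar) 2 P := by
    refine MemLp.of_bound hψm.aestronglyMeasurable (C + |psi P ν₀ j tstar|)
      (ae_of_all _ fun o => ?_)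
    rw [← hψt, psiTilde, hψ]
    exact (norm_sub_le _ _).trans (add_le_add (hC hreg₀ j o) le_rfl)
  have hmean : ∫ o, psiTilde P ν₀ j tstar o ∂P = 0 := by
    rw [← hψt]
    simp only [psiTilde]
    rw [integral_sub (Integrable.of_bound hphim.aestronglyMeasurable C
      (ae_of_all _ fun o => hC hreg₀ j o)) (integrable_const _), hmodel.integral_phi hreg₀ j]
    simp
  refine ⟨hL2, hmean, hlin', ?_⟩
  -- the average of `psiTilde` obeys the central limit theorem, and Slutsky's lemma transfers the
  -- limit to the estimator
  have hident : ∀ i, IdentDistrib (fun ω => psiTilde P ν₀ j tstar (O i ω))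
      (fun ω => psiTilde P ν₀ j tstar (O 0 ω)) μ μ := fun i =>
    IdentDistrib.comp (u := psiTilde P ν₀ j tstar)
      ⟨(hO_meas i).aemeasurable, (hO_meas 0).aemeasurable, by rw [hO_law, hO_law]⟩ hψm
  have hmean0 : ∫ ω, psiTilde P ν₀ j tstar (O 0 ω) ∂μ = 0 := by
    rw [← integral_map (hO_meas 0).aemeasurable hψm.aestronglyMeasurable, hO_law, hmean]
  have hvar : Var[fun ω => psiTilde P ν₀ j tstar (O 0 ω); μ] =
      ∫ o, psiTilde P ν₀ j tstar o ^ 2 ∂P := by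
    rw [variance_of_integral_eq_zero (X := fun ω => psiTilde P ν₀ j tstar (O 0 ω))
      (hψm.comp (hO_meas 0)).aemeasurable hmean0,
      ← integral_map (f := fun o => psiTilde P ν₀ j tstar o ^ 2) (hO_meas 0).aemeasurable
        (hψm.pow_const 2).aestronglyMeasurable, hO_law]
  have hclt := tendstoInDistribution_inv_sqrt_mul_sum_sub (P := μ)
    (P' := gaussianReal 0 (∫ o, psiTilde P ν₀ j tstar o ^ 2 ∂P).toNNReal) (Y := id)
    (X := fun i ω => psiTilde P ν₀ j tstar (O i ω)) (by rw [hvar]; exact HasLaw.id)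
    (hL2.comp_measurePreserving ⟨hO_meas 0, hO_law 0⟩)
    (hO_indep.comp (fun _ => psiTilde P ν₀ j tstar) fun _ => hψm) hident
  refine tendstoInDistribution_of_tendstoInMeasure_sub _ _ hclt ?_ fun n => ?_
  · refine TendstoInMeasure.congr (fun n => ae_of_all _ fun ω => ?_) (ae_eq_refl _) hlin'
    simp only [Pi.sub_apply, hmean0, mul_zero, sub_zero]
    rw [Finset.sum_range, mul_sub, ← mul_assoc, mul_one_div, Real.sqrt_div_self', one_div]
  · have hm := (Learner.measurable_crossFit hη htstar hreg hjoint j n).comp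
      ((hsplit_meas n).prodMk (measurable_pi_iff.2 fun i : Fin n => hO_meas i))
    refine AEMeasurable.congr ((hm.sub_const (psi P ν₀ j tstar)).const_mul
      (√(n : ℝ))).aemeasurable ?_
    filter_upwards [hcross n] with ω hω
    simp only [Function.comp_apply, hω]
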